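/- **Notation.** Let $\mathfrak g$ be a finite-dimensional complex Lie algebra with basis $J^a$, let $\delta^{ab}=\delta_2(J^a,J^b)$ for a symmetric invariant bilinear form $\delta_2$ on $\mathfrak g$, and $\delta^a=\delta_1(J^a)$ for a linear functional $\delta_1$ vanishing on $[\mathfrak g,\mathfrak g]$. Let $N,p\ge 0$ be integers. Repeated indices are summed ($\mu,\nu,\rho,\dots=1,\dots,N$); $\mathbf m,\mathbf n,\mathbf r,\mathbf s$ run over multi-indices in $\mathbb Z_{\ge0}^N$ of length $\le p$, $\mu$ also denotes the unit multi-index in direction $\mu$, $\partial_{\mathbf m}=\partial_1^{m_1}\cdots\partial_N^{m_N}$, and $\binom{\mathbf m}{\mathbf n}=\prod_\mu\binom{m_\mu}{n_\mu}$ (terms with $\mathbf n\not\le\mathbf m$ are absent). Integrals $\int dt$ are over the circle $0\le t<2\pi$, fields are formal Fourier series $B(t)=\sum_{n\in\mathbb Z}B_ne^{int}$, and brackets of fields are understood after smearing with trigonometric polynomials. $gl(N)$ has basis $T^\mu_\nu$ with $[T^\mu_\nu,T^\rho_\sigma]=\delta^\rho_\nu T^\mu_\sigma-\delta^\mu_\sigma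 T^\rho_\nu$. **The algebra $Vir\ltimes\widehat{\mathcal U}(\mathfrak g\oplus gl(N),N,p)$.** Let $I^A$ run over the universal enveloping algebra $U(\mathfrak g\oplus gl(N))$, with $I^\emptyset=1$, and let $I^M=I^{\mathbf mA}_{\mathbf n}$ be the matrix over $U(\mathfrak g\oplus gl(N))$, with rows and columns indexed by multi-indices of length $\le p$, whose only nonzero entry is $I^A$ at $(\mathbf m,\mathbf n)$; it is $0$ if $|\mathbf m|>p$ or $|\mathbf n|>p$. With $[I^M,I^N]$ the commutator of matrices, the algebra is spanned by smeared currents $I^M(t)$, $F(t)$ and a central element $1$, with brackets $$[I^M(s),I^N(t)]=[I^M,I^N](s)\,\delta(s-t)+\tfrac{k^{MN}}{2\pi i}\dot\delta(s-t),$$ $$[F(s),I^M(t)]=I^M(s)\,\dot\delta(s-t)+\tfrac{d^M}{4\pi i}\big(\ddot\delta(s-t)+i\dot\delta(s-t)\big),$$ $$[F(s),F(t)]=(F(s)+F(t))\,\dot\delta(s-t)+\tfrac{c(N,p)}{24\pi i}\big(\dddot\delta(s-t)+\dot\delta(s-t)\big).$$ Here $c(N,p)\in\mathbb C$, and for $M={}^{\mathbf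 mA}_{\mathbf n}$, $N={}^{\mathbf rB}_{\mathbf s}$ we have $k^{MN}=\delta^{\mathbf r}_{\mathbf n}\delta^{\mathbf m}_{\mathbf s}k^{AB}$ and $d^M=\delta^{\mathbf m}_{\mathbf n}d^A$, where $k$ is a symmetric bilinear form and $d$ a linear functional on $U(\mathfrak g\oplus gl(N))$ such that the matrix form satisfies the cyclicity condition $k([I^M,I^N],I^R)=k([I^N,I^R],I^M)$ and $d$ vanishes on matrix commutators (so that the Jacobi identities hold). On $1$, $J^a$, $T^\mu_\nu$ suppose $$k^{\mu\rho}_{\nu\sigma}=k_1\delta^\mu_\sigma\delta^\rho_\nu+k_2\delta^\mu_\nu\delta^\rho_\sigma,\quad k^{\mu\emptyset}_\nu=k_3\delta^\mu_\nu,\quad k^{\emptyset\emptyset}=k_4,\quad k^{ab}=k_5\delta^{ab}+k_8\delta^a\delta^b,\quad k^{a\emptyset}=k_6\delta^a,\quad k^{\mu a}_\nu=k_7\delta^\mu_\nu\delta^a,$$ $$d^\emptyset=d_0,\qquad d^\mu_\nu=d_1\delta^\mu_\nu,\qquad d^a=d_2\delta^a .$$ Put $E^{\mathbf m}_{\mathbf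 n}=I^{\mathbf m\emptyset}_{\mathbf n}$, and let $J^{\mathbf ma}_{\mathbf n}$, $T^{\mathbf m\mu}_{\mathbf n\nu}$ be $I^{\mathbf mA}_{\mathbf n}$ with $I^A=J^a$, resp. $I^A=T^\mu_\nu$. Let $V$ be a module over this algebra on which $1$ acts as the identity and such that for every current $I^M$ and $v\in V$ the modes $I^M_n v$ vanish for all sufficiently large $n$. **The trajectory.** Let $q^\mu(t)$, $p_\mu(t)$ be the fields with $[p_\mu(s),q^\nu(t)]=\delta^\nu_\mu\delta(s-t)$, $[q^\mu(s),q^\nu(t)]=[p_\mu(s),p_\nu(t)]=0$, acting on the Fock space $\mathcal F=C^\infty(\mathbb R^N,\mathbb C)\otimes\mathbb C[q^\mu_{-n},p_{\mu,-n}:n\ge1]$: modes of positive frequency $n>0$ annihilate $1$, $q^\mu_0$ acts by multiplication by $x^\mu$ and $p_{\mu,0}$ as $\frac1{2\pi}\partial_\mu$ on the first factor. For a smooth function $\varphi:\mathbb R^N\to\mathbb C$, $\varphi(q(t))$ is defined by Taylor expansion around the zero mode $q_0$. In $:B(t)p_\mu(t):$ the modes $p_{\mu,n}$ with $n<0$ are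 placed to the left and those with $n\ge0$ to the right. The operators on $\mathcal F$ and on $V$ act together on $\mathcal F\otimes V$, in different factors. For a smooth complex vector field $\xi=\xi^\mu\partial_\mu$ and a smooth $\mathfrak g$-valued function $X=X_aJ^a$ on $\mathbb R^N$, and a trigonometric polynomial $f$, define on $\mathcal F\otimes V$ $$\mathcal L_\xi=\int dt\,\Big\{:\!\xi^\mu(q(t))p_\mu(t)\!:-\,\xi^\mu(q(t))P_\mu(t)+\sum_{\mathbf m,\mathbf n}\tbinom{\mathbf m}{\mathbf n}\partial_{\mathbf m-\mathbf n}\xi^\mu(q(t))E^{\mathbf m}_{\mathbf n+\mu}(t)\Big\}+T_{d\xi},\qquad P_\mu(t)=\sum_{\mathbf m}E^{\mathbf m}_{\mathbf m+\mu}(t),$$ $$T_{d\xi}=\int dt\sum_{\mathbf m,\mathbf n}\tbinom{\mathbf m}{\mathbf n}\partial_{\mathbf m-\mathbf n+\nu}\xi^\mu(q(t))T^{\mathbf m\nu}_{\mathbf n\mu}(t),\qquad \mathcal J_X=\int dt\sum_{\mathbf m,\mathbf n}\tbinom{\mathbf m}{\mathbf n}\partial_{\mathbf m-\mathbf n}X_a(q(t))J^{\mathbf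 ma}_{\mathbf n}(t),$$ $$L_f=\int dt\,f(t)\big(-:\!\dot q^\mu(t)p_\mu(t)\!:+F(t)\big).$$ **Theorem.** All infinite sums in these definitions are locally finite (only finitely many terms are nonzero on each vector), and the Taylor expansion of the coordinate function $x^\mu$ is $q^\mu(t)$. The operators $\mathcal L_\xi$, $\mathcal J_X$, $L_f$ are linear in $\xi$, $X$, $f$. The assignment $\varphi\mapsto\varphi(q(t))$ is linear, unital and multiplicative, and obeys the chain rule $\frac{d}{dt}\varphi(q(t))=\dot q^\mu(t)\,\partial_\mu\varphi(q(t))$, with all products locally finite. The relations of the algebra $DGRO(N,\mathfrak g)$ hold: $$[\mathcal L_\xi,\mathcal L_\eta]=\mathcal L_{[\xi,\eta]}+\tfrac1{2\pi i}\int dt\,\dot q^\rho(t)\big\{c_1\partial_\rho\partial_\nu\xi^\mu\,\partial_\mu\eta^\nu+c_2\partial_\rho\partial_\mu\xi^\mu\,\partial_\nu\eta^\nu\big\}(q(t)),$$ $$[\mathcal L_\xi,\mathcal J_X]=\mathcal J_{\xi X}-\tfrac{c_7}{2\pi i}\delta^a\int dt\,\dot q^\rho(t)\,(X_a\,\partial_\rho\partial_\mu\xi^\mu)(q(t)),\qquad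 (\xi X)_a=\xi^\mu\partial_\mu X_a,$$ $$[\mathcal J_X,\mathcal J_Y]=\mathcal J_{[X,Y]}-\tfrac1{2\pi i}(c_5\delta^{ab}+c_8\delta^a\delta^b)\int dt\,\dot q^\rho(t)\,(\partial_\rho X_a\,Y_b)(q(t)),$$ $$[L_f,\mathcal L_\xi]=\tfrac{c_3}{4\pi i}\int dt\,(\ddot f(t)-i\dot f(t))\,\partial_\mu\xi^\mu(q(t)),\qquad [L_f,\mathcal J_X]=\tfrac{c_6}{4\pi i}\delta^a\int dt\,(\ddot f(t)-i\dot f(t))\,X_a(q(t)),$$ $$[L_f,L_h]=L_{f\dot h-\dot fh}+\tfrac{c_4}{24\pi i}\int dt\,(\ddot f(t)\dot h(t)-\dot f(t)h(t)),$$ $$[\mathcal L_\xi,q^\mu(t)]=\xi^\mu(q(t)),\quad[L_f,q^\mu(t)]=-f(t)\dot q^\mu(t),\quad[\mathcal J_X,q^\mu(t)]=[q^\mu(s),q^\nu(t)]=0,$$ the last line extending by Leibniz' rule to all functions of $q(t)$: $[\mathcal L_\xi,\varphi(q(t))]=(\xi^\mu\partial_\mu\varphi)(q(t))$, $[L_f,\varphi(q(t))]=-f(t)\frac{d}{dt}\varphi(q(t))$,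 $[\mathcal J_X,\varphi(q(t))]=[\varphi(q(s)),\psi(q(t))]=0$. The abelian charges are $$c_1=1-k_1\tbinom{N+p}{N}-k_4\tbinom{N+p+1}{N+2},\qquad c_2=-k_2\tbinom{N+p}{N}-2k_3\tbinom{N+p}{N+1}-k_4\tbinom{N+p}{N+2},$$ $$c_3=1+d_1\tbinom{N+p}{N}+d_0\tbinom{N+p}{N+1},\qquad c_4=2N+c(N,p),\qquad c_5=k_5\tbinom{N+p}{N},\qquad c_6=d_2\tbinom{N+p}{N},$$ $$c_7=k_7\tbinom{N+p}{N}+k_6\tbinom{N+p}{N+1},\qquad c_8=k_8\tbinom{N+p}{N}.$$ -/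

import Mathlib

open scoped TensorProduct LaurentPolynomial ContDiff

noncomputable section

attribute [local instance] LieRing.ofAssociativeRing LieAlgebra.ofAssociativeAlgebra

namespace DGRO

/-! ### Trigonometric polynomials on the circle -/

/-- Trigonometric polynomials on the circle `0 ≤ t < 2π`: the monomial `T n` is `exp (i n t)`. -/
abbrev Trig : Type := LaurentPolynomial ℂ

namespace Trig

/-- The derivative `d/dt`, i.e. `exp (i n t) ↦ i n exp (i n t)`. -/
def dot : Trig →ₗ[ℂ] Trig where
  toFun f := .ofCoeff (Finsupp.onFinset f.coeff.support
    (fun n => Complex.I * n * f.coeff n) (by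
      intro n hn
      rw [Finsupp.mem_support_iff]
      exact right_ne_zero_of_mul hn))
  map_add' f g := by
    ext n
    simp [mul_add]
  map_smul' a f := by
    ext n
    simp
    ring

/-- The integral over the circle, `∫ f(t) dt = 2π f₀`. -/
def integral : Trig →ₗ[ℂ] ℂ where
  toFun f := 2 * (Real.pi : ℂ) * f.coeff 0
  map_add' f g := by simp [mul_add]
  map_smul' a f := by simp; ring

lemma coeff_dot (f : Trig) (n : ℤ) : (dot f).coeff n = Complex.I * n * f.coeff n := rfl

lemma dot_single (n : ℤ) (a : ℂ) :
    dot (AddMonoidAlgebra.single n a) = AddMonoidAlgebra.single n (Complex.I * n * a) := by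
  ext m
  simp only [coeff_dot, AddMonoidAlgebra.coeff_single, Finsupp.single_apply]
  split_ifs with h <;> simp [h]

lemma dot_mul (f g : Trig) : dot (f * g) = dot f * g + f * dot g := by
  induction f using AddMonoidAlgebra.induction_linear with
  | zero => simp
  | add f₁ f₂ h₁ h₂ => simp only [add_mul, map_add, h₁, h₂]; ring
  | single m a =>
    induction g using AddMonoidAlgebra.induction_linear with
    | zero => simp
    | add g₁ g₂ h₁ h₂ => simp only [mul_add, map_add, h₁, h₂]; ring
    | single n b =>
      simp only [AddMonoidAlgebra.single_mul_single, dot_single, ← AddMonoidAlgebra.single_add]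
      congr 1
      push_cast
      ring

lemma integral_dot (f : Trig) : integral (dot f) = 0 := by
  simp [integral, coeff_dot]

end Trig

/-! ### The associative algebra and the central charges -/

/-- Multi-indices `m = (m₁, …, m_N)` of length `|m| ≤ p`. -/
def multiIndices (N p : ℕ) : Finset (Fin N → ℕ) :=
  (Fintype.piFinset fun _ => Finset.range (p + 1)).filter fun m => ∑ μ, m μ ≤ p

variable (g : Type*) [LieRing g] [LieAlgebra ℂ g] (N p : ℕ)

/-- The universal enveloping algebra `U(g ⊕ gl(N))`. -/
abbrev Env : Type _ := UniversalEnvelopingAlgebra ℂ (g × Matrix (Fin N) (Fin N) ℂ)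

/-- The span of the `I^{m A}_n`, with `I^{m A}_n` the matrix with entry `I^A` at `(m, n)`; its
commutator is the bracket of `U(g ⊕ gl(N), N, p)`. -/
abbrev EnvMat : Type _ := Matrix (multiIndices N p) (multiIndices N p) (Env g N)

/-- The matrix `k^{MN}`: the bilinear form with
`(I^{m A}_n, I^{r B}_s) ↦ δ^r_n δ^m_s k^{AB}`. -/
def matForm (k : LinearMap.BilinForm ℂ (Env g N)) : LinearMap.BilinForm ℂ (EnvMat g N p) :=
  ∑ m, ∑ n, k.compl₁₂ (Matrix.entryLinearMap ℂ (Env g N) m n)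
    (Matrix.entryLinearMap ℂ (Env g N) n m)

/-- The functional `d^M`: `I^{m A}_n ↦ δ^m_n d^A`. -/
def matFunctional (d : Env g N →ₗ[ℂ] ℂ) : EnvMat g N p →ₗ[ℂ] ℂ :=
  d ∘ₗ Matrix.traceLinearMap (multiIndices N p) ℂ (Env g N)

/-- The parameters of `Vir ⋉ Û(g ⊕ gl(N), N, p)`: the central charge matrix `k^{AB}`, the
functional `d^A` and the Virasoro central charge `c(N, p)`, subject to the conditions
`k^{NM} = k^{MN}`, `f^{MN}_S k^{SR} = f^{NR}_S k^{SM}`, `f^{MN}_R d^R = 0` without which the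
brackets would not be those of a Lie algebra. -/
structure CentralData where
  k : LinearMap.BilinForm ℂ (Env g N)
  d : Env g N →ₗ[ℂ] ℂ
  c : ℂ
  k_symm : ∀ a b, k a b = k b a
  k_cyclic : ∀ x y z : EnvMat g N p,
    matForm g N p k (x * y - y * x) z = matForm g N p k (y * z - z * y) x
  d_commutator : ∀ x y : EnvMat g N p, matFunctional g N p d (x * y - y * x) = 0

variable {g N p}

/-! ### The Lie algebra `Vir ⋉ Û(g ⊕ gl(N), N, p)` -/

/-- Loops in `EnvMat`; `f ⊗ₜ M` stands for the smeared current `∫ f(t) I^M(t) dt`. -/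
abbrev Loop (g : Type*) [LieRing g] [LieAlgebra ℂ g] (N p : ℕ) : Type _ :=
  Trig ⊗[ℂ] EnvMat g N p

namespace Loop

/-- `d/dt` on loops. -/
def dot : Loop g N p →ₗ[ℂ] Loop g N p := Trig.dot.rTensor (EnvMat g N p)

lemma dot_mul (x y : Loop g N p) : dot (x * y) = dot x * y + x * dot y := by
  induction x using TensorProduct.induction_on with
  | zero => simp
  | add x₁ x₂ h₁ h₂ => simp only [add_mul, map_add, h₁, h₂]; abel
  | tmul f M =>
    induction y using TensorProduct.induction_on with
    | zero => simp
    | add x₁ x₂ h₁ h₂ => simp only [mul_add, map_add, h₁, h₂]; abel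
    | tmul h M' => simp [dot, Trig.dot_mul, TensorProduct.add_tmul]

lemma dot_smul (f : Trig) (x : Loop g N p) : dot (f • x) = Trig.dot f • x + f • dot x := by
  induction x using TensorProduct.induction_on with
  | zero => simp
  | add x₁ x₂ h₁ h₂ => simp only [smul_add, map_add, h₁, h₂]; abel
  | tmul h M => simp [dot, TensorProduct.smul_tmul', Trig.dot_mul, TensorProduct.add_tmul]

end Loop

namespace CentralData

variable (K : CentralData g N p)

/-- `k^{MN}` extended to loops: `(f I^M, h I^N) ↦ k^{MN} f h`. -/
def form : LinearMap.BilinForm Trig (Loop g N p) := (matForm g N p K.k).baseChange Trig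

/-- `d^M` extended to loops: `f I^M ↦ d^M f`. -/
def functional : Loop g N p →ₗ[Trig] Trig :=
  (TensorProduct.AlgebraTensorModule.rid ℂ Trig Trig).toLinearMap ∘ₗ
    (matFunctional g N p K.d).baseChange Trig

lemma form_symm (x y : Loop g N p) : K.form x y = K.form y x := by
  refine (LinearMap.BilinForm.IsSymm.baseChange Trig ⟨fun M M' => ?_⟩).eq x y
  simp only [matForm, LinearMap.sum_apply, LinearMap.compl₁₂_apply,
    Matrix.entryLinearMap_apply, RingHom.id_apply]
  rw [Finset.sum_comm]
  exact Finset.sum_congr rfl fun _ _ => Finset.sum_congr rfl fun _ _ => K.k_symm _ _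

lemma form_tmul (f h : Trig) (M M' : EnvMat g N p) :
    K.form (f ⊗ₜ M) (h ⊗ₜ M') = matForm g N p K.k M M' • (f * h) := by
  simp [form]

lemma functional_tmul (f : Trig) (M : EnvMat g N p) :
    K.functional (f ⊗ₜ M) = matFunctional g N p K.d M • f := by
  simp [functional]

lemma form_cyclic (x y z : Loop g N p) :
    K.form (x * y - y * x) z = K.form (y * z - z * y) x := by
  induction x using TensorProduct.induction_on with
  | zero => simp
  | add x₁ x₂ h₁ h₂ =>
    rw [map_add, ← h₁, ← h₂, ← LinearMap.add_apply, ← map_add]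
    congr 2
    noncomm_ring
  | tmul f M =>
    induction y using TensorProduct.induction_on with
    | zero => simp
    | add x₁ x₂ h₁ h₂ =>
      rw [show (x₁ + x₂) * z - z * (x₁ + x₂) = (x₁ * z - z * x₁) + (x₂ * z - z * x₂) by
        noncomm_ring, map_add, LinearMap.add_apply, ← h₁, ← h₂, ← LinearMap.add_apply, ← map_add]
      congr 2
      noncomm_ring
    | tmul f' M' =>
      induction z using TensorProduct.induction_on with
      | zero => simp
      | add x₁ x₂ h₁ h₂ =>
        rw [map_add, h₁, h₂, ← LinearMap.add_apply, ← map_add]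
        congr 2
        noncomm_ring
      | tmul f'' M'' =>
        rw [Algebra.TensorProduct.tmul_mul_tmul, Algebra.TensorProduct.tmul_mul_tmul,
          Algebra.TensorProduct.tmul_mul_tmul, Algebra.TensorProduct.tmul_mul_tmul,
          mul_comm f' f, mul_comm f'' f', ← TensorProduct.tmul_sub, ← TensorProduct.tmul_sub,
          form_tmul, form_tmul, K.k_cyclic]
        congr 1
        ring

lemma functional_commutator (x y : Loop g N p) : K.functional (x * y - y * x) = 0 := by
  induction x using TensorProduct.induction_on with
  | zero => simp
  | add x₁ x₂ h₁ h₂ =>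
    rw [show (x₁ + x₂) * y - y * (x₁ + x₂) = (x₁ * y - y * x₁) + (x₂ * y - y * x₂) by
        noncomm_ring, map_add, h₁, h₂, add_zero]
  | tmul f M =>
    induction y using TensorProduct.induction_on with
    | zero => simp
    | add x₁ x₂ h₁ h₂ =>
      rw [show f ⊗ₜ M * (x₁ + x₂) - (x₁ + x₂) * f ⊗ₜ M =
        (f ⊗ₜ M * x₁ - x₁ * f ⊗ₜ M) + (f ⊗ₜ M * x₂ - x₂ * f ⊗ₜ M) by
        noncomm_ring, map_add, h₁, h₂, add_zero]
    | tmul f' M' =>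
      rw [Algebra.TensorProduct.tmul_mul_tmul, Algebra.TensorProduct.tmul_mul_tmul,
        mul_comm f' f, ← TensorProduct.tmul_sub, functional_tmul, K.d_commutator, zero_smul]

lemma dot_form (x y : Loop g N p) :
    Trig.dot (K.form x y) = K.form (Loop.dot x) y + K.form x (Loop.dot y) := by
  induction x using TensorProduct.induction_on with
  | zero => simp
  | add x₁ x₂ h₁ h₂ => simp only [map_add, LinearMap.add_apply, h₁, h₂]; abel
  | tmul f M =>
    induction y using TensorProduct.induction_on with
    | zero => simp
    | add x₁ x₂ h₁ h₂ => simp only [map_add, h₁, h₂]; abel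
    | tmul h M' => simp [Loop.dot, form_tmul, Trig.dot_mul]

lemma dot_functional (x : Loop g N p) :
    Trig.dot (K.functional x) = K.functional (Loop.dot x) := by
  induction x using TensorProduct.induction_on with
  | zero => simp
  | add x₁ x₂ h₁ h₂ => simp only [map_add, h₁, h₂]
  | tmul f M => simp [Loop.dot, functional_tmul]

end CentralData

/-- Elements of `Vir ⋉ Û(g ⊕ gl(N), N, p)`. The triple `(Σ fᵢ ⊗ Mᵢ, f, a)` stands for
`Σ ∫ fᵢ(t) I^{Mᵢ}(t) dt + ∫ f(t) F(t) dt + a·1`. -/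
@[ext]
structure VirKM (K : CentralData g N p) where
  cur : Loop g N p
  vir : Trig
  cen : ℂ

namespace VirKM

variable {K : CentralData g N p}

/-- The underlying vector space. -/
def equivProd (K : CentralData g N p) : VirKM K ≃ Loop g N p × Trig × ℂ where
  toFun x := (x.cur, x.vir, x.cen)
  invFun x := ⟨x.1, x.2.1, x.2.2⟩
  left_inv _ := rfl
  right_inv _ := rfl

instance : AddCommGroup (VirKM K) := (equivProd K).addCommGroup

instance : Module ℂ (VirKM K) := (equivProd K).module ℂ

lemma add_cur (x y : VirKM K) : (x + y).cur = x.cur + y.cur := rfl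
lemma add_vir (x y : VirKM K) : (x + y).vir = x.vir + y.vir := rfl
lemma add_cen (x y : VirKM K) : (x + y).cen = x.cen + y.cen := rfl
lemma zero_cur : (0 : VirKM K).cur = 0 := rfl
lemma zero_vir : (0 : VirKM K).vir = 0 := rfl
lemma zero_cen : (0 : VirKM K).cen = 0 := rfl
lemma smul_cur (a : ℂ) (x : VirKM K) : (a • x).cur = a • x.cur := rfl
lemma smul_vir (a : ℂ) (x : VirKM K) : (a • x).vir = a • x.vir := rfl
lemma smul_cen (a : ℂ) (x : VirKM K) : (a • x).cen = a * x.cen := rfl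

/-- The brackets, smeared with test functions on the circle:
`[I^M(s), I^N(t)] = [I^M, I^N](s) δ(s-t) + (k^{MN}/2πi) δ'(s-t)`,
`[F(s), I^M(t)] = I^M(s) δ'(s-t) + (d^M/4πi) (δ''(s-t) + i δ'(s-t))`,
`[F(s), F(t)] = (F(s) + F(t)) δ'(s-t) + (c/24πi) (δ'''(s-t) + δ'(s-t))`. -/
instance : Bracket (VirKM K) (VirKM K) where
  bracket x y :=
    { cur := x.cur * y.cur - y.cur * x.cur + x.vir • Loop.dot y.cur - y.vir • Loop.dot x.cur
      vir := x.vir * Trig.dot y.vir - Trig.dot x.vir * y.vir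
      cen :=
        -(1 / (2 * Real.pi * Complex.I)) * Trig.integral (K.form (Loop.dot x.cur) y.cur)
        + 1 / (4 * Real.pi * Complex.I) *
          (Trig.integral ((Trig.dot (Trig.dot x.vir) - Complex.I • Trig.dot x.vir)
              * K.functional y.cur)
            - Trig.integral ((Trig.dot (Trig.dot y.vir) - Complex.I • Trig.dot y.vir)
              * K.functional x.cur))
        + K.c / (24 * Real.pi * Complex.I) *
          Trig.integral (Trig.dot (Trig.dot x.vir) * Trig.dot y.vir - Trig.dot x.vir * y.vir) }

lemma lie_cur (x y : VirKM K) : ⁅x, y⁆.cur =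
    x.cur * y.cur - y.cur * x.cur + x.vir • Loop.dot y.cur - y.vir • Loop.dot x.cur := rfl

lemma lie_vir (x y : VirKM K) : ⁅x, y⁆.vir =
    x.vir * Trig.dot y.vir - Trig.dot x.vir * y.vir := rfl

lemma lie_cen (x y : VirKM K) : ⁅x, y⁆.cen =
    -(1 / (2 * Real.pi * Complex.I)) * Trig.integral (K.form (Loop.dot x.cur) y.cur)
    + 1 / (4 * Real.pi * Complex.I) *
      (Trig.integral ((Trig.dot (Trig.dot x.vir) - Complex.I • Trig.dot x.vir)
          * K.functional y.cur)
        - Trig.integral ((Trig.dot (Trig.dot y.vir) - Complex.I • Trig.dot y.vir)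
          * K.functional x.cur))
    + K.c / (24 * Real.pi * Complex.I) *
      Trig.integral (Trig.dot (Trig.dot x.vir) * Trig.dot y.vir - Trig.dot x.vir * y.vir) := rfl

lemma int_eq {a b q : Trig} (h : a - b = Trig.dot q) :
    Trig.integral a = Trig.integral b := by
  rw [← sub_eq_zero, ← map_sub, h, Trig.integral_dot]

lemma jacobi_form (x y z : Loop g N p) (f h e : Trig) :
    Trig.integral (K.form (Loop.dot x) (y * z - z * y + h • Loop.dot z - e • Loop.dot y)) =
      Trig.integral (K.form (Loop.dot (x * y - y * x + f • Loop.dot y - h • Loop.dot x)) z) +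
      Trig.integral (K.form (Loop.dot y) (x * z - z * x + f • Loop.dot z - e • Loop.dot x)) := by
  rw [← map_add]
  refine int_eq (q := h * K.form (Loop.dot x) z - f * K.form (Loop.dot y) z) ?_
  have h1 : K.form (Loop.dot x * y - y * Loop.dot x) z =
      K.form (Loop.dot x) (y * z - z * y) := by rw [K.form_cyclic, K.form_symm]
  have h2 : K.form (x * Loop.dot y - Loop.dot y * x) z =
      -K.form (Loop.dot y) (x * z - z * x) := by
    rw [K.form_cyclic, K.form_cyclic, K.form_symm, ← map_neg, neg_sub]
  have h3 : Loop.dot (x * y - y * x) =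
      (Loop.dot x * y - y * Loop.dot x) + (x * Loop.dot y - Loop.dot y * x) := by
    rw [map_sub, Loop.dot_mul, Loop.dot_mul]
    abel
  simp only [map_sub (Loop.dot (g := g) (N := N) (p := p)) (_ + _), map_add Loop.dot, h3,
    map_add (K.form _), map_sub (K.form _) (_ + _), LinearMap.add_apply, LinearMap.sub_apply,
    map_add K.form, map_sub K.form (_ + _), h1, h2, map_sub Trig.dot, Trig.dot_mul, K.dot_form,
    Loop.dot_smul, map_smul, LinearMap.smul_apply, smul_eq_mul]
  rw [K.form_symm (Loop.dot y) (Loop.dot x)]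
  ring

lemma jacobi_functional (x y z : Loop g N p) (f h e : Trig) (i : ℂ)
    (S : Trig → Trig) (hS : ∀ f, S f = Trig.dot (Trig.dot f) - i • Trig.dot f) :
    Trig.integral (S f * K.functional (y * z - z * y + h • Loop.dot z - e • Loop.dot y)) -
      Trig.integral (S (h * Trig.dot e - Trig.dot h * e) * K.functional x) =
    (Trig.integral (S (f * Trig.dot h - Trig.dot f * h) * K.functional z) -
      Trig.integral (S e * K.functional (x * y - y * x + f • Loop.dot y - h • Loop.dot x))) +
    (Trig.integral (S h * K.functional (x * z - z * x + f • Loop.dot z - e • Loop.dot x)) -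
      Trig.integral (S (f * Trig.dot e - Trig.dot f * e) * K.functional y)) := by
  simp only [← map_sub Trig.integral, ← map_add Trig.integral]
  refine int_eq (q := (S f * h - S h * f) * K.functional z + (S e * f - S f * e) * K.functional y
    + (S h * e - S e * h) * K.functional x) ?_
  simp only [hS, map_sub K.functional (_ + _), map_add K.functional, K.functional_commutator,
    map_smul, map_sub Trig.dot, map_add Trig.dot, Trig.dot_mul, ← K.dot_functional, smul_eq_mul,
    Algebra.smul_def]
  have hi : Trig.dot (algebraMap ℂ Trig i) = 0 := by
    rw [AddMonoidAlgebra.coe_algebraMap, Function.comp_apply, Trig.dot_single]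
    simp
  rw [hi]
  ring

lemma jacobi_vir (f h e : Trig) :
    Trig.integral (Trig.dot (Trig.dot f) * Trig.dot (h * Trig.dot e - Trig.dot h * e)
      - Trig.dot f * (h * Trig.dot e - Trig.dot h * e)) =
    Trig.integral (Trig.dot (Trig.dot (f * Trig.dot h - Trig.dot f * h)) * Trig.dot e
      - Trig.dot (f * Trig.dot h - Trig.dot f * h) * e) +
    Trig.integral (Trig.dot (Trig.dot h) * Trig.dot (f * Trig.dot e - Trig.dot f * e)
      - Trig.dot h * (f * Trig.dot e - Trig.dot f * e)) := by
  rw [← map_add]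
  refine int_eq (q := Trig.dot (Trig.dot f) * h * Trig.dot e - f * Trig.dot (Trig.dot h) * Trig.dot e
    - (Trig.dot f * h * e - f * Trig.dot h * e)) ?_
  simp only [map_sub, map_add, Trig.dot_mul]
  ring

lemma jacobi_cur_aux {R S : Type*} [CommRing R] [Ring S] [Algebra R S]
    (x y z x' y' z' x'' y'' z'' : S) (f h e f' h' e' : R) :
    x * (y * z - z * y + h • z' - e • y') - (y * z - z * y + h • z' - e • y') * x +
        f • ((y' * z + y * z') - (z' * y + z * y') + (h' • z' + h • z'') - (e' • y' + e • y'')) -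
        (h * e' - h' * e) • x' =
      ((x * y - y * x + f • y' - h • x') * z - z * (x * y - y * x + f • y' - h • x') +
        (f * h' - f' * h) • z' -
        e • ((x' * y + x * y') - (y' * x + y * x') + (f' • y' + f • y'') - (h' • x' + h • x''))) +
      (y * (x * z - z * x + f • z' - e • x') - (x * z - z * x + f • z' - e • x') * y +
        h • ((x' * z + x * z') - (z' * x + z * x') + (f' • z' + f • z'') - (e' • x' + e • x'')) -
        (f * e' - f' * e) • y') := by
  simp only [mul_add, add_mul, mul_sub, sub_mul, smul_add, smul_sub, sub_smul, smul_smul,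
    mul_smul_comm, smul_mul_assoc, ← mul_assoc, mul_comm h f, mul_comm e f, mul_comm e h,
    mul_comm f' h, mul_comm f' e, mul_comm h' e]
  abel

lemma jacobi_cur (x y z : Loop g N p) (f h e : Trig) :
    x * (y * z - z * y + h • Loop.dot z - e • Loop.dot y) -
        (y * z - z * y + h • Loop.dot z - e • Loop.dot y) * x +
        f • Loop.dot (y * z - z * y + h • Loop.dot z - e • Loop.dot y) -
        (h * Trig.dot e - Trig.dot h * e) • Loop.dot x =
      ((x * y - y * x + f • Loop.dot y - h • Loop.dot x) * z -
        z * (x * y - y * x + f • Loop.dot y - h • Loop.dot x) +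
        (f * Trig.dot h - Trig.dot f * h) • Loop.dot z -
        e • Loop.dot (x * y - y * x + f • Loop.dot y - h • Loop.dot x)) +
      (y * (x * z - z * x + f • Loop.dot z - e • Loop.dot x) -
        (x * z - z * x + f • Loop.dot z - e • Loop.dot x) * y +
        h • Loop.dot (x * z - z * x + f • Loop.dot z - e • Loop.dot x) -
        (f * Trig.dot e - Trig.dot f * e) • Loop.dot y) := by
  simp only [map_sub Loop.dot, map_add Loop.dot, Loop.dot_mul, Loop.dot_smul]
  exact jacobi_cur_aux ..

instance : LieRing (VirKM K) where
  add_lie x y z := by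
    ext1
    · simp only [lie_cur, add_cur, add_vir, add_mul, mul_add, map_add, add_smul, smul_add]
      abel
    · simp only [lie_vir, add_vir, map_add]
      ring
    · simp only [lie_cen, add_cur, add_vir, add_cen, map_add, map_sub, add_mul, mul_add, sub_mul,
        LinearMap.add_apply, smul_add]
      ring
  lie_add x y z := by
    ext1
    · simp only [lie_cur, add_cur, add_vir, add_mul, mul_add, map_add, add_smul, smul_add]
      abel
    · simp only [lie_vir, add_vir, map_add]
      ring
    · simp only [lie_cen, add_cur, add_vir, add_cen, map_add, map_sub, add_mul, mul_add, sub_mul,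
        smul_add]
      ring
  lie_self x := by
    have h1 : Trig.integral (K.form (Loop.dot x.cur) x.cur) = 0 := by
      have h := Trig.integral_dot (K.form x.cur x.cur)
      rw [K.dot_form, K.form_symm x.cur, map_add, ← two_mul] at h
      simpa using h
    have h2 : Trig.integral (Trig.dot x.vir * x.vir) = 0 := by
      have h := Trig.integral_dot (x.vir * x.vir)
      rw [Trig.dot_mul, mul_comm x.vir, map_add, ← two_mul] at h
      simpa using h
    have h3 : Trig.integral (Trig.dot (Trig.dot x.vir) * Trig.dot x.vir) = 0 := by
      have h := Trig.integral_dot (Trig.dot x.vir * Trig.dot x.vir)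
      rw [Trig.dot_mul, mul_comm (Trig.dot x.vir), map_add, ← two_mul] at h
      simpa using h
    ext1
    · simp [lie_cur, zero_cur]
    · rw [lie_vir, zero_vir]
      ring
    · rw [lie_cen, zero_cen, h1, map_sub Trig.integral (_ * _), h2, h3]
      ring
  leibniz_lie x y z := by
    ext1
    · exact jacobi_cur x.cur y.cur z.cur x.vir y.vir z.vir
    · simp only [lie_vir, add_vir, map_sub, Trig.dot_mul]
      ring
    · simp only [lie_cen, lie_cur, lie_vir, add_cen]
      have h1 := jacobi_form (K := K) x.cur y.cur z.cur x.vir y.vir z.vir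
      have h2 := jacobi_functional (K := K) x.cur y.cur z.cur x.vir y.vir z.vir Complex.I
        (fun f => Trig.dot (Trig.dot f) - Complex.I • Trig.dot f) fun _ => rfl
      have h3 := jacobi_vir x.vir y.vir z.vir
      rw [h1, h2, h3]
      ring

instance : LieAlgebra ℂ (VirKM K) where
  lie_smul a x y := by
    ext1
    · simp only [lie_cur, smul_cur, smul_vir, map_smul, smul_sub, smul_add, mul_smul_comm,
        smul_mul_assoc, smul_assoc, smul_comm x.vir a]
    · simp only [lie_vir, smul_vir, map_smul, smul_sub, mul_smul_comm]
    · simp only [lie_cen, smul_cur, smul_vir, smul_cen, map_smul, map_sub, smul_sub,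
        sub_mul, mul_smul_comm, smul_mul_assoc, LinearMap.map_smul_of_tower, smul_eq_mul]
      ring

/-- The smeared current `∫ f(t) I^M(t) dt`. -/
def current (K : CentralData g N p) (f : Trig) (M : EnvMat g N p) : VirKM K := ⟨f ⊗ₜ M, 0, 0⟩

/-- The smeared Virasoro generator `∫ f(t) F(t) dt`. -/
def virasoro (K : CentralData g N p) (f : Trig) : VirKM K := ⟨0, f, 0⟩

/-- The central element `1`. -/
def central (K : CentralData g N p) : VirKM K := ⟨0, 0, 1⟩

end VirKM

/-! ### Smooth functions on `ℝ^N` -/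

/-- The algebra of smooth complex functions on `ℝ^N`. -/
def smoothFunctions (N : ℕ) : Subalgebra ℂ ((Fin N → ℝ) → ℂ) where
  carrier := {φ | ContDiff ℝ ∞ φ}
  mul_mem' {φ ψ} hφ hψ := by
    rw [Set.mem_ofPred_eq] at *
    exact hφ.mul hψ
  add_mem' {φ ψ} hφ hψ := by
    rw [Set.mem_ofPred_eq] at *
    exact hφ.add hψ
  algebraMap_mem' a := by
    rw [Set.mem_ofPred_eq]
    exact contDiff_const (c := a)

/-- Smooth complex functions on `ℝ^N`. -/
abbrev Fn (N : ℕ) : Type := smoothFunctions N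

instance (N : ℕ) : AddCommGroup (Fn N) := inferInstance

namespace Fn

lemma contDiff (φ : Fn N) : ContDiff ℝ ∞ φ.1 := φ.2

/-- The coordinate function `x^μ`. -/
def coord (μ : Fin N) : Fn N :=
  ⟨fun x => (x μ : ℂ), by
    change ContDiff ℝ ∞ _
    exact Complex.ofRealCLM.contDiff.comp (contDiff_apply ℝ ℝ μ)⟩

/-- The partial derivative `∂_μ`. -/
def pd (μ : Fin N) : Module.End ℂ (Fn N) where
  toFun φ := ⟨fun x => fderiv ℝ φ.1 x (Pi.single μ 1),
    by
      change ContDiff ℝ ∞ _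
      exact (φ.contDiff.fderiv_right (m := ∞) (by simp)).clm_apply contDiff_const⟩
  map_add' φ ψ := by
    ext x
    have h1 : DifferentiableAt ℝ φ.1 x := φ.contDiff.differentiable (by simp) x
    have h2 : DifferentiableAt ℝ ψ.1 x := ψ.contDiff.differentiable (by simp) x
    change fderiv ℝ (φ.1 + ψ.1) x _ = _
    rw [fderiv_add h1 h2]
    rfl
  map_smul' a φ := by
    ext x
    have h1 : DifferentiableAt ℝ φ.1 x := φ.contDiff.differentiable (by simp) x
    change fderiv ℝ (a • φ.1) x _ = _
    rw [fderiv_const_smul h1 a]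
    rfl

/-- The iterated partial derivative `∂_m = ∂_1^{m₁} ⋯ ∂_N^{m_N}`. -/
def pdMulti (m : Fin N → ℕ) : Module.End ℂ (Fn N) := (List.ofFn fun μ => pd μ ^ m μ).prod

end Fn

/-- The commutator `[ξ, η]^ν = ξ^μ ∂_μ η^ν - η^μ ∂_μ ξ^ν` of vector fields. -/
def vfBracket (ξ η : Fin N → Fn N) : Fin N → Fn N :=
  fun ν => ∑ μ, (ξ μ * Fn.pd μ (η ν) - η μ * Fn.pd μ (ξ ν))

/-- The commutator `[X, Y] = X_a Y_b [J^a, J^b]` of `g`-valued functions `X = X_a J^a`. -/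
def gaugeBracket {ι : Type*} [Fintype ι] (J : Module.Basis ι ℂ g) (X Y : ι → Fn N) : ι → Fn N :=
  fun c => ∑ a, ∑ b, J.repr ⁅J a, J b⁆ c • (X a * Y b)

/-- The action `(ξ X)_a = ξ^μ ∂_μ X_a` of vector fields on `g`-valued functions. -/
def vfAct {ι : Type*} (ξ : Fin N → Fn N) (X : ι → Fn N) : ι → Fn N :=
  fun a => ∑ μ, ξ μ * Fn.pd μ (X a)

/-! ### Infinite sums of operators and operator-valued fields on the circle -/

section Fields

variable {W : Type*} [AddCommGroup W] [Module ℂ W]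

/-- A family of operators is locally finite if only finitely many of them are nonzero on each
vector, so that its sum makes sense. -/
def LocFin {α : Type*} (A : α → Module.End ℂ W) : Prop := ∀ w, {i | A i w ≠ 0}.Finite

open Classical in
/-- The sum of a locally finite family of operators. -/
def opSum {α : Type*} (A : α → Module.End ℂ W) : Module.End ℂ W :=
  if h : LocFin A then
    { toFun := fun w => ∑ᶠ i, A i w
      map_add' := fun v w => by
        simp only [map_add]
        exact finsum_add_distrib (h v) (h w)
      map_smul' := fun a w => by
        simp only [map_smul, RingHom.id_apply]
        exact (smul_finsum' a (h w)).symm }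
  else 0

/-- An operator-valued field `B(t) = Σ_n B_n exp (i n t)`, given by its Fourier modes. -/
abbrev OpField (W : Type*) [AddCommGroup W] [Module ℂ W] : Type _ := ℤ → Module.End ℂ W

namespace OpField

/-- The derivative `dB/dt`. -/
def dot (B : OpField W) : OpField W := fun n => (Complex.I * n) • B n

/-- The integral `∫ B(t) dt` over the circle. -/
def integral (B : OpField W) : Module.End ℂ W := (2 * (Real.pi : ℂ)) • B 0

/-- The product `f(t) B(t)` with a trigonometric polynomial. -/
def smear (f : Trig) (B : OpField W) : OpField W := fun n => f.coeff.sum fun k a => a • B (n - k)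

/-- The family whose sum is the `n`-th mode of the product `B(t) C(t)`. -/
def mulTerm (B C : OpField W) (n : ℤ) : ℤ → Module.End ℂ W := fun k => B k * C (n - k)

/-- The product `B(t) C(t)`. -/
def mul (B C : OpField W) : OpField W := fun n => opSum (mulTerm B C n)

end OpField

end Fields

/-! ### The DGRO algebra -/

/-- The abelian charges. -/
structure Charges where
  c₁ : ℂ
  c₂ : ℂ
  c₃ : ℂ
  c₄ : ℂ
  c₅ : ℂ
  c₆ : ℂ
  c₇ : ℂ
  c₈ : ℂ

section DGROAlgebra

variable {W : Type*} [AddCommGroup W] [Module ℂ W] {ι : Type*} [Fintype ι]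

/-- The operator `∫ q̇^ρ(t) φ(q(t)) dt`, where `obs φ` is the field `φ(q(t))`. -/
def trajectoryIntegral (obs : Fn N → OpField W) (ρ : Fin N) (φ : Fn N) : Module.End ℂ W :=
  (OpField.mul (obs (Fn.coord ρ)).dot (obs φ)).integral

/-- The operators `lieOp ξ` (`= 𝓛_ξ`), `gaugeOp X` (`= 𝒥_X`), `repOp f` (`= L_f`) and the fields
`obs φ` (`= φ(q(t))`, in particular `q^μ(t) = obs x^μ`) on the space `W` satisfy the relations of
the algebra `DGRO(N, g)` with abelian charges `c`. Here `δ₂ (J a) (J b) = δ^{ab}` and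
`δ₁ (J a) = δ^a`. -/
structure IsDGRO (J : Module.Basis ι ℂ g) (δ₂ : LinearMap.BilinForm ℂ g) (δ₁ : g →ₗ[ℂ] ℂ)
    (c : Charges) (obs : Fn N → OpField W) (lieOp : (Fin N → Fn N) → Module.End ℂ W)
    (gaugeOp : (ι → Fn N) → Module.End ℂ W) (repOp : Trig → Module.End ℂ W) : Prop where
  obs_linear : IsLinearMap ℂ obs
  lie_linear : IsLinearMap ℂ lieOp
  gauge_linear : IsLinearMap ℂ gaugeOp
  rep_linear : IsLinearMap ℂ repOp
  /-- `φ ↦ φ(q(t))` is multiplicative and obeys the chain rule; all products are locally finite. -/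
  obs_one : ∀ n, obs 1 n = if n = 0 then 1 else 0
  obs_mul_locFin : ∀ φ ψ n, LocFin (OpField.mulTerm (obs φ) (obs ψ) n)
  obs_mul : ∀ φ ψ, obs (φ * ψ) = OpField.mul (obs φ) (obs ψ)
  obs_dot_locFin : ∀ ρ φ n, LocFin (OpField.mulTerm (obs (Fn.coord ρ)).dot (obs φ) n)
  obs_dot : ∀ φ, (obs φ).dot = ∑ μ, OpField.mul (obs (Fn.coord μ)).dot (obs (Fn.pd μ φ))
  lie_lie : ∀ ξ η, ⁅lieOp ξ, lieOp η⁆ = lieOp (vfBracket ξ η) +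
    (1 / (2 * Real.pi * Complex.I)) • ∑ ρ, ∑ μ, ∑ ν,
      (c.c₁ • trajectoryIntegral obs ρ (Fn.pd ρ (Fn.pd ν (ξ μ)) * Fn.pd μ (η ν)) +
        c.c₂ • trajectoryIntegral obs ρ (Fn.pd ρ (Fn.pd μ (ξ μ)) * Fn.pd ν (η ν)))
  lie_gauge : ∀ ξ X, ⁅lieOp ξ, gaugeOp X⁆ = gaugeOp (vfAct ξ X) -
    (c.c₇ / (2 * Real.pi * Complex.I)) • ∑ a, ∑ ρ, ∑ μ,
      δ₁ (J a) • trajectoryIntegral obs ρ (X a * Fn.pd ρ (Fn.pd μ (ξ μ)))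
  gauge_gauge : ∀ X Y, ⁅gaugeOp X, gaugeOp Y⁆ = gaugeOp (gaugeBracket J X Y) -
    (1 / (2 * Real.pi * Complex.I)) • ∑ a, ∑ b, ∑ ρ,
      (c.c₅ * δ₂ (J a) (J b) + c.c₈ * δ₁ (J a) * δ₁ (J b)) •
        trajectoryIntegral obs ρ (Fn.pd ρ (X a) * Y b)
  rep_lie : ∀ f ξ, ⁅repOp f, lieOp ξ⁆ = (c.c₃ / (4 * Real.pi * Complex.I)) • ∑ μ,
    (OpField.smear (f.dot.dot - Complex.I • f.dot) (obs (Fn.pd μ (ξ μ)))).integral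
  rep_gauge : ∀ f X, ⁅repOp f, gaugeOp X⁆ = (c.c₆ / (4 * Real.pi * Complex.I)) • ∑ a,
    δ₁ (J a) • (OpField.smear (f.dot.dot - Complex.I • f.dot) (obs (X a))).integral
  rep_rep : ∀ f h, ⁅repOp f, repOp h⁆ = repOp (f * h.dot - f.dot * h) +
    (c.c₄ / (24 * Real.pi * Complex.I) *
      Trig.integral (f.dot.dot * h.dot - f.dot * h)) • (1 : Module.End ℂ W)
  lie_q : ∀ ξ μ n, ⁅lieOp ξ, obs (Fn.coord μ) n⁆ = obs (ξ μ) n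
  rep_q : ∀ f μ n, ⁅repOp f, obs (Fn.coord μ) n⁆ = -OpField.smear f (obs (Fn.coord μ)).dot n
  gauge_q : ∀ X μ n, ⁅gaugeOp X, obs (Fn.coord μ) n⁆ = 0
  q_q : ∀ μ ν m n, ⁅obs (Fn.coord μ) m, obs (Fn.coord ν) n⁆ = 0
  /-- The extension of the last four relations to functions of `q(t)` by Leibniz' rule. -/
  lie_obs : ∀ ξ φ n, ⁅lieOp ξ, obs φ n⁆ = obs (∑ μ, ξ μ * Fn.pd μ φ) n
  rep_obs : ∀ f φ n, ⁅repOp f, obs φ n⁆ = -OpField.smear f (obs φ).dot n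
  gauge_obs : ∀ X φ n, ⁅gaugeOp X, obs φ n⁆ = 0
  obs_obs : ∀ φ ψ m n, ⁅obs φ m, obs ψ n⁆ = 0

end DGROAlgebra

/-! ### The Fock space of the observer's trajectory -/

/-- Polynomials in the creation operators: the variable `inl (μ, k)` is `q^μ_{-(k+1)}`, the
variable `inr (μ, k)` is `p_{μ, -(k+1)}`. -/
abbrev Osc (N : ℕ) : Type := MvPolynomial ((Fin N × ℕ) ⊕ (Fin N × ℕ)) ℂ

/-- The Fock space of `q^μ(t) = Σ_n q^μ_n exp (i n t)`, `p_μ(t) = Σ_n p_{μ,n} exp (i n t)`: the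
first factor consists of the functions of the zero modes `q^μ_0`. -/
abbrev Fock (N : ℕ) : Type := Fn N ⊗[ℂ] Osc N

instance (N : ℕ) : AddCommGroup (Fock N) := TensorProduct.addCommGroup

instance (N : ℕ) : Module ℂ (Fock N) := TensorProduct.leftModule

namespace Fock

/-- The operator `φ(q_0)`. -/
def mulFn (φ : Fn N) : Module.End ℂ (Fock N) := (LinearMap.mulLeft ℂ φ).rTensor (Osc N)

/-- The Fourier modes of `q^μ(t)`. -/
def qField (μ : Fin N) : OpField (Fock N)
  | .ofNat 0 => mulFn (Fn.coord μ)
  | .ofNat (k + 1) => (-(1 / (2 * Real.pi)) : ℂ) •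
      (MvPolynomial.pderiv (R := ℂ) (Sum.inr (μ, k))).toLinearMap.lTensor (Fn N)
  | .negSucc k => (LinearMap.mulLeft ℂ (MvPolynomial.X (Sum.inl (μ, k)) : Osc N)).lTensor (Fn N)

/-- The Fourier modes of `p_μ(t)`; `[p_μ(s), q^ν(t)] = δ^ν_μ δ(s-t)` reads
`[p_{μ,m}, q^ν_n] = δ^ν_μ δ_{m+n,0} / 2π`. -/
def pField (μ : Fin N) : OpField (Fock N)
  | .ofNat 0 => (1 / (2 * Real.pi) : ℂ) • (Fn.pd μ).rTensor (Osc N)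
  | .ofNat (k + 1) => (1 / (2 * Real.pi) : ℂ) •
      (MvPolynomial.pderiv (R := ℂ) (Sum.inl (μ, k))).toLinearMap.lTensor (Fn N)
  | .negSucc k => (LinearMap.mulLeft ℂ (MvPolynomial.X (Sum.inr (μ, k)) : Osc N)).lTensor (Fn N)

/-- The terms of the Taylor expansion of the `n`-th Fourier mode of `φ(q(t))` around `q_0`,
`Σ_r (1/r!) Σ ∂_{μ₁} ⋯ ∂_{μ_r} φ(q_0) q^{μ₁}_{n₁} ⋯ q^{μ_r}_{n_r}`, the inner sum being over all
`(μ₁, n₁), …, (μ_r, n_r)` with all `nᵢ ≠ 0` and `n₁ + ⋯ + n_r = n`. -/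
def taylorTerm (φ : Fn N) (n : ℤ) (l : List (Fin N × ℤ)) : Module.End ℂ (Fock N) :=
  if (∀ x ∈ l, x.2 ≠ 0) ∧ (l.map Prod.snd).sum = n then
    (1 / (l.length.factorial : ℂ)) •
      (mulFn ((l.map fun x => Fn.pd x.1).prod φ) * (l.map fun x => qField x.1 x.2).prod)
  else 0

/-- The field `φ(q(t))`. -/
def fn (φ : Fn N) : OpField (Fock N) := fun n => opSum (taylorTerm φ n)

/-- The family whose sum is the `n`-th mode of `:B(t) p_μ(t):`, with normal ordering with respect
to frequency (modes `p_{μ,k}` with `k < 0` to the left, those with `k ≥ 0` to the right). -/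
def normalTerm (B : OpField (Fock N)) (μ : Fin N) (n k : ℤ) : Module.End ℂ (Fock N) :=
  if k < 0 then pField μ k * B (n - k) else B (n - k) * pField μ k

/-- The normal ordered product `:B(t) p_μ(t):`. -/
def normal (B : OpField (Fock N)) (μ : Fin N) : OpField (Fock N) :=
  fun n => opSum (normalTerm B μ n)

end Fock

/-! ### The realization -/

section Realization

variable (K : CentralData g N p) (V : Type*) [AddCommGroup V] [Module ℂ V]
  [LieRingModule (VirKM K) V] [LieModule ℂ (VirKM K) V]

/-- On each vector, the Fourier modes `I^M_n` of each current vanish for `n` large, and the central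
element acts as the identity. -/
structure IsSmoothModule : Prop where
  smooth : ∀ (M : EnvMat g N p) (v : V), ∃ n₀ : ℤ, ∀ n ≥ n₀,
    ⁅VirKM.current K (LaurentPolynomial.T (-n)) M, v⁆ = 0
  central : ∀ v : V, ⁅VirKM.central K, v⁆ = v

/-- The space on which the generators act. -/
abbrev Carrier (N : ℕ) (V : Type*) [AddCommGroup V] [Module ℂ V] : Type _ := Fock N ⊗[ℂ] V

instance : AddCommGroup (Carrier N V) := TensorProduct.addCommGroup

instance : Module ℂ (Carrier N V) := TensorProduct.leftModule

/-- An operator on the Fock space, as an operator on `Fock N ⊗ V`. -/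
def onFock (A : Module.End ℂ (Fock N)) : Module.End ℂ (Carrier N V) := A.rTensor V

/-- The field `φ(q(t))` on `Fock N ⊗ V`. -/
def fnField (φ : Fn N) : OpField (Carrier N V) := fun n => onFock V (Fock.fn φ n)

/-- The current `I^M(t)` on `Fock N ⊗ V`; its modes are `(1/2π) ∫ exp (-i n t) I^M(t) dt`. -/
def curField (M : EnvMat g N p) : OpField (Carrier N V) := fun n =>
  ((1 / (2 * Real.pi) : ℂ) • LieModule.toEnd ℂ (VirKM K) V
    (VirKM.current K (LaurentPolynomial.T (-n)) M)).lTensor (Fock N)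

/-- The operator `∫ φ(q(t)) I^M(t) dt`. -/
def pairing (φ : Fn N) (M : EnvMat g N p) : Module.End ℂ (Carrier N V) :=
  (OpField.mul (fnField V φ) (curField K V M)).integral

/-- The element `J^a` of `U(g ⊕ gl(N))`. -/
def envJ {ι : Type*} (N : ℕ) (J : Module.Basis ι ℂ g) (a : ι) : Env g N :=
  UniversalEnvelopingAlgebra.ι ℂ (J a, 0)

/-- The element `T^μ_ν` of `U(g ⊕ gl(N))`. -/
def envT (g : Type*) [LieRing g] [LieAlgebra ℂ g] {N : ℕ} (μ ν : Fin N) : Env g N :=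
  UniversalEnvelopingAlgebra.ι ℂ (0, Matrix.single μ ν 1)

/-- `I^{m A}_n` with `u = I^A`; it is zero if `m` or `n` has length more than `p`. -/
def gen (p : ℕ) (m n : Fin N → ℕ) (u : Env g N) : EnvMat g N p :=
  Matrix.of fun a b => if a.1 = m ∧ b.1 = n then u else 0

/-- The binomial coefficient of multi-indices. -/
def multiChoose (m n : Fin N → ℕ) : ℂ := ∏ μ, ((m μ).choose (n μ) : ℂ)

/-- `T_{dξ} = ∫ Σ_{m,n} (m choose n) ∂_{m-n+ν} ξ^μ(q(t)) T^{mν}_{nμ}(t) dt`. -/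
def tangentOp (ξ : Fin N → Fn N) : Module.End ℂ (Carrier N V) :=
  ∑ m ∈ multiIndices N p, ∑ n ∈ multiIndices N p, ∑ μ, ∑ ν,
    multiChoose m n • pairing K V (Fn.pdMulti (m - n + Pi.single ν 1) (ξ μ))
      (gen p m n (envT g ν μ))

/-- `𝓛_ξ = ∫ (:ξ^μ(q(t)) p_μ(t): - ξ^μ(q(t)) P_μ(t)
+ Σ_{m,n} (m choose n) ∂_{m-n} ξ^μ(q(t)) E^m_{n+μ}(t)) dt + T_{dξ}`, where
`P_μ(t) = Σ_m E^m_{m+μ}(t)`. -/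
def lieOp (ξ : Fin N → Fn N) : Module.End ℂ (Carrier N V) :=
  ∑ μ, onFock V (Fock.normal (Fock.fn (ξ μ)) μ).integral
  - ∑ μ, pairing K V (ξ μ) (∑ m ∈ multiIndices N p, gen p m (m + Pi.single μ 1) 1)
  + ∑ m ∈ multiIndices N p, ∑ n ∈ multiIndices N p, ∑ μ,
      multiChoose m n • pairing K V (Fn.pdMulti (m - n) (ξ μ)) (gen p m (n + Pi.single μ 1) 1)
  + tangentOp K V ξ

/-- `𝒥_X = ∫ Σ_{m,n} (m choose n) ∂_{m-n} X_a(q(t)) J^{ma}_n(t) dt`. -/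
def gaugeOp {ι : Type*} [Fintype ι] (J : Module.Basis ι ℂ g) (X : ι → Fn N) :
    Module.End ℂ (Carrier N V) :=
  ∑ m ∈ multiIndices N p, ∑ n ∈ multiIndices N p, ∑ a,
    multiChoose m n • pairing K V (Fn.pdMulti (m - n) (X a)) (gen p m n (envJ N J a))

/-- `L_f = ∫ f(t) (-:q̇^μ(t) p_μ(t): + F(t)) dt`. -/
def repOp (f : Trig) : Module.End ℂ (Carrier N V) :=
  -∑ μ, onFock V (Fock.normal (OpField.smear f (Fock.qField μ).dot) μ).integral
  + (LieModule.toEnd ℂ (VirKM K) V (VirKM.virasoro K f)).lTensor (Fock N)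

/-- All infinite sums in the definitions of the generators are locally finite, and the Taylor
expansion reproduces the trajectory `q^μ(t)` itself. -/
structure WellDefined : Prop where
  coord : ∀ μ : Fin N, Fock.fn (Fn.coord μ) = Fock.qField μ
  taylor : ∀ (φ : Fn N) n, LocFin (Fock.taylorTerm φ n)
  normal_fn : ∀ (φ : Fn N) μ n, LocFin (Fock.normalTerm (Fock.fn φ) μ n)
  normal_q : ∀ (f : Trig) (μ : Fin N) n,
    LocFin (Fock.normalTerm (OpField.smear f (Fock.qField μ).dot) μ n)
  pairing : ∀ (φ : Fn N) (M : EnvMat g N p) n,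
    LocFin (OpField.mulTerm (fnField V φ) (curField K V M) n)

end Realization

end DGRO

end

open DGRO

/-! Every operator involved is a locally finite sum of products of modes, and every relation is an
identity between two such sums. `HasOpSum` records that a family is locally finite and has a given
sum; products of sums are sums over pairs (`HasOpSum.mul`), sums may be re-indexed and evaluated
iteratively, and values are unique. Hence a commutator is computed by arranging both sides over one
index set and comparing terms. Fields with mutually commuting modes whose high modes kill each
vector can be multiplied, and this product is commutative, associative and obeys Leibniz' rule for
d/dt (`OpField.mul_comm`, `OpField.mul_assoc`, `OpField.dot_mul`).

Functions of the trajectory. A term of the Taylor series is indexed by a list of modes with weight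
1/r!. Commuting with a non-zero mode of p removes one entry of the list, and d/dt marks one entry;
averaging over the marked position (`finsum_list_removal`) gives both [2π p_{μ,k}, φ(q)_n] = (∂_μ
φ)(q)_{n+k} (`Fock.pField_fn`) and the chain rule (`Fock.fn_dot`). Multiplicativity (`Fock.fn_mul`)
holds because the defect kills the vacuum, commutes with q, and has commutators with p that are
again defects (`Fock.eq_zero_of_vac`).

Flows ∫ :B^μ p_μ: dt. Their commutator is the flow of the commutator plus contractions of pairs of
modes, which occur only when the two terms are ordered oppositely (`Fock.flow_commutator`). For a
fixed frequency transfer l finitely many pairs contract, and their coefficients add up to a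
polynomial in l, that is, to a differential operator (`Fock.hasOpSum_contraction`). The polynomials
l, i l(l-1)/2 and (l³-l)/6 are the contributions 1, 1 and 2N of the trajectory to c₁, c₃ and c₄.

Currents. The sums with binomial coefficients are matrices of functions. `jet φ` is the matrix of
multiplication by φ on p-jets and is multiplicative by Leibniz' rule. The E-part of 𝓛_ξ is the
current of `jetFlow ξ`, the sum of (jet ξ^μ - ξ^μ) times the shift in direction μ. The commutator of
two currents is the current of the commutator, minus k^{AB} times the cocycle ∫ tr(∂_ρ M M') q̇^ρ
dt/(2πi) (`jetCurrent_commutator`). The shift is truncated at length p, but its left factor is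
strictly lower triangular, so the cut is never seen in commutators (`jetRed_mul_shift_mul`). The
commutators of `jetFlow ξ` contain terms in which ξ^μ is not differentiated; these are cancelled by
the flow of ξ, which differentiates coefficient functions along ξ.

The charges then follow from traces. Each is a sum over multi-indices of length at most p of
products of binomial coefficients, evaluated by `sum_multiIndices_choose`: the trace of `jet` gives
the binomial N+p over N, a shift by one direction gives N+p over N+1, and the product of two
`jetFlow`s gives N+p over N+2 and, by Pascal's rule, N+p+1 over N+2. In 𝓛_ξ = `jetLie` +
`tangentMap` the cross terms yield the doubled k₃, since a total derivative integrates to zero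
(`anomaly_symm`). -/

open scoped TensorProduct LaurentPolynomial ContDiff
noncomputable section
attribute [local instance] LieRing.ofAssociativeRing LieAlgebra.ofAssociativeAlgebra
namespace DGRO

/-! ### Sums of locally finite families of operators -/

section HasOpSum

variable {W : Type*} [AddCommGroup W] [Module ℂ W] {α β : Type*}

lemma end_smul_sub (c : ℂ) (A B : Module.End ℂ W) : c • (A - B) = c • A - c • B := smul_sub c A B

/-- The locally finite family `A` of operators has the sum `S`. -/
def HasOpSum (A : α → Module.End ℂ W) (S : Module.End ℂ W) : Prop :=
  LocFin A ∧ ∀ w, ∑ᶠ i, A i w = S w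

lemma LocFin.opSum_apply {A : α → Module.End ℂ W} (h : LocFin A) (w : W) :
    opSum A w = ∑ᶠ i, A i w := by
  rw [opSum, dif_pos h]
  rfl

/-- Local finiteness is not needed: a family that is not locally finite has the default sum zero,
which kills w as well. -/
lemma opSum_apply_eq_zero {A : α → Module.End ℂ W} {w : W} (h : ∀ i, A i w = 0) :
    opSum A w = 0 := by
  by_cases hA : LocFin A
  · rw [hA.opSum_apply, finsum_eq_zero_of_forall_eq_zero h]
  · rw [opSum, dif_neg hA, LinearMap.zero_apply]

lemma LocFin.hasOpSum {A : α → Module.End ℂ W} (h : LocFin A) : HasOpSum A (opSum A) :=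
  ⟨h, fun w => (h.opSum_apply w).symm⟩

namespace HasOpSum

variable {A A' : α → Module.End ℂ W} {S S' : Module.End ℂ W}

lemma locFin (h : HasOpSum A S) : LocFin A := h.1

lemma opSum_eq (h : HasOpSum A S) : opSum A = S := by
  ext w
  rw [h.1.opSum_apply, h.2]

lemma unique (h : HasOpSum A S) (h' : HasOpSum A S') : S = S' := by
  rw [← h.opSum_eq, h'.opSum_eq]

lemma zero : HasOpSum (fun _ : α => (0 : Module.End ℂ W)) 0 :=
  ⟨fun w => by simp, fun w => by simp⟩

lemma add (h : HasOpSum A S) (h' : HasOpSum A' S') : HasOpSum (fun i => A i + A' i) (S + S') := by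
  refine ⟨fun w => ((h.1 w).union (h'.1 w)).subset fun i hi => ?_, fun w => ?_⟩
  · by_contra hc
    simp only [Set.mem_union, Set.mem_ofPred_eq, not_or, not_not] at hc
    exact hi (by simp [hc.1, hc.2])
  · simp only [LinearMap.add_apply]
    rw [finsum_add_distrib (h.1 w) (h'.1 w), h.2, h'.2]

lemma mul_left (B : Module.End ℂ W) (h : HasOpSum A S) : HasOpSum (fun i => B * A i) (B * S) := by
  refine ⟨fun w => (h.1 w).subset fun i hi h0 => hi (by simp [h0]), fun w => ?_⟩
  simp only [Module.End.mul_apply]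
  rw [← h.2, map_finsum B (h.1 w)]

lemma mul_right (h : HasOpSum A S) (B : Module.End ℂ W) : HasOpSum (fun i => A i * B) (S * B) :=
  ⟨fun w => h.1 (B w), fun w => h.2 (B w)⟩

lemma smul (c : ℂ) (h : HasOpSum A S) : HasOpSum (fun i => c • A i) (c • S) := by
  simpa using h.mul_left (c • 1)

lemma neg (h : HasOpSum A S) : HasOpSum (fun i => -A i) (-S) := by
  simpa using h.smul (-1)

lemma sub (h : HasOpSum A S) (h' : HasOpSum A' S') : HasOpSum (fun i => A i - A' i) (S - S') := by
  simpa [sub_eq_add_neg] using h.add h'.neg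

lemma sum {κ : Type*} (s : Finset κ) {A : κ → α → Module.End ℂ W} {S : κ → Module.End ℂ W}
    (h : ∀ j ∈ s, HasOpSum (A j) (S j)) :
    HasOpSum (fun i => ∑ j ∈ s, A j i) (∑ j ∈ s, S j) := by
  classical
  induction s using Finset.induction_on with
  | empty => simpa using zero
  | insert a s ha ih =>
    simp only [Finset.sum_insert ha]
    exact (h a (by simp)).add (ih fun j hj => h j (by simp [hj]))

lemma congr (h : HasOpSum A S) (hA : ∀ i, A i = A' i) : HasOpSum A' S := by
  rwa [← funext hA]

lemma comp_equiv (e : β ≃ α) (h : HasOpSum A S) : HasOpSum (fun i => A (e i)) S := by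
  refine ⟨fun w => (h.1 w).preimage e.injective.injOn, fun w => ?_⟩
  rw [← h.2]
  exact finsum_comp_equiv e (f := fun i => A i w)

/-- The sum of a family indexed by pairs can be computed by first summing over one index. -/
lemma prod_fst {F : α × β → Module.End ℂ W} (h : HasOpSum F S) {T : α → Module.End ℂ W}
    (hT : ∀ a, HasOpSum (fun b => F (a, b)) (T a)) : HasOpSum T S := by
  refine ⟨fun w => ((h.1 w).image Prod.fst).subset fun a ha => ?_, fun w => ?_⟩
  · have ha : T a w ≠ 0 := ha
    rw [← (hT a).2] at ha
    obtain ⟨b, hb⟩ : ∃ b, F (a, b) w ≠ 0 := by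
      by_contra! hc
      exact ha (finsum_eq_zero_of_forall_eq_zero hc)
    exact ⟨(a, b), hb, rfl⟩
  · rw [← h.2, finsum_curry _ (h.1 w)]
    exact finsum_congr fun a => ((hT a).2 w).symm

lemma swap {F : α × β → Module.End ℂ W} (h : HasOpSum F S) :
    HasOpSum (fun x : β × α => F (x.2, x.1)) S := h.comp_equiv (Equiv.prodComm β α)

lemma prod_snd {F : α × β → Module.End ℂ W} (h : HasOpSum F S) {T : β → Module.End ℂ W}
    (hT : ∀ b, HasOpSum (fun a => F (a, b)) (T b)) : HasOpSum T S :=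
  h.swap.prod_fst hT

/-- The product of two locally finite sums. -/
lemma mul {B : β → Module.End ℂ W} {T : Module.End ℂ W} (h : HasOpSum A S) (hB : HasOpSum B T) :
    HasOpSum (fun x : α × β => A x.1 * B x.2) (S * T) := by
  -- Only finitely many B b are non-zero on w, and each vector B b w is seen by finitely many A a
  -- only; no commutation of A and B enters.
  have hl : LocFin (fun x : α × β => A x.1 * B x.2) := fun w => by
    refine (((hB.1 w).biUnion fun b _ => ((h.1 (B b w)).image fun a => (a, b)))).subset ?_
    rintro ⟨a, b⟩ hab
    simp only [Set.mem_ofPred_eq, Module.End.mul_apply] at hab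
    simp only [Set.mem_iUnion]
    refine ⟨b, fun h0 => hab (by simp [h0]), a, hab, rfl⟩
  refine ⟨hl, fun w => ?_⟩
  -- The double sum exists, so it may be evaluated by summing over a first; comparison with the sum
  -- of S * B b over b then identifies its value.
  have h1 : HasOpSum (fun b => S * B b) (opSum fun x : α × β => A x.1 * B x.2) :=
    hl.hasOpSum.prod_snd fun b => h.mul_right (B b)
  rw [← hl.opSum_apply, h1.unique (hB.mul_left S)]

lemma commute {B : Module.End ℂ W} (h : HasOpSum A S) (hc : ∀ i, Commute B (A i)) :
    Commute B S := by
  refine (h.mul_left B).unique ((h.mul_right B).congr fun i => (hc i).symm)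

lemma of_fintype [Fintype α] (A : α → Module.End ℂ W) : HasOpSum A (∑ i, A i) :=
  ⟨fun _ => Set.toFinite _, fun w => by
    rw [finsum_eq_sum_of_fintype, LinearMap.sum_apply]⟩

lemma of_finset (s : Finset α) (h : ∀ i ∉ s, A i = 0) : HasOpSum A (∑ i ∈ s, A i) :=
  ⟨fun w => s.finite_toSet.subset fun i hi => by
      by_contra hc
      exact hi (by simp [h i hc]),
    fun w => by
      rw [LinearMap.sum_apply]
      refine finsum_eq_sum_of_support_subset _ fun i hi => ?_
      by_contra hc
      exact hi (by simp [h i hc])⟩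

lemma single (i₀ : α) (h : ∀ i ≠ i₀, A i = 0) : HasOpSum A (A i₀) := by
  classical
  simpa using of_finset {i₀} (A := A) (by simpa using h)

lemma fintype_prod {κ : Type*} [Fintype κ] {A : κ → α → Module.End ℂ W} {S : κ → Module.End ℂ W}
    (h : ∀ j, HasOpSum (A j) (S j)) :
    HasOpSum (fun x : κ × α => A x.1 x.2) (∑ j, S j) := by
  have hl : LocFin fun x : κ × α => A x.1 x.2 := fun w => by
    refine (Set.finite_iUnion fun j => ((h j).1 w).image fun a => (j, a)).subset ?_
    rintro ⟨j, a⟩ hja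
    exact Set.mem_iUnion.2 ⟨j, a, hja, rfl⟩
  have h1 := hl.hasOpSum.prod_fst h
  rw [(of_fintype S).unique h1]
  exact hl.hasOpSum

end HasOpSum

/-- The vectors on which only finitely many members of a family are nonzero. -/
def locFinSubmodule (A : α → Module.End ℂ W) : Submodule ℂ W where
  carrier := {w | {i | A i w ≠ 0}.Finite}
  zero_mem' := by simp
  add_mem' {v w} hv hw := (Set.Finite.union hv hw).subset fun i hi => by
    by_contra hc
    simp only [Set.mem_union, Set.mem_ofPred_eq, not_or, not_not] at hc
    exact hi (by simp [hc.1, hc.2])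
  smul_mem' c w hw := Set.Finite.subset hw fun i hi h0 => hi (by simp [h0])

variable {V : Type*} [AddCommGroup V] [Module ℂ V]

/-- Pure tensors suffice: the vectors on which a family is finite form a subspace
(`locFinSubmodule`), and on it the sum is linear. -/
lemma HasOpSum.map_of_tensor {U : Type*} [AddCommGroup U] [Module ℂ U]
    {A : α → Module.End ℂ (W ⊗[ℂ] U)} {S : Module.End ℂ (W ⊗[ℂ] U)}
    (hl : ∀ w u, {i | A i (w ⊗ₜ u) ≠ 0}.Finite)
    (hs : ∀ w u, ∑ᶠ i, A i (w ⊗ₜ u) = S (w ⊗ₜ u)) : HasOpSum A S := by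
  have hA : LocFin A := fun x => by
    change x ∈ locFinSubmodule A
    induction x using TensorProduct.induction_on with
    | zero => exact zero_mem _
    | add x y hx hy => exact add_mem hx hy
    | tmul w u => exact hl w u
  refine ⟨hA, fun x => ?_⟩
  rw [← hA.opSum_apply]
  congr 1
  refine TensorProduct.ext' fun w u => ?_
  rw [hA.opSum_apply, hs]

lemma HasOpSum.rTensor {A : α → Module.End ℂ W} {S : Module.End ℂ W} (h : HasOpSum A S) :
    HasOpSum (fun i => (A i).rTensor V : α → Module.End ℂ (W ⊗[ℂ] V)) (S.rTensor V) := by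
  refine HasOpSum.map_of_tensor (fun w v => (h.1 w).subset fun i hi h0 => hi ?_) fun w v => ?_
  · simp [h0]
  · simp only [LinearMap.rTensor_tmul]
    rw [← h.2]
    exact (map_finsum ((TensorProduct.mk ℂ W V).flip v) (h.1 w)).symm

end HasOpSum

/-! ### Partial derivatives of smooth functions -/

section Calculus

variable {N : ℕ}

namespace Fn

lemma differentiableAt (φ : Fn N) (x : Fin N → ℝ) : DifferentiableAt ℝ φ.1 x :=
  φ.contDiff.differentiable (by simp) x

lemma pd_apply (μ : Fin N) (φ : Fn N) (x : Fin N → ℝ) :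
    (pd μ φ).1 x = fderiv ℝ φ.1 x (Pi.single μ 1) := rfl

lemma pd_mul (μ : Fin N) (φ ψ : Fn N) : pd μ (φ * ψ) = pd μ φ * ψ + φ * pd μ ψ := by
  ext x
  change fderiv ℝ (φ.1 * ψ.1) x _ =
    fderiv ℝ φ.1 x _ * ψ.1 x + φ.1 x * fderiv ℝ ψ.1 x _
  rw [fderiv_mul (φ.differentiableAt x) (ψ.differentiableAt x)]
  simp
  ring

lemma pd_one (μ : Fin N) : pd μ 1 = 0 := by
  have h := pd_mul μ 1 1
  simpa using h

lemma pd_coord (μ ν : Fin N) : pd μ (coord ν) = if μ = ν then 1 else 0 := by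
  have h : (coord ν).1 = Complex.ofRealCLM ∘L ContinuousLinearMap.proj (R := ℝ) (φ := fun _ => ℝ) ν :=
    rfl
  ext x
  rw [pd_apply, h, ContinuousLinearMap.fderiv]
  by_cases hμ : μ = ν
  · subst hμ; simp
  · simp [hμ, Ne.symm hμ]

/-- Symmetry of the second derivative. It makes the derivative attached to a list of modes
independent of the order of the list. -/
lemma pd_comm (μ ν : Fin N) : Commute (pd μ) (pd ν) := by
  ext φ x
  have key : ∀ μ ν : Fin N, ((pd μ * pd ν) φ).1 x =
      fderiv ℝ (fderiv ℝ φ.1) x (Pi.single μ 1) (Pi.single ν 1) := by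
    intro μ ν
    change fderiv ℝ (fun y => fderiv ℝ φ.1 y (Pi.single ν 1)) x _ = _
    have hd : DifferentiableAt ℝ (fderiv ℝ φ.1) x :=
      (φ.contDiff.fderiv_right (m := ∞) (by simp)).differentiable (by simp) x
    rw [fderiv_clm_apply hd (differentiableAt_const _)]
    simp
  rw [key, key]
  have hs : IsSymmSndFDerivAt ℝ φ.1 x := by
    refine ContDiffAt.isSymmSndFDerivAt (n := ∞) φ.contDiff.contDiffAt ?_
    simp [minSmoothness_of_isRCLikeNormedField]
    exact WithTop.coe_le_coe.2 le_top
  exact hs _ _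

/-- The additional factor can be moved to the right end because all factors commute; the induction
peels off the factor at 0, which is the only one that has to be moved past the rest. -/
lemma prod_ofFn_pow_add_single {M : Type*} [Monoid M] {n : ℕ} (a : Fin n → M)
    (ha : ∀ i j, Commute (a i) (a j)) (m : Fin n → ℕ) (i : Fin n) :
    (List.ofFn fun j => a j ^ (m + Pi.single i 1 : Fin n → ℕ) j).prod =
      (List.ofFn fun j => a j ^ m j).prod * a i := by
  induction n with
  | zero => exact i.elim0
  | succ n ih =>
    have hc : ∀ (j : Fin (n + 1)), Commute (a j)
        (List.ofFn fun j : Fin n => a j.succ ^ m j.succ).prod := fun j =>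
      Commute.list_prod_right _ _ fun _ h => by
        obtain ⟨k, rfl⟩ := (List.mem_ofFn' _ _).1 h
        exact (ha _ _).pow_right _
    simp only [List.ofFn_succ, List.prod_cons]
    cases i using Fin.cases with
    | zero =>
      have : ∀ j : Fin n, (m + Pi.single 0 1 : Fin (n + 1) → ℕ) j.succ = m j.succ := by
        intro j; simp
      simp only [this]
      rw [Pi.add_apply, Pi.single_eq_same, pow_succ, mul_assoc, mul_assoc, (hc 0).eq]
    | succ i =>
      have h1 : ∀ j : Fin n, (m + Pi.single i.succ 1 : Fin (n + 1) → ℕ) j.succ =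
          ((fun j => m (Fin.succ j)) + Pi.single i 1 : Fin n → ℕ) j := by
        intro j; simp [Pi.single_apply]
      have h2 : (m + Pi.single i.succ 1 : Fin (n + 1) → ℕ) 0 = m 0 := by
        simp
      simp only [h1, h2]
      rw [ih (fun j => a j.succ) (fun _ _ => ha _ _), mul_assoc]

lemma pdMulti_zero : pdMulti (0 : Fin N → ℕ) = 1 := by
  refine List.prod_eq_one fun x hx => ?_
  obtain ⟨k, rfl⟩ := (List.mem_ofFn' _ _).1 hx
  simp

lemma pdMulti_add_single (m : Fin N → ℕ) (μ : Fin N) (φ : Fn N) :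
    pdMulti (m + Pi.single μ 1) φ = pdMulti m (pd μ φ) := by
  rw [pdMulti, prod_ofFn_pow_add_single _ pd_comm]
  rfl

lemma pd_pdMulti_comm (m : Fin N → ℕ) (μ : Fin N) : Commute (pd μ) (pdMulti m) :=
  Commute.list_prod_right _ _ fun _ h => by
    obtain ⟨k, rfl⟩ := (List.mem_ofFn' _ _).1 h
    exact (pd_comm _ _).pow_right _

end Fn

end Calculus

/-! ### The Fock space and its canonical commutation relations -/

section FockSpace

variable {N : ℕ}

/-- A commutator of derivations is a derivation, hence it vanishes once it vanishes on the
variables. -/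
lemma pderiv_commute {σ : Type*} (i j : σ) :
    Commute (MvPolynomial.pderiv (R := ℂ) i).toLinearMap
      (MvPolynomial.pderiv (R := ℂ) j).toLinearMap := by
  classical
  have h : ⁅MvPolynomial.pderiv (R := ℂ) i, MvPolynomial.pderiv (R := ℂ) j⁆ = 0 := by
    refine MvPolynomial.derivation_ext fun k => ?_
    rw [Derivation.commutator_apply, MvPolynomial.pderiv_X, MvPolynomial.pderiv_X]
    simp only [Pi.single_apply]
    split_ifs <;> simp
  refine LinearMap.ext fun f => ?_
  have h1 := DFunLike.congr_fun h f
  rw [Derivation.commutator_apply, Derivation.zero_apply, sub_eq_zero] at h1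
  exact h1

lemma pderiv_mul_mulLeft_X {σ : Type*} [DecidableEq σ] (i j : σ) :
    (MvPolynomial.pderiv (R := ℂ) i).toLinearMap * LinearMap.mulLeft ℂ (MvPolynomial.X j) =
      LinearMap.mulLeft ℂ (MvPolynomial.X j) * (MvPolynomial.pderiv (R := ℂ) i).toLinearMap +
        if i = j then 1 else 0 := by
  refine LinearMap.ext fun f => ?_
  simp only [Module.End.mul_apply, LinearMap.mulLeft_apply, Derivation.coeFn_coe,
    Derivation.leibniz, MvPolynomial.pderiv_X, LinearMap.add_apply, smul_eq_mul]
  by_cases h : i = j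
  · subst h; simp
  · simp [h, Ne.symm h]

lemma mulLeft_commute {R : Type*} [CommRing R] [Algebra ℂ R] (a b : R) :
    Commute (LinearMap.mulLeft ℂ a) (LinearMap.mulLeft ℂ b) := by
  ext c
  simp [mul_left_comm]

lemma rTensor_lTensor_commute {V W : Type*} [AddCommGroup V] [Module ℂ V] [AddCommGroup W]
    [Module ℂ W] (A : Module.End ℂ V) (B : Module.End ℂ W) :
    Commute (A.rTensor W : Module.End ℂ (V ⊗[ℂ] W)) (B.lTensor V) := by
  change _ ∘ₗ _ = _ ∘ₗ _
  rw [LinearMap.rTensor_comp_lTensor, LinearMap.lTensor_comp_rTensor]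

lemma rTensor_commute {V W : Type*} [AddCommGroup V] [Module ℂ V] [AddCommGroup W]
    [Module ℂ W] {A B : Module.End ℂ V} (h : Commute A B) :
    Commute (A.rTensor W : Module.End ℂ (V ⊗[ℂ] W)) (B.rTensor W) := by
  change _ * _ = _ * _
  rw [← LinearMap.rTensor_mul, h.eq, LinearMap.rTensor_mul]

lemma lTensor_commute {V W : Type*} [AddCommGroup V] [Module ℂ V] [AddCommGroup W]
    [Module ℂ W] {A B : Module.End ℂ W} (h : Commute A B) :
    Commute (A.lTensor V : Module.End ℂ (V ⊗[ℂ] W)) (B.lTensor V) := by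
  change _ * _ = _ * _
  rw [← LinearMap.lTensor_mul, h.eq, LinearMap.lTensor_mul]

namespace Fock

/-- A frequency is zero, positive or negative. -/
lemma mode_cases (n : ℤ) :
    n = Int.ofNat 0 ∨ (∃ k, n = Int.ofNat (k + 1)) ∨ ∃ k, n = Int.negSucc k := by
  rcases n with n | n
  · rcases n with _ | n
    · exact Or.inl rfl
    · exact Or.inr (Or.inl ⟨n, rfl⟩)
  · exact Or.inr (Or.inr ⟨n, rfl⟩)

lemma mulFn_mul (φ ψ : Fn N) : mulFn (φ * ψ) = mulFn φ * mulFn ψ := by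
  rw [mulFn, LinearMap.mulLeft_mul]
  exact LinearMap.rTensor_comp ..

lemma mulFn_commute (φ ψ : Fn N) : Commute (mulFn φ) (mulFn ψ) :=
  rTensor_commute (mulLeft_commute φ ψ)

lemma mulFn_one : mulFn (1 : Fn N) = 1 := by
  rw [mulFn, LinearMap.mulLeft_one]
  exact LinearMap.rTensor_id ..

lemma mulFn_add (φ ψ : Fn N) : mulFn (φ + ψ) = mulFn φ + mulFn ψ := by
  rw [mulFn, mulFn, mulFn, ← LinearMap.rTensor_add]
  congr 1
  ext x
  simp [add_mul]

lemma mulFn_smul (c : ℂ) (φ : Fn N) : mulFn (c • φ) = c • mulFn φ := by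
  rw [mulFn, mulFn, ← LinearMap.rTensor_smul]
  congr 1
  ext x
  simp

lemma mulFn_zero : mulFn (0 : Fn N) = 0 := by
  simpa using mulFn_smul 0 (0 : Fn N)

/-- Positive modes of q differentiate in the `inr` variables, negative ones multiply by `inl`
variables, and the zero mode acts on the other tensor factor; no two of them are conjugate. -/
lemma qField_commute (μ ν : Fin N) (m n : ℤ) : Commute (qField μ m) (qField ν n) := by
  rcases mode_cases m with rfl | ⟨k, rfl⟩ | ⟨k, rfl⟩ <;>
  rcases mode_cases n with rfl | ⟨l, rfl⟩ | ⟨l, rfl⟩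
  · exact mulFn_commute _ _
  · exact (rTensor_lTensor_commute _ _).smul_right _
  · exact rTensor_lTensor_commute _ _
  · exact ((rTensor_lTensor_commute _ _).smul_right _).symm
  · exact ((lTensor_commute (pderiv_commute _ _)).smul_right _).smul_left _
  · refine (lTensor_commute ?_).smul_left _
    change _ * _ = _ * _
    rw [pderiv_mul_mulLeft_X]
    simp
  · exact (rTensor_lTensor_commute _ _).symm
  · refine ((lTensor_commute ?_).smul_left _).symm
    change _ * _ = _ * _
    rw [pderiv_mul_mulLeft_X]
    simp
  · exact lTensor_commute (mulLeft_commute _ _)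

lemma mulFn_commute_qField (φ : Fn N) (ν : Fin N) (n : ℤ) : Commute (mulFn φ) (qField ν n) := by
  rcases mode_cases n with rfl | ⟨l, rfl⟩ | ⟨l, rfl⟩
  · exact mulFn_commute _ _
  · exact (rTensor_lTensor_commute _ _).smul_right _
  · exact rTensor_lTensor_commute _ _

/-- As for q, with `inl` and `inr` exchanged; for two zero modes this is the symmetry of second
derivatives. -/
lemma pField_commute (μ ν : Fin N) (m n : ℤ) : Commute (pField μ m) (pField ν n) := by
  rcases mode_cases m with rfl | ⟨k, rfl⟩ | ⟨k, rfl⟩ <;>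
  rcases mode_cases n with rfl | ⟨l, rfl⟩ | ⟨l, rfl⟩
  · exact ((rTensor_commute (Fn.pd_comm _ _)).smul_right _).smul_left _
  · exact ((rTensor_lTensor_commute _ _).smul_right _).smul_left _
  · exact (rTensor_lTensor_commute _ _).smul_left _
  · exact (((rTensor_lTensor_commute _ _).smul_right _).smul_left _).symm
  · exact ((lTensor_commute (pderiv_commute _ _)).smul_right _).smul_left _
  · refine (lTensor_commute ?_).smul_left _
    change _ * _ = _ * _
    rw [pderiv_mul_mulLeft_X]
    simp
  · exact ((rTensor_lTensor_commute _ _).smul_left _).symm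
  · refine ((lTensor_commute ?_).smul_left _).symm
    change _ * _ = _ * _
    rw [pderiv_mul_mulLeft_X]
    simp
  · exact lTensor_commute (mulLeft_commute _ _)

lemma pd_mul_mulLeft (μ : Fin N) (φ : Fn N) :
    Fn.pd μ * LinearMap.mulLeft ℂ φ =
      LinearMap.mulLeft ℂ φ * Fn.pd μ + LinearMap.mulLeft ℂ (Fn.pd μ φ) := by
  ext1 ψ
  simp only [Module.End.mul_apply, LinearMap.mulLeft_apply, LinearMap.add_apply, Fn.pd_mul]
  rw [add_comm]

/-- `[p_{μ,k}, φ(q_0)]`. -/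
lemma pField_mul_mulFn (μ : Fin N) (k : ℤ) (φ : Fn N) :
    pField μ k * mulFn φ = mulFn φ * pField μ k +
      if k = 0 then (1 / (2 * Real.pi) : ℂ) • mulFn (Fn.pd μ φ) else 0 := by
  rcases mode_cases k with rfl | ⟨k, rfl⟩ | ⟨k, rfl⟩
  · rw [if_pos (by rfl)]
    change ((1 / (2 * Real.pi) : ℂ) • (Fn.pd μ).rTensor (Osc N)) * mulFn φ =
      mulFn φ * ((1 / (2 * Real.pi) : ℂ) • (Fn.pd μ).rTensor (Osc N)) + _
    rw [smul_mul_assoc, mul_smul_comm, ← smul_add]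
    congr 1
    simp only [mulFn]
    rw [← LinearMap.rTensor_mul, ← LinearMap.rTensor_mul, ← LinearMap.rTensor_add, pd_mul_mulLeft]
  · rw [if_neg (by simp; omega), add_zero]
    exact ((rTensor_lTensor_commute _ _).smul_right _).symm
  · rw [if_neg (by simp), add_zero]
    exact (rTensor_lTensor_commute _ _).symm

/-- `[p_{μ,k}, q^ν_n] = δ^ν_μ δ_{k+n,0} / 2π`. -/
lemma pField_mul_qField (μ ν : Fin N) (k n : ℤ) :
    pField μ k * qField ν n = qField ν n * pField μ k +
      if μ = ν ∧ k + n = 0 then (1 / (2 * Real.pi) : ℂ) • 1 else 0 := by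
  rcases mode_cases n with rfl | ⟨l, rfl⟩ | ⟨l, rfl⟩
  · change pField μ k * mulFn (Fn.coord ν) = mulFn (Fn.coord ν) * pField μ k + _
    rw [pField_mul_mulFn, Fn.pd_coord]
    congr 1
    by_cases hk : k = 0 <;> by_cases h : μ = ν <;> simp [hk, h, mulFn_one, mulFn_zero]
  · rcases mode_cases k with rfl | ⟨k, rfl⟩ | ⟨k, rfl⟩
    · rw [if_neg (by simp; omega), add_zero]
      exact ((rTensor_lTensor_commute _ _).smul_right _).smul_left _
    · rw [if_neg (by simp; omega), add_zero]
      exact ((lTensor_commute (pderiv_commute _ _)).smul_right _).smul_left _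
    · change (LinearMap.mulLeft ℂ (MvPolynomial.X (Sum.inr (μ, k)) : Osc N)).lTensor (Fn N) *
        ((-(1 / (2 * Real.pi)) : ℂ) •
          (MvPolynomial.pderiv (R := ℂ) (Sum.inr (ν, l))).toLinearMap.lTensor (Fn N)) =
        ((-(1 / (2 * Real.pi)) : ℂ) •
          (MvPolynomial.pderiv (R := ℂ) (Sum.inr (ν, l))).toLinearMap.lTensor (Fn N)) *
        (LinearMap.mulLeft ℂ (MvPolynomial.X (Sum.inr (μ, k)) : Osc N)).lTensor (Fn N) + _
      rw [smul_mul_assoc, mul_smul_comm, ← LinearMap.lTensor_mul, ← LinearMap.lTensor_mul,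
        pderiv_mul_mulLeft_X, LinearMap.lTensor_add, smul_add, add_assoc,
        left_eq_add]
      have h : (Int.negSucc k + Int.ofNat (l + 1) = 0) ↔ k = l := by
        rw [Int.negSucc_eq]; simp only [Int.ofNat_eq_natCast]; push_cast; omega
      simp only [h]
      by_cases h1 : μ = ν <;> by_cases h2 : k = l
      · subst h1 h2
        simp [show (1 : Module.End ℂ (Osc N)) = LinearMap.id from rfl,
          show (1 : Module.End ℂ (Fock N)) = LinearMap.id from rfl]
      · simp [h1, h2, Ne.symm h2]
      · simp [h1, h2, Ne.symm h1]
      · simp [h1, h2, Ne.symm h1]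
  · rcases mode_cases k with rfl | ⟨k, rfl⟩ | ⟨k, rfl⟩
    · rw [if_neg (by simp), add_zero]
      exact (rTensor_lTensor_commute _ _).smul_left _
    · change ((1 / (2 * Real.pi) : ℂ) •
          (MvPolynomial.pderiv (R := ℂ) (Sum.inl (μ, k))).toLinearMap.lTensor (Fn N)) *
        (LinearMap.mulLeft ℂ (MvPolynomial.X (Sum.inl (ν, l)) : Osc N)).lTensor (Fn N) =
        (LinearMap.mulLeft ℂ (MvPolynomial.X (Sum.inl (ν, l)) : Osc N)).lTensor (Fn N) *
        ((1 / (2 * Real.pi) : ℂ) •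
          (MvPolynomial.pderiv (R := ℂ) (Sum.inl (μ, k))).toLinearMap.lTensor (Fn N)) + _
      rw [smul_mul_assoc, mul_smul_comm, ← LinearMap.lTensor_mul, ← LinearMap.lTensor_mul,
        pderiv_mul_mulLeft_X, LinearMap.lTensor_add, smul_add]
      have h : (Int.ofNat (k + 1) + Int.negSucc l = 0) ↔ k = l := by
        rw [Int.negSucc_eq]; simp only [Int.ofNat_eq_natCast]; push_cast; omega
      simp only [h]
      congr 1
      by_cases h1 : μ = ν <;> by_cases h2 : k = l
      · subst h1 h2
        simp [show (1 : Module.End ℂ (Osc N)) = LinearMap.id from rfl,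
          show (1 : Module.End ℂ (Fock N)) = LinearMap.id from rfl]
      · simp [h1, h2]
      · simp [h1, h2]
      · simp [h1, h2]
    · rw [if_neg (by rw [Int.negSucc_eq, Int.negSucc_eq]; omega), add_zero]
      exact lTensor_commute (mulLeft_commute _ _)

/-- The vacuum vector. -/
def vac : Fock N := (1 : Fn N) ⊗ₜ (1 : Osc N)

/-- The Fock space is generated from the vacuum by functions of the zero modes and by the creation
operators. -/
lemma induction {P : Fock N → Prop} (hvac : P vac)
    (hadd : ∀ v w, P v → P w → P (v + w)) (hfn : ∀ φ w, P w → P (mulFn φ w))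
    (hq : ∀ μ n w, n < 0 → P w → P (qField μ n w))
    (hp : ∀ μ n w, n < 0 → P w → P (pField μ n w)) (w : Fock N) : P w := by
  have hzero : P 0 := by simpa [mulFn_zero] using hfn 0 vac hvac
  induction w using TensorProduct.induction_on with
  | zero => exact hzero
  | add v w hv hw => exact hadd v w hv hw
  | tmul φ f =>
    have h1 : P ((1 : Fn N) ⊗ₜ f) := by
      induction f using MvPolynomial.induction_on with
      | C a =>
        have := hfn (a • 1) vac hvac
        simpa [mulFn, vac, MvPolynomial.C_eq_smul_one, TensorProduct.smul_tmul] using this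
      | add f h hf hh => rw [TensorProduct.tmul_add]; exact hadd _ _ hf hh
      | mul_X f i hf =>
        rcases i with ⟨μ, k⟩ | ⟨μ, k⟩
        · have h2 := hq μ (Int.negSucc k) _ (Int.negSucc_lt_zero k) hf
          rw [mul_comm]
          exact h2
        · have h2 := hp μ (Int.negSucc k) _ (Int.negSucc_lt_zero k) hf
          rw [mul_comm]
          exact h2
    simpa [mulFn] using hfn φ _ h1

lemma qField_vac {μ : Fin N} {n : ℤ} (hn : 0 < n) : qField μ n vac = 0 := by
  rcases mode_cases n with rfl | ⟨l, rfl⟩ | ⟨l, rfl⟩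
  · exact absurd hn (lt_irrefl _)
  · change (-(1 / (2 * Real.pi)) : ℂ) • ((1 : Fn N) ⊗ₜ[ℂ] _) = 0
    simp
  · exact absurd hn (Int.negSucc_lt_zero l).not_gt

lemma pField_vac {μ : Fin N} {n : ℤ} (hn : 0 ≤ n) : pField μ n vac = 0 := by
  rcases mode_cases n with rfl | ⟨l, rfl⟩ | ⟨l, rfl⟩
  · change (1 / (2 * Real.pi) : ℂ) • (Fn.pd μ 1 ⊗ₜ[ℂ] (1 : Osc N)) = 0
    simp [Fn.pd_one]
  · change (1 / (2 * Real.pi) : ℂ) • ((1 : Fn N) ⊗ₜ[ℂ] _) = 0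
    simp
  · exact absurd hn (Int.negSucc_lt_zero l).not_ge

/-- An operator that commutes with the functions of `q_0` and the modes of `q(t)`, and whose
commutators with the modes of `p(t)` lie in a class of such operators killing the vacuum,
vanishes. -/
lemma eq_zero_of_vac {κ : Type*} (E : κ → Module.End ℂ (Fock N))
    (hvac : ∀ i, E i vac = 0) (hfn : ∀ i φ, Commute (mulFn φ) (E i))
    (hq : ∀ i μ n, Commute (qField μ n) (E i))
    (hp : ∀ i μ n w, (∀ j, E j w = 0) → (pField μ n * E i - E i * pField μ n : Module.End ℂ (Fock N)) w = 0) (i : κ) :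
    E i = 0 := by
  -- The vector comes before the index: moving `E i` past a mode of p produces other members of the
  -- family, so the induction over w must carry all of them.
  suffices h : ∀ w, ∀ i, E i w = 0 from LinearMap.ext fun w => h w i
  intro w
  induction w using Fock.induction with
  | hvac => exact hvac
  | hadd v w hv hw => intro i; rw [map_add, hv, hw, add_zero]
  | hfn φ w hw =>
    intro i
    rw [← Module.End.mul_apply, ← (hfn i φ).eq, Module.End.mul_apply, hw, map_zero]
  | hq μ n w _ hw =>
    intro i
    rw [← Module.End.mul_apply, ← (hq i μ n).eq, Module.End.mul_apply, hw, map_zero]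
  | hp μ n w _ hw =>
    intro i
    have h := hp i μ n w hw
    rw [LinearMap.sub_apply, Module.End.mul_apply, Module.End.mul_apply, hw, map_zero, zero_sub,
      neg_eq_zero] at h
    exact h

end Fock

end FockSpace

/-! ### The algebra of commuting fields -/

section FieldAlgebra

variable {W : Type*} [AddCommGroup W] [Module ℂ W]

namespace OpField

/-- The modes of large frequency of the field annihilate each vector. -/
def Ann (B : OpField W) : Prop := ∀ w, ∃ n₀ : ℤ, ∀ n ≥ n₀, B n w = 0

/-- All modes of the two fields commute. -/
def FComm (B C : OpField W) : Prop := ∀ m n, Commute (B m) (C n)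

/-- A trigonometric polynomial as a field of scalar operators. -/
def scalar (f : Trig) : OpField W := fun n => f.coeff n • 1

/-- The field with modes `v(n) B_n`. -/
def weight (v : ℤ → ℂ) (B : OpField W) : OpField W := fun n => v n • B n

lemma FComm.symm {B C : OpField W} (h : FComm B C) : FComm C B := fun m n => (h n m).symm

lemma FComm.weight_left {B C : OpField W} (h : FComm B C) (v : ℤ → ℂ) : FComm (weight v B) C :=
  fun m n => (h m n).smul_left _

lemma FComm.weight_right {B C : OpField W} (h : FComm B C) (v : ℤ → ℂ) : FComm B (weight v C) :=
  fun m n => (h m n).smul_right _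

lemma FComm.dot_left {B C : OpField W} (h : FComm B C) : FComm B.dot C := h.weight_left _

lemma FComm.dot_right {B C : OpField W} (h : FComm B C) : FComm B C.dot := h.weight_right _

lemma FComm.add_right {B C D : OpField W} (h : FComm B C) (h' : FComm B D) : FComm B (C + D) :=
  fun m n => (h m n).add_right (h' m n)

lemma FComm.neg_right {B C : OpField W} (h : FComm B C) : FComm B (-C) :=
  fun m n => (h m n).neg_right

lemma FComm.neg_left {B C : OpField W} (h : FComm B C) : FComm (-B) C :=
  fun m n => (h m n).neg_left

lemma FComm.sub_right {B C D : OpField W} (h : FComm B C) (h' : FComm B D) : FComm B (C - D) :=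
  fun m n => (h m n).sub_right (h' m n)

lemma fcomm_scalar_left (f : Trig) (B : OpField W) : FComm (scalar f) B :=
  fun _ _ => (Commute.one_left _).smul_left _

lemma fcomm_scalar_right (f : Trig) (B : OpField W) : FComm B (scalar f) :=
  (fcomm_scalar_left f B).symm

lemma Ann.weight {B : OpField W} (h : Ann B) (v : ℤ → ℂ) : Ann (weight v B) := fun w => by
  obtain ⟨n₀, hn⟩ := h w
  exact ⟨n₀, fun n h => by simp [OpField.weight, hn n h]⟩

lemma Ann.dot {B : OpField W} (h : Ann B) : Ann B.dot := h.weight _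

lemma Ann.add {B C : OpField W} (hB : Ann B) (hC : Ann C) : Ann (B + C) := fun w => by
  obtain ⟨b, hb⟩ := hB w
  obtain ⟨c, hc⟩ := hC w
  exact ⟨max b c, fun n h => by
    simp [hb n (le_of_max_le_left h), hc n (le_of_max_le_right h)]⟩

lemma Ann.smul {B : OpField W} (h : Ann B) (a : ℂ) : Ann (a • B) := h.weight fun _ => a

lemma Ann.neg {B : OpField W} (h : Ann B) : Ann (-B) := by
  have e : -B = (-1 : ℂ) • B := by
    funext n
    simp
  rw [e]
  exact h.smul _

lemma ann_zero : Ann (0 : OpField W) := fun _ => ⟨0, fun _ _ => rfl⟩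

lemma ann_scalar (f : Trig) : Ann (scalar f : OpField W) := fun w => by
  obtain ⟨b, hb⟩ := f.coeff.support.finite_toSet.bddAbove
  refine ⟨b + 1, fun n hn => ?_⟩
  have : f.coeff n = 0 := by
    by_contra hc
    have := hb (Finset.mem_coe.2 (Finsupp.mem_support_iff.2 hc))
    omega
  simp [scalar, this]

/-- A large n - k is killed by C, which acts first; a large k is killed by B after commuting it to
the right. So k stays in a bounded interval. -/
lemma locFin_mulTerm {B C : OpField W} (hB : Ann B) (hC : Ann C) (h : FComm B C) (n : ℤ) :
    LocFin (mulTerm B C n) := fun w => by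
  obtain ⟨b, hb⟩ := hB w
  obtain ⟨c, hc⟩ := hC w
  refine (Set.finite_Ioo (n - c) b).subset fun k hk => ?_
  simp only [Set.mem_ofPred_eq, mulTerm] at hk
  constructor <;> by_contra! hlt
  · exact hk (by rw [Module.End.mul_apply, hc _ (by omega), map_zero])
  · exact hk (by rw [(h _ _).eq, Module.End.mul_apply, hb _ hlt, map_zero])

lemma hasOpSum_mul {B C : OpField W} (hB : Ann B) (hC : Ann C) (h : FComm B C) (n : ℤ) :
    HasOpSum (fun k => B k * C (n - k)) (mul B C n) := (locFin_mulTerm hB hC h n).hasOpSum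

lemma mul_eq_of_hasOpSum {B C D : OpField W}
    (h : ∀ n, HasOpSum (fun k => B k * C (n - k)) (D n)) : mul B C = D :=
  funext fun n => (h n).opSum_eq

lemma Ann.mul {B C : OpField W} (hB : Ann B) (hC : Ann C) (h : FComm B C) : Ann (mul B C) := by
  intro w
  obtain ⟨b, hb⟩ := hB w
  obtain ⟨c, hc⟩ := hC w
  -- If n ≥ b + c, each splitting of n into k and n - k has k ≥ b or n - k ≥ c, so one factor
  -- annihilates w.
  refine ⟨b + c, fun n hn => ?_⟩
  rw [← (hasOpSum_mul hB hC h n).2]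
  refine finsum_eq_zero_of_forall_eq_zero fun k => ?_
  rcases lt_or_ge k b with hk | hk
  · change (B k * C (n - k)) w = 0
    rw [Module.End.mul_apply, hc _ (by omega), map_zero]
  · change (B k * C (n - k)) w = 0
    rw [(h _ _).eq, Module.End.mul_apply, hb _ hk, map_zero]

lemma FComm.mul_right {B C D : OpField W} (hC : Ann C) (hD : Ann D) (hCD : FComm C D)
    (h : FComm B C) (h' : FComm B D) : FComm B (mul C D) := fun _ n =>
  (hasOpSum_mul hC hD hCD n).commute fun _ => (h _ _).mul_right (h' _ _)

lemma mul_comm {B C : OpField W} (hB : Ann B) (hC : Ann C) (h : FComm B C) :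
    mul B C = mul C B := by
  refine mul_eq_of_hasOpSum fun n => ?_
  refine ((hasOpSum_mul hC hB h.symm n).comp_equiv (Equiv.subLeft n)).congr fun k => ?_
  simp only [Equiv.subLeft_apply, sub_sub_cancel]
  exact ((h _ _).eq).symm

lemma mul_add {B C D : OpField W} (hB : Ann B) (hC : Ann C) (hD : Ann D) (h : FComm B C)
    (h' : FComm B D) : mul B (C + D) = mul B C + mul B D :=
  mul_eq_of_hasOpSum fun n =>
    ((hasOpSum_mul hB hC h n).add (hasOpSum_mul hB hD h' n)).congr fun k => by
      simp [_root_.mul_add]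

lemma mul_sub {B C D : OpField W} (hB : Ann B) (hC : Ann C) (hD : Ann D) (h : FComm B C)
    (h' : FComm B D) : mul B (C - D) = mul B C - mul B D :=
  mul_eq_of_hasOpSum fun n =>
    ((hasOpSum_mul hB hC h n).sub (hasOpSum_mul hB hD h' n)).congr fun k => by
      simp [_root_.mul_sub]

lemma mul_sum {κ : Type*} {s : Finset κ} {B : OpField W} {C : κ → OpField W} (hB : Ann B)
    (hC : ∀ i ∈ s, Ann (C i)) (h : ∀ i ∈ s, FComm B (C i)) :
    mul B (∑ i ∈ s, C i) = ∑ i ∈ s, mul B (C i) :=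
  mul_eq_of_hasOpSum fun n => by
    rw [Finset.sum_apply]
    refine (HasOpSum.sum s fun i hi => hasOpSum_mul hB (hC i hi) (h i hi) n).congr fun k => ?_
    rw [Finset.sum_apply, Finset.mul_sum]

lemma sum_mul {κ : Type*} {s : Finset κ} {B : OpField W} {C : κ → OpField W} (hB : Ann B)
    (hC : ∀ i ∈ s, Ann (C i)) (h : ∀ i ∈ s, FComm (C i) B) :
    mul (∑ i ∈ s, C i) B = ∑ i ∈ s, mul (C i) B :=
  mul_eq_of_hasOpSum fun n => by
    rw [Finset.sum_apply]
    refine (HasOpSum.sum s fun i hi => hasOpSum_mul (hC i hi) hB (h i hi) n).congr fun k => ?_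
    rw [Finset.sum_apply, Finset.sum_mul]

lemma mul_smul {B C : OpField W} (hB : Ann B) (hC : Ann C) (h : FComm B C) (a : ℂ) :
    mul B (a • C) = a • mul B C :=
  mul_eq_of_hasOpSum fun n =>
    ((hasOpSum_mul hB hC h n).smul a).congr fun k => by simp

lemma smul_mul {B C : OpField W} (hB : Ann B) (hC : Ann C) (h : FComm B C) (a : ℂ) :
    mul (a • B) C = a • mul B C :=
  mul_eq_of_hasOpSum fun n =>
    ((hasOpSum_mul hB hC h n).smul a).congr fun k => by simp

lemma mul_neg {B C : OpField W} (hB : Ann B) (hC : Ann C) (h : FComm B C) :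
    mul B (-C) = -mul B C := by
  simpa using mul_smul hB hC h (-1)

lemma neg_mul {B C : OpField W} (hB : Ann B) (hC : Ann C) (h : FComm B C) :
    mul (-B) C = -mul B C := by
  simpa using smul_mul hB hC h (-1)

/-- Each of the three frequencies is bounded above on w, since commutation lets the corresponding
factor act first; their sum is n, so they are bounded below too. -/
lemma locFin_triple {B C D : OpField W} (hB : Ann B) (hC : Ann C) (hD : Ann D) (hBC : FComm B C)
    (hBD : FComm B D) (hCD : FComm C D) (n : ℤ) :
    LocFin fun x : ℤ × ℤ => B x.1 * (C x.2 * D (n - x.1 - x.2)) := fun w => by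
  obtain ⟨b, hb⟩ := hB w
  obtain ⟨c, hc⟩ := hC w
  obtain ⟨d, hd⟩ := hD w
  refine ((Set.finite_Ioo (n - d - c) b).prod (Set.finite_Ioo (n - d - b) c)).subset ?_
  rintro ⟨j, k⟩ hk
  simp only [Set.mem_ofPred_eq] at hk
  have h1 : j < b := by
    by_contra! hlt
    refine hk ?_
    rw [((hBC _ _).mul_right (hBD _ _)).eq, Module.End.mul_apply, hb _ hlt, map_zero]
  have h2 : k < c := by
    by_contra! hlt
    refine hk ?_
    rw [(hCD _ _).eq, Module.End.mul_apply, Module.End.mul_apply, hc _ hlt, map_zero, map_zero]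
  have h3 : n - j - k < d := by
    by_contra! hlt
    refine hk ?_
    rw [Module.End.mul_apply, Module.End.mul_apply, hd _ hlt, map_zero, map_zero]
  simp only [Set.mem_prod, Set.mem_Ioo]
  omega

/-- The substitution `(j, k) ↦ (j + k, j)` of frequencies. -/
def modeShear : ℤ × ℤ ≃ ℤ × ℤ where
  toFun x := (x.2, x.1 - x.2)
  invFun x := (x.1 + x.2, x.1)
  left_inv x := by simp
  right_inv x := by simp

lemma hasOpSum_triple {B C D : OpField W} (hB : Ann B) (hC : Ann C) (hD : Ann D) (hBC : FComm B C)
    (hBD : FComm B D) (hCD : FComm C D) (n : ℤ) :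
    HasOpSum (fun x : ℤ × ℤ => B x.1 * (C x.2 * D (n - x.1 - x.2))) (mul (mul B C) D n) := by
  have h := (locFin_triple hB hC hD hBC hBD hCD n).hasOpSum
  have h1 : HasOpSum (fun m => mul B C m * D (n - m))
      (opSum fun x : ℤ × ℤ => B x.1 * (C x.2 * D (n - x.1 - x.2))) := by
    refine (h.comp_equiv modeShear).prod_fst fun m => ?_
    refine ((hasOpSum_mul hB hC hBC m).mul_right (D (n - m))).congr fun k => ?_
    simp only [modeShear, Equiv.coe_fn_mk, mul_assoc, sub_sub, add_sub_cancel]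
  have h2 : mul (mul B C) D n = _ := h1.opSum_eq
  rw [h2]
  exact h

/-- Both bracketings are iterated evaluations of one locally finite sum over triples of frequencies
with total n. -/
lemma mul_assoc {B C D : OpField W} (hB : Ann B) (hC : Ann C) (hD : Ann D) (hBC : FComm B C)
    (hBD : FComm B D) (hCD : FComm C D) : mul (mul B C) D = mul B (mul C D) := by
  symm
  refine mul_eq_of_hasOpSum fun n => ?_
  exact (hasOpSum_triple hB hC hD hBC hBD hCD n).prod_fst fun j =>
    (hasOpSum_mul hC hD hCD (n - j)).mul_left (B j)

lemma dot_mul {B C : OpField W} (hB : Ann B) (hC : Ann C) (h : FComm B C) :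
    (mul B C).dot = mul B.dot C + mul B C.dot := by
  funext n
  refine ((hasOpSum_mul hB hC h n).smul (Complex.I * n)).unique (((hasOpSum_mul hB.dot hC h.dot_left n).add
    (hasOpSum_mul hB hC.dot h.dot_right n)).congr fun k => ?_)
  simp only [OpField.dot, smul_mul_assoc, mul_smul_comm, ← add_smul]
  congr 1
  push_cast
  ring

lemma hasOpSum_smear (f : Trig) (B : OpField W) (n : ℤ) :
    HasOpSum (fun k => (scalar f : OpField W) k * B (n - k)) (smear f B n) := by
  have h := HasOpSum.of_finset (A := fun k => (scalar f : OpField W) k * B (n - k)) f.coeff.support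
    (fun i hi => by simp [scalar, Finsupp.notMem_support_iff.1 hi])
  simpa [smear, Finsupp.sum, scalar] using h

/-- A test function is treated as a field of scalars, so that smearing falls under the product
calculus. -/
lemma smear_eq_mul (f : Trig) (B : OpField W) : smear f B = mul (scalar f) B :=
  (mul_eq_of_hasOpSum fun n => hasOpSum_smear f B n).symm

lemma scalar_dot (f : Trig) : (scalar f : OpField W).dot = scalar f.dot := by
  funext n
  simp [OpField.dot, scalar, Trig.coeff_dot, smul_smul]

lemma scalar_sub (f h : Trig) : (scalar (f - h) : OpField W) = scalar f - scalar h := by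
  funext n
  simp [scalar, sub_smul]

lemma scalar_mul (f h : Trig) : (scalar (f * h) : OpField W) = mul (scalar f) (scalar h) := by
  refine (mul_eq_of_hasOpSum fun n => ?_).symm
  have e : (scalar (f * h) : OpField W) n = smear f (scalar h : OpField W) n := by
    simp only [scalar, smear, smul_smul]
    rw [AddMonoidAlgebra.coeff_mul_apply_left]
    simp only [Finsupp.sum, Finset.sum_smul, neg_add_eq_sub]
  rw [e]
  exact hasOpSum_smear f _ n

end OpField

end FieldAlgebra

/-! ### Removal and insertion of list entries -/

section Insertion

variable {X W : Type*} [AddCommGroup W] [Module ℂ W]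

open Classical in
/-- Averaging over the positions at which an element can be removed from a list undoes the
insertion of that element. -/
lemma finsum_list_removal (F : X → List X → W)
    (hF : (Function.support fun x : X × List X => F x.1 x.2).Finite) :
    (Function.support fun l : List X =>
        ∑ i : Fin l.length, (1 / (l.length : ℂ)) • F (l.get i) (l.eraseIdx i)).Finite ∧
      ∑ᶠ l : List X, ∑ i : Fin l.length, (1 / (l.length : ℂ)) • F (l.get i) (l.eraseIdx i) =
        ∑ᶠ x : X × List X, F x.1 x.2 := by
  -- f is the summand for a list with a marked position, f' the one for an entry, a list and a
  -- position for inserting the entry; both are zero at inadmissible positions. Insertion is a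
  -- bijection between the admissible data that matches f' with f.
  set f : List X × ℕ → W := fun x =>
    if h : x.2 < x.1.length then (1 / (x.1.length : ℂ)) • F (x.1[x.2]) (x.1.eraseIdx x.2) else 0
    with hf
  set f' : (X × List X) × ℕ → W := fun x =>
    if x.2 < x.1.2.length + 1 then (1 / ((x.1.2.length + 1 : ℕ) : ℂ)) • F x.1.1 x.1.2 else 0
    with hf'
  set e : (X × List X) × ℕ → List X × ℕ := fun x => (x.1.2.insertIdx x.2 x.1.1, x.2) with he
  have hmaps : ∀ x : (X × List X) × ℕ, x.2 < x.1.2.length + 1 → x.2 < (e x).1.length := by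
    rintro ⟨⟨x, l⟩, i⟩ h
    simp only [he] at h ⊢
    rw [List.length_insertIdx_of_le_length (by omega)]
    exact h
  have hfe : ∀ x : (X × List X) × ℕ, x.2 < x.1.2.length + 1 → f' x = f (e x) := by
    rintro ⟨⟨x, l⟩, i⟩ h
    have h1 := hmaps ⟨⟨x, l⟩, i⟩ h
    simp only [he] at h h1
    simp only [hf, hf', he, dif_pos h1, if_pos h, List.getElem_insertIdx_self,
      List.eraseIdx_insertIdx_self, List.length_insertIdx_of_le_length (by omega : i ≤ l.length)]
  have hbij : Set.BijOn e {x | x.2 < x.1.2.length + 1} {x | x.2 < x.1.length} := by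
    refine ⟨hmaps, ?_, ?_⟩
    · rintro ⟨⟨x, l⟩, i⟩ h ⟨⟨y, l'⟩, j⟩ h' heq
      obtain ⟨h1, h2⟩ := Prod.ext_iff.1 heq
      change i = j at h2
      subst h2
      change l.insertIdx i x = l'.insertIdx i y at h1
      have h3 := congrArg (fun l => l.eraseIdx i) h1
      simp only [List.eraseIdx_insertIdx_self] at h3
      subst h3
      have h4 := List.getElem_insertIdx_self (x := x) (hmaps ⟨⟨x, l⟩, i⟩ h)
      have h5 := List.getElem_insertIdx_self (x := y) (hmaps ⟨⟨y, l⟩, i⟩ h')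
      simp only [h1, h5] at h4
      rw [h4]
    · rintro ⟨l, i⟩ h
      simp only [Set.mem_ofPred_eq] at h
      refine ⟨((l[i], l.eraseIdx i), i), ?_, ?_⟩
      · simp only [Set.mem_ofPred_eq, List.length_eraseIdx_of_lt h]
        omega
      · simp only [he, List.insertIdx_eraseIdx_getElem h]
  have hsup' : (Function.support f').Finite := by
    refine (hF.biUnion fun x _ => (Set.finite_Iio (x.2.length + 1)).image fun i => (x, i)).subset ?_
    rintro ⟨⟨x, l⟩, i⟩ h
    simp only [Function.mem_support, hf', ne_eq, ite_eq_right_iff, Classical.not_imp,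
      smul_eq_zero, not_or] at h
    exact Set.mem_iUnion₂.2 ⟨(x, l), h.2.2, i, h.1, rfl⟩
  have hsup : (Function.support f).Finite := by
    refine (hsup'.image e).subset ?_
    intro y h
    have hy : y.2 < y.1.length := by
      by_contra hc
      exact h (by simp only [hf, dif_neg hc])
    obtain ⟨x, hx, rfl⟩ := hbij.surjOn hy
    exact ⟨x, by rw [Function.mem_support, hfe x hx]; exact h, rfl⟩
  have h1 : ∑ᶠ y, f y = ∑ᶠ x, f' x := by
    rw [← finsum_mem_univ f, ← finsum_mem_univ f']
    rw [finsum_mem_inter_support_eq' f Set.univ {x | x.2 < x.1.length}, finsum_mem_inter_support_eq'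
      f' Set.univ {x | x.2 < x.1.2.length + 1}]
    · exact (finsum_mem_eq_of_bijOn e hbij hfe).symm
    · intro x hx
      simp only [Set.mem_univ, true_iff]
      by_contra hc
      exact hx (if_neg hc)
    · intro x hx
      simp only [Set.mem_univ, true_iff]
      by_contra hc
      exact hx (dif_neg hc)
  have h2 : ∀ l : List X, ∑ᶠ i, f (l, i) =
      ∑ i : Fin l.length, (1 / (l.length : ℂ)) • F (l.get i) (l.eraseIdx i) := by
    intro l
    rw [finsum_eq_sum_of_support_subset (s := Finset.range l.length), Finset.sum_range]
    · refine Finset.sum_congr rfl fun i _ => ?_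
      simp only [hf, dif_pos i.2, List.get_eq_getElem]
    · intro i h
      by_contra hc
      exact h (by simp only [hf]; exact dif_neg (by simpa using hc))
  -- A list of length r has r + 1 insertion positions, each of weight 1 / (r + 1).
  have h3 : ∀ x : X × List X, ∑ᶠ i, f' (x, i) = F x.1 x.2 := by
    intro x
    rw [finsum_eq_sum_of_support_subset (s := Finset.range (x.2.length + 1))]
    · have : ∀ i ∈ Finset.range (x.2.length + 1), f' (x, i) =
          (1 / ((x.2.length + 1 : ℕ) : ℂ)) • F x.1 x.2 := fun i hi => by
        simp only [hf']
        rw [if_pos (Finset.mem_range.1 hi)]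
      rw [Finset.sum_congr rfl this, Finset.sum_const, Finset.card_range, ← Nat.cast_smul_eq_nsmul ℂ,
        smul_smul, mul_one_div_cancel (Nat.cast_ne_zero.2 (Nat.succ_ne_zero _)), one_smul]
    · intro i h
      by_contra hc
      exact h (by simp only [hf']; exact if_neg (by simpa using hc))
  rw [finsum_curry _ hsup, finsum_curry _ hsup'] at h1
  simp only [h2, h3] at h1
  refine ⟨(hsup.image Prod.fst).subset fun l hl => ?_, h1⟩
  rw [Function.mem_support, ← h2] at hl
  obtain ⟨i, hi⟩ : ∃ i, f (l, i) ≠ 0 := by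
    by_contra! hc
    exact hl (finsum_eq_zero_of_forall_eq_zero hc)
  exact ⟨(l, i), hi, rfl⟩

lemma HasOpSum.list_removal {F : X → List X → Module.End ℂ W} {S : Module.End ℂ W}
    (h : HasOpSum (fun x : X × List X => F x.1 x.2) S) :
    HasOpSum (fun l : List X =>
      ∑ i : Fin l.length, (1 / (l.length : ℂ)) • F (l.get i) (l.eraseIdx i)) S := by
  have key := fun w => finsum_list_removal (fun x l => F x l w) (h.1 w)
  refine ⟨fun w => (key w).1.subset fun l hl => ?_, fun w => ?_⟩
  · simpa [Function.mem_support, LinearMap.sum_apply] using hl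
  · rw [← h.2, ← (key w).2]
    simp [LinearMap.sum_apply]

lemma HasOpSum.prod_single {Y : Type*} {A : Y → Module.End ℂ W} {S : Module.End ℂ W}
    [DecidableEq X] (x₀ : X) (h : HasOpSum A S) :
    HasOpSum (fun x : X × Y => if x.1 = x₀ then A x.2 else 0) S := by
  have hl : LocFin fun x : X × Y => if x.1 = x₀ then A x.2 else 0 := fun w => by
    refine ((h.1 w).image fun y => (x₀, y)).subset ?_
    rintro ⟨x, y⟩ hxy
    by_cases hx : x = x₀
    · subst hx
      exact ⟨y, by simpa using hxy, rfl⟩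
    · simp [hx] at hxy
  have h1 := hl.hasOpSum.prod_snd (T := A) fun y => by
    simpa using HasOpSum.single (A := fun x => if x = x₀ then A y else 0) x₀ (by simp +contextual)
  rw [h.unique h1]
  exact hl.hasOpSum

end Insertion

/-! ### The Taylor expansion of functions of the trajectory -/

section Taylor

variable {N : ℕ}

namespace Fock

/-- The product of the modes of `q(t)` in a list. -/
def qList (l : List (Fin N × ℤ)) : Module.End ℂ (Fock N) :=
  (l.map fun x => qField x.1 x.2).prod

/-- The product of the partial derivatives in the directions of a list of modes. -/
def pdList (l : List (Fin N × ℤ)) : Module.End ℂ (Fn N) := (l.map fun x => Fn.pd x.1).prod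

/-- The modes in the list are nonzero and their frequencies add up to `n`. -/
def TaylorIndex (n : ℤ) (l : List (Fin N × ℤ)) : Prop :=
  (∀ x ∈ l, x.2 ≠ 0) ∧ (l.map Prod.snd).sum = n

lemma taylorTerm_of_index {φ : Fn N} {n : ℤ} {l : List (Fin N × ℤ)} (h : TaylorIndex n l) :
    taylorTerm φ n l = (1 / (l.length.factorial : ℂ)) • (mulFn (pdList l φ) * qList l) :=
  if_pos h

lemma taylorTerm_of_not_index {φ : Fn N} {n : ℤ} {l : List (Fin N × ℤ)} (h : ¬TaylorIndex n l) :
    taylorTerm φ n l = 0 :=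
  if_neg h

lemma qList_cons (x : Fin N × ℤ) (l : List (Fin N × ℤ)) :
    qList (x :: l) = qField x.1 x.2 * qList l := by
  simp [qList]

lemma qList_commute {A : Module.End ℂ (Fock N)} (h : ∀ μ n, Commute A (qField μ n))
    (l : List (Fin N × ℤ)) : Commute A (qList l) :=
  Commute.list_prod_right _ _ fun _ hx => by
    obtain ⟨y, _, rfl⟩ := List.mem_map.1 hx
    exact h _ _

lemma qField_commute_qList (μ : Fin N) (n : ℤ) (l : List (Fin N × ℤ)) :
    Commute (qField μ n) (qList l) := qList_commute (fun _ _ => qField_commute _ _ _ _) l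

lemma qList_perm {l l' : List (Fin N × ℤ)} (h : l.Perm l') : qList l = qList l' := by
  refine (h.map _).prod_eq' ?_
  rw [List.pairwise_map]
  exact List.pairwise_of_forall fun x y => qField_commute _ _ _ _

lemma pdList_perm {l l' : List (Fin N × ℤ)} (h : l.Perm l') : pdList l = pdList l' := by
  refine (h.map _).prod_eq' ?_
  rw [List.pairwise_map]
  exact List.pairwise_of_forall fun x y => Fn.pd_comm _ _

lemma TaylorIndex.perm {n : ℤ} {l l' : List (Fin N × ℤ)} (h : l.Perm l') :
    TaylorIndex n l ↔ TaylorIndex n l' := by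
  rw [TaylorIndex, TaylorIndex, (h.map Prod.snd).sum_eq]
  simp only [h.mem_iff]

lemma taylorTerm_perm (φ : Fn N) (n : ℤ) {l l' : List (Fin N × ℤ)} (h : l.Perm l') :
    taylorTerm φ n l = taylorTerm φ n l' := by
  by_cases hl : TaylorIndex n l
  · rw [taylorTerm_of_index hl, taylorTerm_of_index ((TaylorIndex.perm h).1 hl), h.length_eq,
      pdList_perm h, qList_perm h]
  · rw [taylorTerm_of_not_index hl, taylorTerm_of_not_index (mt (TaylorIndex.perm h).2 hl)]

lemma taylorIndex_cons {n : ℤ} {x : Fin N × ℤ} {l : List (Fin N × ℤ)} :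
    TaylorIndex n (x :: l) ↔ x.2 ≠ 0 ∧ TaylorIndex (n - x.2) l := by
  simp only [TaylorIndex, List.mem_cons, forall_eq_or_imp, List.map_cons, List.sum_cons,
    eq_sub_iff_add_eq, add_comm x.2, and_assoc]

lemma pdList_cons (x : Fin N × ℤ) (l : List (Fin N × ℤ)) (φ : Fn N) :
    pdList (x :: l) φ = pdList l (Fn.pd x.1 φ) := by
  have h : Commute (Fn.pd x.1) (pdList l) := Commute.list_prod_right _ _ fun _ hx => by
    obtain ⟨y, _, rfl⟩ := List.mem_map.1 hx
    exact Fn.pd_comm _ _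
  have h1 : pdList (x :: l) = Fn.pd x.1 * pdList l := by simp [pdList]
  rw [h1, h.eq]
  rfl

/-- Splitting one mode off a list of length r + 1 turns 1/(r+1)! into 1/(r+1) times 1/r!; the first
factor is the averaging weight of `finsum_list_removal`. -/
lemma taylorTerm_cons (φ : Fn N) (n : ℤ) {x : Fin N × ℤ} (hx : x.2 ≠ 0) (l : List (Fin N × ℤ)) :
    taylorTerm φ n (x :: l) = (1 / ((l.length + 1 : ℕ) : ℂ)) •
      (qField x.1 x.2 * taylorTerm (Fn.pd x.1 φ) (n - x.2) l) := by
  by_cases hl : TaylorIndex (n - x.2) l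
  · rw [taylorTerm_of_index hl, taylorTerm_of_index (taylorIndex_cons.2 ⟨hx, hl⟩), pdList_cons,
      qList_cons, mul_smul_comm, smul_smul, ← mul_assoc, ← mul_assoc,
      (mulFn_commute_qField _ _ _).eq]
    congr 1
    rw [List.length_cons, Nat.factorial_succ]
    push_cast
    rw [one_div_mul_one_div]
  · rw [taylorTerm_of_not_index hl, taylorTerm_of_not_index (by rw [taylorIndex_cons]; tauto)]
    simp

lemma taylorTerm_commute {A : Module.End ℂ (Fock N)} (hf : ∀ φ, Commute A (mulFn φ))
    (hq : ∀ μ n, Commute A (qField μ n)) (φ : Fn N) (n : ℤ) (l : List (Fin N × ℤ)) :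
    Commute A (taylorTerm φ n l) := by
  by_cases hl : TaylorIndex n l
  · rw [taylorTerm_of_index hl]
    exact ((hf _).mul_right (qList_commute hq l)).smul_right _
  · rw [taylorTerm_of_not_index hl]
    exact Commute.zero_right _

/-- A mode of p acts by commutator as a derivation on products of modes of q, and it only contracts
with the conjugate mode. -/
lemma pField_mul_qList (μ : Fin N) (k : ℤ) (l : List (Fin N × ℤ)) :
    pField μ k * qList l = qList l * pField μ k + ∑ i : Fin l.length,
      if l.get i = (μ, -k) then (1 / (2 * Real.pi) : ℂ) • qList (l.eraseIdx i) else 0 := by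
  induction l with
  | nil => simp [qList]
  | cons x l ih =>
    have hx : (μ = x.1 ∧ k + x.2 = 0) ↔ x = (μ, -k) := by
      rw [Prod.ext_iff, eq_comm (a := μ), add_comm, add_eq_zero_iff_eq_neg]
    rw [qList_cons, ← mul_assoc, pField_mul_qField, add_mul, mul_assoc, ih, mul_add, ← mul_assoc,
      add_assoc]
    congr 1
    simp only [List.length_cons, Fin.sum_univ_succ]
    rw [add_comm, Finset.mul_sum]
    congr 1
    · simp only [hx]
      by_cases h : x = (μ, -k) <;> simp [h]
    · refine Finset.sum_congr rfl fun i _ => ?_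
      by_cases h : l[(i : ℕ)] = (μ, -k)
      · simp [h, qList_cons]
      · simp [h]

/-- Contraction removes the entry (μ, -k). The derivative belonging to it remains and is transferred
to φ, and 1/r! splits into 1/r and the weight of the shorter list. The sum over positions has the
form required by `HasOpSum.list_removal`. -/
lemma pField_taylorTerm (μ : Fin N) {k : ℤ} (hk : k ≠ 0) (φ : Fn N) (n : ℤ)
    (l : List (Fin N × ℤ)) :
    pField μ k * taylorTerm φ n l - taylorTerm φ n l * pField μ k =
      ∑ i : Fin l.length, (1 / (l.length : ℂ)) • if l.get i = (μ, -k) then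
        (1 / (2 * Real.pi) : ℂ) • taylorTerm (Fn.pd μ φ) (n + k) (l.eraseIdx i) else 0 := by
  have hperm : ∀ i : Fin l.length, (l.get i :: l.eraseIdx i).Perm l := fun i =>
    List.getElem_cons_eraseIdx_perm i.2
  by_cases hl : TaylorIndex n l
  · rw [taylorTerm_of_index hl, mul_smul_comm, smul_mul_assoc, ← end_smul_sub, ← mul_assoc,
      pField_mul_mulFn, if_neg hk, add_zero, mul_assoc, pField_mul_qList, mul_assoc, ← mul_sub,
      add_sub_cancel_left, Finset.mul_sum, Finset.smul_sum]
    refine Finset.sum_congr rfl fun i _ => ?_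
    split_ifs with h
    · have hi : TaylorIndex (n + k) (l.eraseIdx i) := by
        have := (TaylorIndex.perm (hperm i)).2 hl
        rw [taylorIndex_cons, h] at this
        simpa using this.2
      have hlen : l.length = (l.eraseIdx i).length + 1 := by
        rw [List.length_eraseIdx_of_lt i.2]
        have := i.2
        omega
      rw [taylorTerm_of_index hi, ← pdList_perm (hperm i), pdList_cons, h]
      generalize l.eraseIdx i = l' at hlen ⊢
      rw [hlen, Nat.factorial_succ, mul_smul_comm, smul_smul, smul_smul, smul_smul]
      congr 1
      push_cast
      have h1 : (l'.length : ℂ) + 1 ≠ 0 := Nat.cast_add_one_ne_zero _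
      have h2 : (l'.length.factorial : ℂ) ≠ 0 :=
        Nat.cast_ne_zero.2 (Nat.factorial_ne_zero _)
      have h3 : (Real.pi : ℂ) ≠ 0 := Complex.ofReal_ne_zero.2 Real.pi_ne_zero
      field_simp
    · simp
  · rw [taylorTerm_of_not_index hl, mul_zero, zero_mul, sub_zero]
    refine (Finset.sum_eq_zero fun i _ => ?_).symm
    split_ifs with h
    · have hi : ¬TaylorIndex (n + k) (l.eraseIdx i) := by
        intro hi
        refine hl ((TaylorIndex.perm (hperm i)).1 ?_)
        rw [taylorIndex_cons, h]
        exact ⟨by simpa using hk, by simpa using hi⟩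
      rw [taylorTerm_of_not_index hi]
      simp
    · simp

/-- The zero mode of p only differentiates the coefficient, because no mode of frequency zero occurs
in an admissible list. -/
lemma pField_zero_taylorTerm (μ : Fin N) (φ : Fn N) (n : ℤ) (l : List (Fin N × ℤ)) :
    pField μ 0 * taylorTerm φ n l - taylorTerm φ n l * pField μ 0 =
      (1 / (2 * Real.pi) : ℂ) • taylorTerm (Fn.pd μ φ) n l := by
  by_cases hl : TaylorIndex n l
  · have h0 : pField μ 0 * qList l = qList l * pField μ 0 := by
      rw [pField_mul_qList, Finset.sum_eq_zero, add_zero]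
      intro i _
      refine if_neg fun h => hl.1 (l.get i) (l.get_mem i) ?_
      rw [h]
      simp
    have h1 : pdList l (Fn.pd μ φ) = Fn.pd μ (pdList l φ) := by
      have h : Commute (Fn.pd μ) (pdList l) := Commute.list_prod_right _ _ fun _ hx => by
        obtain ⟨y, _, rfl⟩ := List.mem_map.1 hx
        exact Fn.pd_comm _ _
      exact (LinearMap.congr_fun h.eq φ).symm
    rw [taylorTerm_of_index hl, taylorTerm_of_index hl, mul_smul_comm, smul_mul_assoc, ← end_smul_sub,
      ← mul_assoc, pField_mul_mulFn, if_pos rfl, add_mul, mul_assoc, h0, mul_assoc,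
      add_sub_cancel_left, h1, smul_mul_assoc, smul_comm]
  · simp [taylorTerm_of_not_index hl]

lemma exists_pos_of_sum_pos {l : List (Fin N × ℤ)} (h : 0 < (l.map Prod.snd).sum) :
    ∃ x ∈ l, 0 < x.2 := by
  induction l with
  | nil => simp at h
  | cons y l ih =>
    rw [List.map_cons, List.sum_cons] at h
    by_cases hy : 0 < y.2
    · exact ⟨y, by simp, hy⟩
    · obtain ⟨x, hx, h0⟩ := ih (by omega)
      exact ⟨x, by simp [hx], h0⟩

lemma qList_vac {l : List (Fin N × ℤ)} {x : Fin N × ℤ} (hx : x ∈ l) (h0 : 0 < x.2) :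
    qList l vac = 0 := by
  rw [qList_perm (List.perm_cons_erase hx), qList_cons, (qField_commute_qList _ _ _).eq,
    Module.End.mul_apply, qField_vac h0, map_zero]

lemma taylorTerm_vac (φ : Fn N) (n : ℤ) {l : List (Fin N × ℤ)} (h : taylorTerm φ n l vac ≠ 0) :
    TaylorIndex n l ∧ ∀ x ∈ l, x.2 < 0 := by
  by_cases hl : TaylorIndex n l
  · refine ⟨hl, fun x hx => ?_⟩
    by_contra! hc
    refine h ?_
    rw [taylorTerm_of_index hl, LinearMap.smul_apply, Module.End.mul_apply,
      qList_vac hx (lt_of_le_of_ne hc (hl.1 x hx).symm), map_zero, smul_zero]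
  · simp [taylorTerm_of_not_index hl] at h

/-- On the vacuum only lists of negative frequencies survive. With prescribed total frequency these
have bounded length and bounded entries, so there are finitely many. -/
lemma neg_list_bounds (l : List (Fin N × ℤ)) (h : ∀ x ∈ l, x.2 < 0) :
    (l.length : ℤ) ≤ -(l.map Prod.snd).sum ∧ ∀ x ∈ l, (l.map Prod.snd).sum ≤ x.2 := by
  induction l with
  | nil => simp
  | cons y l ih =>
    simp only [List.mem_cons, forall_eq_or_imp] at h
    obtain ⟨h1, h2⟩ := ih h.2
    simp only [List.length_cons, List.map_cons, List.sum_cons, List.mem_cons, forall_eq_or_imp]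
    have h3 : (0 : ℤ) ≤ l.length := by positivity
    refine ⟨by push_cast; omega, by omega, fun x hx => ?_⟩
    have := h2 x hx
    omega

lemma finite_taylorTerm_vac (φ : Fn N) (n : ℤ) : {l | taylorTerm φ n l vac ≠ 0}.Finite := by
  have hfin : {l : List (Fin N × Fin (n.natAbs + 1)) | l.length ≤ n.natAbs}.Finite :=
    List.finite_length_le _ _
  refine (hfin.image fun l => l.map fun x => (x.1, -(x.2.1 : ℤ))).subset fun l hl => ?_
  obtain ⟨h1, h2⟩ := taylorTerm_vac φ n hl
  obtain ⟨h3, h4⟩ := neg_list_bounds l h2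
  rw [h1.2] at h3 h4
  refine ⟨l.map fun x => (x.1, Fin.ofNat _ x.2.natAbs), ?_, ?_⟩
  · simp only [Set.mem_ofPred_eq, List.length_map]
    omega
  · simp only [List.map_map]
    conv_rhs => rw [← List.map_id l]
    refine List.map_congr_left fun x hx => ?_
    have h5 := h2 x hx
    have h6 := h4 x hx
    simp only [Function.comp_apply, Fin.ofNat, id]
    rw [Nat.mod_eq_of_lt (by omega)]
    exact Prod.ext rfl (by simp only; omega)

/-- Induction over the generation of the Fock space from the vacuum, for all φ and n simultaneously.
Functions of q_0 and modes of q commute with every term. A creation mode of p adds the terms for ∂_μ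
φ with one mode inserted, which are finitely many on w by `finsum_list_removal`. -/
lemma locFin_taylorTerm (φ : Fn N) (n : ℤ) : LocFin (taylorTerm φ n) := by
  intro w
  induction w using Fock.induction generalizing φ n with
  | hvac => exact finite_taylorTerm_vac φ n
  | hadd v w hv hw => exact (locFinSubmodule (taylorTerm φ n)).add_mem (hv φ n) (hw φ n)
  | hfn ψ w hw =>
    refine (hw φ n).subset fun l hl h0 => hl ?_
    rw [← Module.End.mul_apply, ← (taylorTerm_commute (fun χ => mulFn_commute ψ χ)
      (fun μ k => mulFn_commute_qField ψ μ k) φ n l).eq, Module.End.mul_apply, h0, map_zero]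
  | hq μ k w _ hw =>
    refine (hw φ n).subset fun l hl h0 => hl ?_
    rw [← Module.End.mul_apply, ← (taylorTerm_commute
      (fun χ => (mulFn_commute_qField χ μ k).symm)
      (fun ν j => qField_commute μ ν k j) φ n l).eq, Module.End.mul_apply, h0, map_zero]
  | hp μ k w hk hw =>
    have h1 := (finsum_list_removal (fun x l => (if x = (μ, -k) then
        (1 / (2 * Real.pi) : ℂ) • taylorTerm (Fn.pd μ φ) (n + k) l else 0) w) (by
      refine ((hw (Fn.pd μ φ) (n + k)).image fun l => ((μ, -k), l)).subset ?_
      rintro ⟨x, l⟩ hx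
      by_cases h : x = (μ, -k)
      · subst h
        refine ⟨l, fun h0 => hx ?_, rfl⟩
        simp [h0]
      · simp [h] at hx)).1
    refine ((hw φ n).union h1).subset fun l hl => ?_
    by_contra hc
    simp only [Set.mem_union, Set.mem_ofPred_eq, not_or, not_not, Function.mem_support] at hc
    have h2 := LinearMap.congr_fun (pField_taylorTerm μ hk.ne φ n l) w
    simp only [LinearMap.sum_apply, LinearMap.smul_apply] at h2
    rw [hc.2, LinearMap.sub_apply, Module.End.mul_apply, hc.1, map_zero, zero_sub,
      neg_eq_zero] at h2
    exact hl h2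

lemma hasOpSum_fn (φ : Fn N) (n : ℤ) : HasOpSum (taylorTerm φ n) (fn φ n) :=
  (locFin_taylorTerm φ n).hasOpSum

/-- `[p_{μ,k}, φ(q)_n] = (∂_μ φ)(q)_{n+k} / 2π`. -/
lemma pField_fn (μ : Fin N) (k : ℤ) (φ : Fn N) (n : ℤ) :
    pField μ k * fn φ n - fn φ n * pField μ k =
      (1 / (2 * Real.pi) : ℂ) • fn (Fn.pd μ φ) (n + k) := by
  have h := ((hasOpSum_fn φ n).mul_left (pField μ k)).sub ((hasOpSum_fn φ n).mul_right (pField μ k))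
  have h' := (hasOpSum_fn (Fn.pd μ φ) (n + k)).smul (1 / (2 * Real.pi) : ℂ)
  by_cases hk : k = 0
  · subst hk
    refine h.unique (h'.congr fun l => ?_)
    rw [pField_zero_taylorTerm, add_zero]
  -- The lists that contain (μ, -k) arise from the lists for ∂_μ φ, of total frequency n + k, by
  -- inserting this entry; the average over its position undoes the insertion.
  · refine h.unique ((HasOpSum.list_removal (F := fun x l => if x = (μ, -k) then
      (1 / (2 * Real.pi) : ℂ) • taylorTerm (Fn.pd μ φ) (n + k) l else 0)
      (h'.prod_single (μ, -k))).congr fun l => ?_)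
    rw [pField_taylorTerm μ hk]

lemma fn_commute {A : Module.End ℂ (Fock N)} (hf : ∀ φ, Commute A (mulFn φ))
    (hq : ∀ μ n, Commute A (qField μ n)) (φ : Fn N) (n : ℤ) : Commute A (fn φ n) :=
  (hasOpSum_fn φ n).commute fun l => taylorTerm_commute hf hq φ n l

lemma mulFn_commute_fn (χ φ : Fn N) (n : ℤ) : Commute (mulFn χ) (fn φ n) :=
  fn_commute (mulFn_commute χ) (mulFn_commute_qField χ) φ n

lemma qField_commute_fn (μ : Fin N) (k : ℤ) (φ : Fn N) (n : ℤ) :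
    Commute (qField μ k) (fn φ n) :=
  fn_commute (fun _ => (mulFn_commute_qField _ _ _).symm) (fun _ _ => qField_commute _ _ _ _) φ n

lemma fn_commute_fn (φ ψ : Fn N) (m n : ℤ) : Commute (fn φ m) (fn ψ n) :=
  fn_commute (fun _ => (mulFn_commute_fn _ _ _).symm) (fun _ _ => (qField_commute_fn _ _ _ _).symm)
    ψ n

/-- A list with positive total contains a positive frequency, and such a mode of q can be moved onto
the vacuum. -/
lemma fn_vac_of_pos (φ : Fn N) {n : ℤ} (hn : 0 < n) : fn φ n vac = 0 := by
  rw [← (hasOpSum_fn φ n).2]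
  refine finsum_eq_zero_of_forall_eq_zero fun l => ?_
  by_contra hl
  obtain ⟨h1, h2⟩ := taylorTerm_vac φ n hl
  obtain ⟨x, hx, h3⟩ := exists_pos_of_sum_pos (h1.2 ▸ hn)
  exact (h2 x hx).not_gt h3

/-- Among the lists of negative frequencies only the empty one has total zero. -/
lemma fn_zero_vac (φ : Fn N) : fn φ 0 vac = mulFn φ vac := by
  rw [← (hasOpSum_fn φ 0).2, finsum_eq_single _ []]
  · rw [taylorTerm_of_index (by simp [TaylorIndex])]
    simp [pdList, qList]
  · intro l hl0
    by_contra hl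
    obtain ⟨h1, h2⟩ := taylorTerm_vac φ 0 hl
    have h3 := (neg_list_bounds l h2).1
    rw [h1.2] at h3
    exact hl0 (List.length_eq_zero_iff.1 (by omega))

/-- The induction of `locFin_taylorTerm` again; a mode p_{μ,k} brings in the threshold of ∂_μ φ,
shifted by -k, through `pField_fn`. -/
lemma ann_fn (φ : Fn N) : OpField.Ann (fn φ) := by
  intro w
  induction w using Fock.induction generalizing φ with
  | hvac => exact ⟨1, fun n hn => fn_vac_of_pos φ (by omega)⟩
  | hadd v w hv hw =>
    obtain ⟨a, ha⟩ := hv φ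
    obtain ⟨b, hb⟩ := hw φ
    exact ⟨max a b, fun n hn => by
      rw [map_add, ha n (le_of_max_le_left hn), hb n (le_of_max_le_right hn), add_zero]⟩
  | hfn ψ w hw =>
    obtain ⟨a, ha⟩ := hw φ
    refine ⟨a, fun n hn => ?_⟩
    rw [← Module.End.mul_apply, ← (mulFn_commute_fn ψ φ n).eq, Module.End.mul_apply, ha n hn,
      map_zero]
  | hq μ k w _ hw =>
    obtain ⟨a, ha⟩ := hw φ
    refine ⟨a, fun n hn => ?_⟩
    rw [← Module.End.mul_apply, ← (qField_commute_fn μ k φ n).eq, Module.End.mul_apply, ha n hn,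
      map_zero]
  | hp μ k w _ hw =>
    obtain ⟨a, ha⟩ := hw φ
    obtain ⟨b, hb⟩ := hw (Fn.pd μ φ)
    refine ⟨max a (b - k), fun n hn => ?_⟩
    have h := LinearMap.congr_fun (pField_fn μ k φ n) w
    rw [LinearMap.sub_apply, LinearMap.smul_apply, Module.End.mul_apply, Module.End.mul_apply,
      ha n (le_of_max_le_left hn), hb (n + k) (by have := le_of_max_le_right hn; omega), map_zero,
      smul_zero, zero_sub, neg_eq_zero] at h
    exact h

/-- Second derivatives of a coordinate vanish, so only the empty list (for n = 0) and the list with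
single entry (μ, n) (for n ≠ 0) contribute. -/
lemma fn_coord (μ : Fin N) : fn (Fn.coord μ) = qField μ := by
  funext n
  have hlong : ∀ (l : List (Fin N × ℤ)) (x y : Fin N × ℤ),
      pdList (x :: y :: l) (Fn.coord μ) = 0 := by
    intro l x y
    rw [pdList_cons, pdList_cons, Fn.pd_coord]
    split_ifs <;> simp [Fn.pd_one]
  by_cases hn : n = 0
  · subst hn
    have h := HasOpSum.single (A := taylorTerm (Fn.coord μ) 0) [] (fun l hl => by
      rcases l with _ | ⟨x, _ | ⟨y, l⟩⟩
      · exact absurd rfl hl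
      · exact taylorTerm_of_not_index (by simp [TaylorIndex])
      · by_cases hi : TaylorIndex 0 (x :: y :: l)
        · rw [taylorTerm_of_index hi, hlong, mulFn_zero]
          simp
        · exact taylorTerm_of_not_index hi)
    rw [(hasOpSum_fn _ _).unique h, taylorTerm_of_index (by simp [TaylorIndex])]
    simp only [List.length_nil, Nat.factorial_zero, Nat.cast_one, div_one, one_smul, pdList,
      List.map_nil, List.prod_nil, Module.End.one_apply, qList, mul_one]
    rfl
  · have h := HasOpSum.single (A := taylorTerm (Fn.coord μ) n) [(μ, n)] (fun l hl => by
      by_cases hi : TaylorIndex n l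
      · rw [taylorTerm_of_index hi]
        rcases l with _ | ⟨x, _ | ⟨y, l⟩⟩
        · exact absurd hi.2.symm hn
        · have h2 : x.2 = n := by simpa using hi.2
          have h1 : x.1 ≠ μ := fun h1 => hl (by rw [← h1, ← h2])
          rw [pdList_cons, Fn.pd_coord, if_neg h1, map_zero, mulFn_zero]
          simp
        · rw [hlong, mulFn_zero]
          simp
      · exact taylorTerm_of_not_index hi)
    rw [(hasOpSum_fn _ _).unique h, taylorTerm_of_index (by simp [TaylorIndex, hn]), pdList_cons,
      Fn.pd_coord, if_pos rfl]
    simp [pdList, qList, mulFn_one]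

lemma fn_one (n : ℤ) : fn (1 : Fn N) n = if n = 0 then 1 else 0 := by
  have h := HasOpSum.single (A := taylorTerm (1 : Fn N) n) [] (fun l hl => by
    rcases l with _ | ⟨x, l⟩
    · exact absurd rfl hl
    · by_cases hi : TaylorIndex n (x :: l)
      · rw [taylorTerm_of_index hi, pdList_cons, Fn.pd_one, map_zero, mulFn_zero]
        simp
      · exact taylorTerm_of_not_index hi)
  rw [(hasOpSum_fn _ _).unique h]
  split_ifs with hn
  · rw [taylorTerm_of_index (by simp [TaylorIndex, hn])]
    simp [pdList, qList, mulFn_one]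
  · exact taylorTerm_of_not_index (by simp [TaylorIndex, Ne.symm hn])

lemma fn_add (φ ψ : Fn N) : fn (φ + ψ) = fn φ + fn ψ := by
  funext n
  refine (hasOpSum_fn _ n).unique (((hasOpSum_fn φ n).add (hasOpSum_fn ψ n)).congr fun l => ?_)
  by_cases hi : TaylorIndex n l
  · simp only [taylorTerm_of_index hi, map_add, mulFn_add, add_mul, smul_add]
  · simp [taylorTerm_of_not_index hi]

lemma fn_smul (c : ℂ) (φ : Fn N) : fn (c • φ) = c • fn φ := by
  funext n
  refine (hasOpSum_fn _ n).unique (((hasOpSum_fn φ n).smul c).congr fun l => ?_)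
  by_cases hi : TaylorIndex n l
  · simp only [taylorTerm_of_index hi, map_smul, mulFn_smul, smul_mul_assoc, smul_comm c]
  · simp [taylorTerm_of_not_index hi]

/-- The map `φ ↦ φ(q(t))`. -/
def fnLinear : Fn N →ₗ[ℂ] OpField (Fock N) where
  toFun := fn
  map_add' := fn_add
  map_smul' := fn_smul

lemma fcomm_fn (φ ψ : Fn N) : OpField.FComm (fn φ) (fn ψ) := fn_commute_fn φ ψ

lemma ann_qField (μ : Fin N) : OpField.Ann (qField μ) := fn_coord μ ▸ ann_fn _

lemma fcomm_qField_fn (μ : Fin N) (φ : Fn N) : OpField.FComm (qField μ) (fn φ) :=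
  fn_coord μ ▸ fcomm_fn _ φ

/-- The chain rule for functions of `q(t)`. -/
lemma fn_dot (φ : Fn N) :
    (fn φ).dot = ∑ μ, OpField.mul (qField μ).dot (fn (Fn.pd μ φ)) := by
  funext n
  rw [Finset.sum_apply]
  -- F x l is the contribution of a differentiated mode x and remaining modes l. Both sides are
  -- evaluations of its sum: over l at fixed x it gives products of q̇ with derivatives of φ, and by
  -- list removal it gives i times the sum of the frequencies of a Taylor term.
  set F : Fin N × ℤ → List (Fin N × ℤ) → Module.End ℂ (Fock N) := fun x l =>
    (Complex.I * x.2) • (qField x.1 x.2 * taylorTerm (Fn.pd x.1 φ) (n - x.2) l) with hF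
  -- If F x l is non-zero on w, so is the Taylor term at x :: l, and (x, l) is determined by this
  -- list. Modes x of frequency zero drop out by their factor x.2.
  have hl : LocFin fun x : (Fin N × ℤ) × List (Fin N × ℤ) => F x.1 x.2 := fun w => by
    refine ((locFin_taylorTerm φ n w).preimage
      (f := fun x : (Fin N × ℤ) × List (Fin N × ℤ) => x.1 :: x.2) ?_).subset ?_
    · rintro ⟨x, l⟩ _ ⟨y, l'⟩ _ h
      simpa using h
    · rintro ⟨x, l⟩ hx h0
      refine hx ?_
      by_cases hx2 : x.2 = 0
      · simp [hF, hx2]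
      · change taylorTerm φ n (x :: l) w = 0 at h0
        rw [taylorTerm_cons φ n hx2, LinearMap.smul_apply, smul_eq_zero] at h0
        rcases h0 with h0 | h0
        · exact absurd h0 (one_div_ne_zero (Nat.cast_ne_zero.2 (Nat.succ_ne_zero _)))
        · simp only [hF, LinearMap.smul_apply, h0, smul_zero]
  have h1 := hl.hasOpSum
  have h2 : HasOpSum (fun x : Fin N × ℤ =>
      (qField x.1).dot x.2 * fn (Fn.pd x.1 φ) (n - x.2)) _ :=
    h1.prod_fst fun x => (((hasOpSum_fn (Fn.pd x.1 φ) (n - x.2)).mul_left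
      (qField x.1 x.2)).smul (Complex.I * x.2)).congr fun l => rfl
  have h3 := HasOpSum.fintype_prod fun μ : Fin N => OpField.hasOpSum_mul (ann_qField μ).dot
    (ann_fn (Fn.pd μ φ)) (fcomm_qField_fn μ _).dot_left n
  rw [h3.unique h2]
  refine ((hasOpSum_fn φ n).smul (Complex.I * n)).unique (h1.list_removal.congr fun l => ?_)
  by_cases hi : TaylorIndex n l
  · have hterm : ∀ i : Fin l.length, (1 / (l.length : ℂ)) • F (l.get i) (l.eraseIdx i) =
        (Complex.I * (l.get i).2) • taylorTerm φ n l := by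
      intro i
      have hperm : (l.get i :: l.eraseIdx i).Perm l := List.getElem_cons_eraseIdx_perm i.2
      have hlen : l.length = (l.eraseIdx i).length + 1 := by
        rw [List.length_eraseIdx_of_lt i.2]
        have := i.2
        omega
      rw [← taylorTerm_perm φ n hperm, taylorTerm_cons φ n (hi.1 _ (l.get_mem i)), smul_comm,
        ← hlen]
    rw [Finset.sum_congr rfl fun i _ => hterm i, ← Finset.sum_smul, ← Finset.mul_sum]
    -- The frequencies of an admissible list add up to n.
    congr 2
    rw [← hi.2]
    have : (l.map Prod.snd).sum = ∑ i : Fin l.length, (l.get i).2 := by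
      conv_lhs => rw [← List.ofFn_get l, List.map_ofFn, List.sum_ofFn]
      rfl
    rw [this]
    push_cast
    rfl
  · rw [taylorTerm_of_not_index hi, smul_zero]
    refine Finset.sum_eq_zero fun i _ => ?_
    have hperm : (l.get i :: l.eraseIdx i).Perm l := List.getElem_cons_eraseIdx_perm i.2
    rw [← TaylorIndex.perm hperm, taylorIndex_cons, not_and_or, not_not] at hi
    rcases hi with hi | hi
    · simp only [hF, hi]
      simp
    · simp only [hF, taylorTerm_of_not_index hi]
      simp

end Fock

end Taylor

/-! ### Multiplicativity of the expansion -/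

section Multiplicativity

/-- Leibniz' rule for the commutator with A. The frequency shift k can be booked on whichever factor
is acted on, since all splittings of the frequency are summed. -/
lemma OpField.commutator_mul {W : Type*} [AddCommGroup W] [Module ℂ W] {A : Module.End ℂ W}
    {k : ℤ} {B C B' C' : OpField W} (hB : Ann B) (hC : Ann C) (hB' : Ann B') (hC' : Ann C')
    (h : FComm B C) (h₁ : FComm B' C) (h₂ : FComm B C')
    (hAB : ∀ n, A * B n - B n * A = B' (n + k)) (hAC : ∀ n, A * C n - C n * A = C' (n + k))
    (n : ℤ) :
    A * mul B C n - mul B C n * A = mul B' C (n + k) + mul B C' (n + k) := by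
  have e := hasOpSum_mul hB hC h n
  refine ((e.mul_left A).sub (e.mul_right A)).unique
    ((((hasOpSum_mul hB' hC h₁ (n + k)).comp_equiv (Equiv.addRight k)).add
      (hasOpSum_mul hB hC' h₂ (n + k))).congr fun j => ?_)
  simp only [Equiv.coe_addRight, add_sub_add_right_eq_sub]
  rw [← hAB, show n + k - j = n - j + k by ring, ← hAC]
  noncomm_ring

variable {N : ℕ}

namespace Fock

/-- The deviation of `φ ↦ φ(q(t))` from multiplicativity. -/
def mulDefect (φ ψ : Fn N) : OpField (Fock N) := fn (φ * ψ) - OpField.mul (fn φ) (fn ψ)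

lemma ann_mul_fn (φ ψ : Fn N) : OpField.Ann (OpField.mul (fn φ) (fn ψ)) :=
  (ann_fn φ).mul (ann_fn ψ) (fcomm_fn φ ψ)

lemma fcomm_mul_fn {B : OpField (Fock N)} (h : ∀ φ, OpField.FComm B (fn φ)) (φ ψ : Fn N) :
    OpField.FComm B (OpField.mul (fn φ) (fn ψ)) :=
  OpField.FComm.mul_right (ann_fn φ) (ann_fn ψ) (fcomm_fn φ ψ) (h φ) (h ψ)

lemma hasOpSum_mul_fn (φ ψ : Fn N) (n : ℤ) :
    HasOpSum (fun k => fn φ k * fn ψ (n - k)) (OpField.mul (fn φ) (fn ψ) n) :=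
  OpField.hasOpSum_mul (ann_fn φ) (ann_fn ψ) (fcomm_fn φ ψ) n

lemma mul_fn_vac_of_pos (φ ψ : Fn N) {n : ℤ} (hn : 0 < n) :
    OpField.mul (fn φ) (fn ψ) n vac = 0 := by
  refine opSum_apply_eq_zero fun k => ?_
  rw [OpField.mulTerm]
  rcases lt_or_ge k n with hk | hk
  · rw [Module.End.mul_apply, fn_vac_of_pos ψ (by omega), map_zero]
  · rw [(fn_commute_fn φ ψ k (n - k)).eq, Module.End.mul_apply, fn_vac_of_pos φ (by omega),
      map_zero]

lemma mul_fn_zero_vac (φ ψ : Fn N) : OpField.mul (fn φ) (fn ψ) 0 vac = mulFn (φ * ψ) vac := by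
  rw [← (hasOpSum_mul_fn φ ψ 0).2, finsum_eq_single _ 0]
  · rw [Module.End.mul_apply, sub_zero, fn_zero_vac, ← Module.End.mul_apply,
      ← (mulFn_commute_fn ψ φ 0).eq, Module.End.mul_apply, fn_zero_vac, ← Module.End.mul_apply,
      ← mulFn_mul, mul_comm]
  · intro k hk
    change (fn φ k * fn ψ (0 - k)) vac = 0
    rcases lt_or_gt_of_ne hk with hk | hk
    · rw [Module.End.mul_apply, fn_vac_of_pos ψ (by omega), map_zero]
    · rw [(fn_commute_fn φ ψ k (0 - k)).eq, Module.End.mul_apply, fn_vac_of_pos φ (by omega),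
        map_zero]

/-- Both terms of the defect obey the chain rule and Leibniz' rule. As q̇ has no zero mode, this is
a recursion in the frequency. -/
lemma dot_mulDefect (φ ψ : Fn N) : (mulDefect φ ψ).dot = ∑ μ, OpField.mul (qField μ).dot
    (mulDefect (Fn.pd μ φ) ψ + mulDefect φ (Fn.pd μ ψ)) := by
  have h1 : (mulDefect φ ψ).dot = (fn (φ * ψ)).dot - (OpField.mul (fn φ) (fn ψ)).dot := by
    funext n
    exact end_smul_sub _ _ _
  have hq : ∀ μ : Fin N, OpField.Ann (qField μ).dot := fun μ => (ann_qField μ).dot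
  have hqf : ∀ (μ : Fin N) χ, OpField.FComm (qField μ).dot (fn χ) :=
    fun μ χ => (fcomm_qField_fn μ χ).dot_left
  have hqm : ∀ (μ : Fin N) χ χ', OpField.Ann (OpField.mul (fn χ) (fn χ')) ∧
      OpField.FComm (qField μ).dot (OpField.mul (fn χ) (fn χ')) :=
    fun μ χ χ' => ⟨ann_mul_fn _ _, fcomm_mul_fn (hqf μ) χ χ'⟩
  have hqa : ∀ (μ : Fin N) χ, OpField.Ann (OpField.mul (qField μ).dot (fn χ)) :=
    fun μ χ => (hq μ).mul (ann_fn χ) (hqf μ χ)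
  have hqc : ∀ (μ : Fin N) χ χ', OpField.FComm (fn χ) (OpField.mul (qField μ).dot (fn χ')) :=
    fun μ χ χ' => OpField.FComm.mul_right (hq μ) (ann_fn χ') (hqf μ χ') (hqf μ χ).symm
      (fcomm_fn χ χ')
  rw [h1, OpField.dot_mul (ann_fn φ) (ann_fn ψ) (fcomm_fn φ ψ), fn_dot, fn_dot, fn_dot,
    OpField.sum_mul (ann_fn ψ) (fun μ _ => hqa μ _) (fun μ _ => (hqc μ _ _).symm),
    OpField.mul_sum (ann_fn φ) (fun μ _ => hqa μ _) (fun μ _ => hqc μ _ _),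
    ← Finset.sum_add_distrib, ← Finset.sum_sub_distrib]
  refine Finset.sum_congr rfl fun μ _ => ?_
  have e1 : mulDefect (Fn.pd μ φ) ψ + mulDefect φ (Fn.pd μ ψ) = fn (Fn.pd μ (φ * ψ)) -
      (OpField.mul (fn (Fn.pd μ φ)) (fn ψ) + OpField.mul (fn φ) (fn (Fn.pd μ ψ))) := by
    rw [Fn.pd_mul, fn_add, mulDefect, mulDefect]
    abel
  rw [e1, OpField.mul_sub (hq μ) (ann_fn _) ((ann_mul_fn _ _).add (ann_mul_fn _ _)) (hqf μ _)
      ((hqm μ _ _).2.add_right (hqm μ _ _).2),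
    OpField.mul_add (hq μ) (ann_mul_fn _ _) (ann_mul_fn _ _) (hqm μ _ _).2 (hqm μ _ _).2,
    OpField.mul_assoc (hq μ) (ann_fn _) (ann_fn _) (hqf μ _) (hqf μ _) (fcomm_fn _ _),
    OpField.mul_comm (ann_fn φ) (hqa μ _) (hqc μ _ _),
    OpField.mul_assoc (hq μ) (ann_fn _) (ann_fn _) (hqf μ _) (hqf μ _) (fcomm_fn _ _),
    OpField.mul_comm (ann_fn (Fn.pd μ ψ)) (ann_fn φ) (fcomm_fn _ _)]

/-- For positive n both terms of the defect kill the vacuum, and for n = 0 both act on it as φψ. For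
n = -m < 0 the recursion `dot_mulDefect` determines the defect up to the factor -i m ≠ 0: modes q_j
with j > 0 can be moved onto the vacuum, j = 0 is absent, and j < 0 leaves defects of frequency
above -m, known by induction. -/
lemma mulDefect_vac (φ ψ : Fn N) (n : ℤ) : mulDefect φ ψ n vac = 0 := by
  rcases lt_trichotomy n 0 with hn | hn | hn
  · obtain ⟨m, rfl⟩ : ∃ m : ℕ, n = -m := ⟨n.natAbs, by omega⟩
    induction m using Nat.strong_induction_on generalizing φ ψ with
    | _ m ih =>
      have hall : ∀ (φ ψ : Fn N) (j : ℤ), -m < j → mulDefect φ ψ j vac = 0 := by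
        intro φ ψ j hj
        rcases lt_trichotomy j 0 with h | h | h
        · obtain ⟨i, rfl⟩ : ∃ i : ℕ, j = -i := ⟨j.natAbs, by omega⟩
          exact ih i (by omega) φ ψ h
        · subst h
          rw [mulDefect, Pi.sub_apply, LinearMap.sub_apply, mul_fn_zero_vac, fn_zero_vac, sub_self]
        · rw [mulDefect, Pi.sub_apply, LinearMap.sub_apply, mul_fn_vac_of_pos _ _ h,
            fn_vac_of_pos _ h, sub_self]
      have h := LinearMap.congr_fun (congrFun (dot_mulDefect φ ψ) (-m)) vac
      have hz : (∑ μ, OpField.mul (qField μ).dot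
          (mulDefect (Fn.pd μ φ) ψ + mulDefect φ (Fn.pd μ ψ)) : OpField (Fock N)) (-m) vac = 0 := by
        rw [Finset.sum_apply, LinearMap.sum_apply]
        refine Finset.sum_eq_zero fun μ _ => ?_
        refine opSum_apply_eq_zero fun j => ?_
        have hD : ∀ φ ψ : Fn N, Commute (qField μ j) (mulDefect φ ψ (-m - j)) := fun φ ψ =>
          (fcomm_qField_fn μ _).sub_right (fcomm_mul_fn (fcomm_qField_fn μ) φ ψ) j _
        change ((Complex.I * j) • qField μ j *
          (mulDefect (Fn.pd μ φ) ψ (-m - j) + mulDefect φ (Fn.pd μ ψ) (-m - j)) :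
            Module.End ℂ (Fock N)) vac = 0
        rcases lt_trichotomy j 0 with hj | hj | hj
        · rw [Module.End.mul_apply, LinearMap.add_apply, hall _ _ _ (by omega),
            hall _ _ _ (by omega), add_zero, map_zero]
        · simp [hj]
        · rw [smul_mul_assoc, ((hD _ _).add_right (hD _ _)).eq, LinearMap.smul_apply,
            Module.End.mul_apply, qField_vac hj, map_zero, smul_zero]
      rw [hz] at h
      have h0 : (Complex.I * ((-m : ℤ) : ℂ)) • mulDefect φ ψ (-m) vac = 0 := h
      rcases smul_eq_zero.1 h0 with h0 | h0
      · exfalso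
        rcases mul_eq_zero.1 h0 with h0 | h0
        · exact Complex.I_ne_zero h0
        · exact hn.ne (Int.cast_eq_zero.1 h0)
      · exact h0
  · subst hn
    rw [mulDefect, Pi.sub_apply, LinearMap.sub_apply, mul_fn_zero_vac, fn_zero_vac, sub_self]
  · rw [mulDefect, Pi.sub_apply, LinearMap.sub_apply, mul_fn_vac_of_pos _ _ hn,
      fn_vac_of_pos _ hn, sub_self]

lemma pField_mulDefect (μ : Fin N) (k : ℤ) (φ ψ : Fn N) (n : ℤ) :
    pField μ k * mulDefect φ ψ n - mulDefect φ ψ n * pField μ k = (1 / (2 * Real.pi) : ℂ) •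
      (mulDefect (Fn.pd μ φ) ψ (n + k) + mulDefect φ (Fn.pd μ ψ) (n + k)) := by
  have h := OpField.commutator_mul (A := pField μ k) (k := k) (ann_fn φ) (ann_fn ψ)
    (B' := (1 / (2 * Real.pi) : ℂ) • fn (Fn.pd μ φ)) (C' := (1 / (2 * Real.pi) : ℂ) • fn (Fn.pd μ ψ))
    ((ann_fn _).smul _) ((ann_fn _).smul _) (fcomm_fn φ ψ) ((fcomm_fn _ _).weight_left _)
    ((fcomm_fn _ _).weight_right _) (pField_fn μ k φ) (pField_fn μ k ψ) n
  rw [OpField.smul_mul (ann_fn _) (ann_fn _) (fcomm_fn _ _),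
    OpField.mul_smul (ann_fn _) (ann_fn _) (fcomm_fn _ _)] at h
  have h2 := pField_fn μ k (φ * ψ) n
  rw [Fn.pd_mul, fn_add] at h2
  simp only [mulDefect, Pi.sub_apply, Pi.add_apply, Pi.smul_apply] at h h2 ⊢
  rw [mul_sub, sub_mul, sub_sub_sub_comm, h, h2, ← smul_add, ← end_smul_sub]
  congr 1
  abel

/-- `φ ↦ φ(q(t))` is multiplicative. -/
lemma fn_mul (φ ψ : Fn N) : fn (φ * ψ) = OpField.mul (fn φ) (fn ψ) := by
  -- All defects form one family, closed under commutation with modes of p by `pField_mulDefect`, as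
  -- `eq_zero_of_vac` requires.
  suffices h : ∀ x : Fn N × Fn N × ℤ, mulDefect x.1 x.2.1 x.2.2 = 0 by
    funext n
    exact sub_eq_zero.1 (h (φ, ψ, n))
  refine eq_zero_of_vac _ (fun x => mulDefect_vac _ _ _) (fun x χ => ?_) (fun x μ n => ?_)
    (fun x μ n w hw => ?_)
  · refine (mulFn_commute_fn χ _ _).sub_right ?_
    exact (hasOpSum_mul_fn _ _ _).commute fun k =>
      (mulFn_commute_fn χ _ _).mul_right (mulFn_commute_fn χ _ _)
  · exact (fcomm_qField_fn μ _).sub_right (fcomm_mul_fn (fcomm_qField_fn μ) _ _) n _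
  · have h := fun (φ ψ : Fn N) n => hw (φ, ψ, n)
    simp only at h
    rw [pField_mulDefect, LinearMap.smul_apply, LinearMap.add_apply, h, h]
    simp

end Fock

end Multiplicativity

/-! ### Commutators of two normally ordered terms -/

section NormalOrderedPairs

lemma end_neg_one_smul {W : Type*} [AddCommGroup W] [Module ℂ W] (A : Module.End ℂ W) :
    (-1 : ℂ) • A = -A := neg_one_smul ℂ A

lemma end_mul_neg {W : Type*} [AddCommGroup W] [Module ℂ W] (A B : Module.End ℂ W) :
    A * -B = -(A * B) := mul_neg A B

lemma end_neg_mul {W : Type*} [AddCommGroup W] [Module ℂ W] (A B : Module.End ℂ W) :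
    -A * B = -(A * B) := neg_mul A B

lemma end_eq_of_sub_add {W : Type*} [AddCommGroup W] [Module ℂ W] {A B C D : Module.End ℂ W}
    (h : A - B + C = D) : A = B - C + D := by
  rw [← h]
  abel

variable {R : Type*} [Ring R] {P Q x y u v : R}

/-- Here and in the next three lemmas P and Q stand for derivations, x and y for multiplication
operators, u = [Q, x] and v = [P, y]. With equal ordering prescriptions the commutator is normally
ordered already; with opposite ones, restoring the order costs a contraction, minus or plus u v. -/
lemma commutator_right_right (hP : P * Q = Q * P) (h1 : x * y = y * x)
    (hu : Q * x = x * Q + u) (hv : P * y = y * P + v) :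
    (x * P) * (y * Q) - (y * Q) * (x * P) - (x * v) * Q + (y * u) * P = 0 := by
  linear_combination (norm := noncomm_ring) x * hv * Q - y * hu * P + h1 * (P * Q) + y * x * hP

lemma commutator_left_left (hP : P * Q = Q * P) (h1 : x * y = y * x)
    (hu : Q * x = x * Q + u) (hv : P * y = y * P + v) (h2 : u * y = y * u) (h3 : x * v = v * x) :
    (P * x) * (Q * y) - (Q * y) * (P * x) - Q * (x * v) + P * (y * u) = 0 := by
  linear_combination (norm := noncomm_ring)
    -P * hu * y + Q * hv * x + hP * (x * y) + Q * P * h1 - P * h2 - Q * h3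

lemma commutator_right_left (hP : P * Q = Q * P) (h1 : x * y = y * x)
    (hu : Q * x = x * Q + u) (hv : P * y = y * P + v) (h2 : u * y = y * u) :
    (x * P) * (Q * y) - (Q * y) * (x * P) - Q * (x * v) + (y * u) * P = -(u * v) := by
  linear_combination (norm := noncomm_ring)
    x * hP * y - hu * (P * y) + Q * x * hv - u * hv + Q * h1 * P - h2 * P

lemma commutator_left_right (hP : P * Q = Q * P) (h1 : x * y = y * x)
    (hu : Q * x = x * Q + u) (hv : P * y = y * P + v) (h3 : x * v = v * x) (h4 : u * v = v * u) :
    (P * x) * (y * Q) - (y * Q) * (P * x) - (x * v) * Q + P * (y * u) = u * v := by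
  linear_combination (norm := noncomm_ring)
    y * hP * x - y * P * hu + hv * (x * Q) + hv * u + P * h1 * Q - h3 * Q - h4

end NormalOrderedPairs

/-! ### Normally ordered flows -/

section NormalOrdering

variable {N : ℕ}

lemma locFin_pairs {W : Type*} [AddCommGroup W] [Module ℂ W] {κ κ' α β : Type*} [Finite κ]
    [Finite κ'] {F : (κ × α) × (κ' × β) → Module.End ℂ W}
    (h : ∀ i j, LocFin fun x : α × β => F ((i, x.1), (j, x.2))) : LocFin F := fun w => by
  refine (Set.finite_iUnion fun i => Set.finite_iUnion fun j => ((h i j w).image fun x =>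
    ((i, x.1), (j, x.2)))).subset ?_
  rintro ⟨⟨i, a⟩, ⟨j, b⟩⟩ hx
  exact Set.mem_iUnion.2 ⟨i, Set.mem_iUnion.2 ⟨j, (a, b), hx, rfl⟩⟩

namespace Fock

lemma ann_pField (μ : Fin N) : OpField.Ann (pField μ) := by
  intro w
  induction w using Fock.induction with
  | hvac => exact ⟨0, fun n hn => pField_vac hn⟩
  | hadd v w hv hw =>
    obtain ⟨a, ha⟩ := hv
    obtain ⟨b, hb⟩ := hw
    exact ⟨max a b, fun n hn => by
      rw [map_add, ha n (le_of_max_le_left hn), hb n (le_of_max_le_right hn), add_zero]⟩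
  | hfn ψ w hw =>
    obtain ⟨a, ha⟩ := hw
    refine ⟨max a 1, fun n hn => ?_⟩
    have h1 := le_of_max_le_right hn
    rw [← Module.End.mul_apply, pField_mul_mulFn, if_neg (by omega), add_zero,
      Module.End.mul_apply, ha n (le_of_max_le_left hn), map_zero]
  | hq ν k w _ hw =>
    obtain ⟨a, ha⟩ := hw
    refine ⟨max a (1 - k), fun n hn => ?_⟩
    have h1 := le_of_max_le_right hn
    rw [← Module.End.mul_apply, pField_mul_qField, if_neg (by omega), add_zero,
      Module.End.mul_apply, ha n (le_of_max_le_left hn), map_zero]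
  | hp ν k w _ hw =>
    obtain ⟨a, ha⟩ := hw
    refine ⟨a, fun n hn => ?_⟩
    rw [← Module.End.mul_apply, (pField_commute μ ν n k).eq, Module.End.mul_apply, ha n hn,
      map_zero]

/-- The derivation `2π p_{μ,k}`, dual to the mode `q^μ_{-k}`. -/
def der (a : Fin N × ℤ) : Module.End ℂ (Fock N) := (2 * Real.pi : ℂ) • pField a.1 a.2

lemma der_commute (a b : Fin N × ℤ) : Commute (der a) (der b) :=
  ((pField_commute _ _ _ _).smul_left _).smul_right _

/-- The normal ordered product of `X` with a derivation. -/
def nord (a : Fin N × ℤ) (X : Module.End ℂ (Fock N)) : Module.End ℂ (Fock N) :=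
  if a.2 < 0 then der a * X else X * der a

/-- The terms of `∫ :B^μ(t) p_μ(t): dt`. -/
def flowTerm (B : Fin N → OpField (Fock N)) (a : Fin N × ℤ) : Module.End ℂ (Fock N) :=
  nord a (B a.1 (-a.2))

/-- The operator `∫ :B^μ(t) p_μ(t): dt`. -/
def flow (B : Fin N → OpField (Fock N)) : Module.End ℂ (Fock N) := opSum (flowTerm B)

lemma finite_der_nonneg (ν : Fin N) (w : Fock N) : {j : ℤ | 0 ≤ j ∧ der (ν, j) w ≠ 0}.Finite := by
  obtain ⟨a, ha⟩ := ann_pField ν w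
  refine (Set.finite_Ico 0 a).subset fun j hj => ⟨hj.1, ?_⟩
  by_contra! hc
  exact hj.2 (by simp [der, ha j hc])

/-- Normal ordering is what makes this finite: for k < 0 the field acts first and bounds n - k, for
k ≥ 0 the momentum acts first and bounds k. -/
lemma locFin_normalTerm {B : OpField (Fock N)} (hB : OpField.Ann B) (μ : Fin N) (n : ℤ) :
    LocFin (normalTerm B μ n) := fun w => by
  obtain ⟨a, ha⟩ := ann_pField μ w
  obtain ⟨b, hb⟩ := hB w
  refine (Set.finite_Ioo (min (-1) (n - b)) (max 0 a)).subset fun k hk => ?_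
  simp only [Set.mem_ofPred_eq, normalTerm] at hk
  simp only [Set.mem_Ioo, min_lt_iff, lt_max_iff]
  by_cases hk0 : k < 0
  · rw [if_pos hk0] at hk
    refine ⟨Or.inr ?_, Or.inl hk0⟩
    by_contra! hc
    exact hk (by rw [Module.End.mul_apply, hb _ (by omega), map_zero])
  · rw [if_neg hk0] at hk
    refine ⟨Or.inl (by omega), Or.inr ?_⟩
    by_contra! hc
    exact hk (by rw [Module.End.mul_apply, ha _ hc, map_zero])

lemma hasOpSum_flow_normal {B : Fin N → OpField (Fock N)} (hB : ∀ μ, OpField.Ann (B μ)) :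
    HasOpSum (flowTerm B) (∑ μ, (normal (B μ) μ).integral) := by
  refine (HasOpSum.fintype_prod fun μ => ((locFin_normalTerm (hB μ) μ 0).hasOpSum.smul
    (2 * (Real.pi : ℂ)))).congr fun a => ?_
  simp only [normalTerm, flowTerm, nord, der, zero_sub]
  split_ifs
  · rw [smul_mul_assoc]
  · rw [mul_smul_comm]

lemma hasOpSum_flow {B : Fin N → OpField (Fock N)} (hB : ∀ μ, OpField.Ann (B μ)) :
    HasOpSum (flowTerm B) (flow B) := (hasOpSum_flow_normal hB).locFin.hasOpSum

lemma flow_eq {B : Fin N → OpField (Fock N)} (hB : ∀ μ, OpField.Ann (B μ)) :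
    flow B = ∑ μ, (normal (B μ) μ).integral := (hasOpSum_flow_normal hB).opSum_eq

lemma nord_add (a : Fin N × ℤ) (X Y : Module.End ℂ (Fock N)) :
    nord a (X + Y) = nord a X + nord a Y := by
  unfold nord
  split_ifs
  · rw [mul_add]
  · rw [add_mul]

lemma nord_smul (a : Fin N × ℤ) (c : ℂ) (X : Module.End ℂ (Fock N)) :
    nord a (c • X) = c • nord a X := by
  unfold nord
  split_ifs
  · rw [mul_smul_comm]
  · rw [smul_mul_assoc]

lemma flow_add {B C : Fin N → OpField (Fock N)} (hB : ∀ μ, OpField.Ann (B μ))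
    (hC : ∀ μ, OpField.Ann (C μ)) : flow (B + C) = flow B + flow C :=
  (((hasOpSum_flow hB).add (hasOpSum_flow hC)).congr fun a =>
    (nord_add a (B a.1 (-a.2)) (C a.1 (-a.2))).symm).opSum_eq

lemma flow_smul {B : Fin N → OpField (Fock N)} (hB : ∀ μ, OpField.Ann (B μ)) (c : ℂ) :
    flow (c • B) = c • flow B :=
  (((hasOpSum_flow hB).smul c).congr fun a => (nord_smul a c (B a.1 (-a.2))).symm).opSum_eq

lemma flow_sub {B C : Fin N → OpField (Fock N)} (hB : ∀ μ, OpField.Ann (B μ))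
    (hC : ∀ μ, OpField.Ann (C μ)) : flow (B - C) = flow B - flow C := by
  refine (((hasOpSum_flow hB).sub (hasOpSum_flow hC)).congr fun a => ?_).opSum_eq
  unfold flowTerm nord
  split_ifs
  · exact (mul_sub _ _ _).symm
  · exact (sub_mul _ _ _).symm

/-- The commutators of the fields `B^μ` with the modes of `p(t)` are
`[2π p_{ν,j}, B^μ_n] = v(j) (Y_ν^μ)_{n+j}`. -/
structure HasDer (B : Fin N → OpField (Fock N)) (v : ℤ → ℂ)
    (Y : Fin N → Fin N → OpField (Fock N)) : Prop where
  ann : ∀ μ, OpField.Ann (B μ)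
  ann_der : ∀ ν μ, OpField.Ann (Y ν μ)
  bracket : ∀ ν j μ n, der (ν, j) * B μ n = B μ n * der (ν, j) + v j • Y ν μ (n + j)

/-- The action of the flow of `B` on fields with derivatives `v`, `Y`. -/
def act (B : Fin N → OpField (Fock N)) (v : ℤ → ℂ) (Y : Fin N → Fin N → OpField (Fock N)) :
    Fin N → OpField (Fock N) :=
  fun ν => ∑ μ, OpField.mul (OpField.weight (fun m => v (-m)) (B μ)) (Y μ ν)

lemma hasOpSum_act_term {B : Fin N → OpField (Fock N)} {v : ℤ → ℂ}
    {Y : Fin N → Fin N → OpField (Fock N)} (hB : ∀ μ, OpField.Ann (B μ))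
    (hY : ∀ μ ν, OpField.Ann (Y μ ν)) (h : ∀ μ μ' ν, OpField.FComm (B μ) (Y μ' ν))
    (μ ν : Fin N) (n : ℤ) :
    HasOpSum (fun k : ℤ => B μ (-k) * (v k • Y μ ν (n + k)))
      (OpField.mul (OpField.weight (fun m => v (-m)) (B μ)) (Y μ ν) n) := by
  refine ((OpField.hasOpSum_mul ((hB μ).weight _) (hY μ ν)
    ((h μ μ ν).weight_left fun m => v (-m)) n).comp_equiv (Equiv.neg ℤ)).congr fun k => ?_
  simp only [Equiv.neg_apply, OpField.weight, neg_neg, sub_neg_eq_add, smul_mul_assoc,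
    mul_smul_comm]

lemma hasOpSum_act {B : Fin N → OpField (Fock N)} {v : ℤ → ℂ}
    {Y : Fin N → Fin N → OpField (Fock N)} (hB : ∀ μ, OpField.Ann (B μ))
    (hY : ∀ μ ν, OpField.Ann (Y μ ν)) (h : ∀ μ μ' ν, OpField.FComm (B μ) (Y μ' ν))
    (ν : Fin N) (n : ℤ) :
    HasOpSum (fun a : Fin N × ℤ => B a.1 (-a.2) * (v a.2 • Y a.1 ν (n + a.2)))
      (act B v Y ν n) := by
  rw [act, Finset.sum_apply]
  exact HasOpSum.fintype_prod fun μ => hasOpSum_act_term hB hY h μ ν n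

/-- The flow of the transformed fields, expanded over pairs of modes; in this shape it is comparable
with a product of two flows. -/
lemma hasOpSum_nord_act {B : Fin N → OpField (Fock N)} {v : ℤ → ℂ}
    {Y : Fin N → Fin N → OpField (Fock N)} (hB : ∀ μ, OpField.Ann (B μ))
    (hY : ∀ μ ν, OpField.Ann (Y μ ν)) (h : ∀ μ μ' ν, OpField.FComm (B μ) (Y μ' ν)) :
    HasOpSum (fun x : (Fin N × ℤ) × (Fin N × ℤ) => nord x.2
      (B x.1.1 (-x.1.2) * (v x.1.2 • Y x.1.1 x.2.1 (-x.2.2 + x.1.2)))) (flow (act B v Y)) := by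
  have hl : LocFin (fun x : (Fin N × ℤ) × (Fin N × ℤ) => nord x.2
      (B x.1.1 (-x.1.2) * (v x.1.2 • Y x.1.1 x.2.1 (-x.2.2 + x.1.2)))) := by
    refine locFin_pairs fun μ ν w => ?_
    obtain ⟨b, hb⟩ := hB μ w
    obtain ⟨y, hy⟩ := hY μ ν w
    -- For j < 0 the fields act first, which bounds k and then j. For j ≥ 0 the derivation acts
    -- first; it is non-zero on w for finitely many j, each leaving finitely many k.
    refine (((Set.finite_Ioo (-b) y).prod (Set.finite_Ioo (-b - y) 0)).union
      ((finite_der_nonneg ν w).biUnion fun j _ =>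
        ((hasOpSum_act_term (v := v) hB hY h μ ν (-j)).1 (der (ν, j) w)).image fun k =>
          (k, j))).subset ?_
    rintro ⟨k, j⟩ hkj
    simp only [Set.mem_ofPred_eq, nord] at hkj
    by_cases hj : j < 0
    · left
      rw [if_pos hj, Module.End.mul_apply] at hkj
      have h1 : -k < b := by
        by_contra! hc
        refine hkj ?_
        rw [((h μ μ ν _ _).smul_right _).eq, Module.End.mul_apply, hb _ hc, map_zero, map_zero]
      have h2 : -j + k < y := by
        by_contra! hc
        refine hkj ?_
        rw [Module.End.mul_apply, LinearMap.smul_apply, hy _ hc, smul_zero, map_zero, map_zero]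
      simp only [Set.mem_prod, Set.mem_Ioo]
      omega
    · right
      rw [if_neg hj, Module.End.mul_apply] at hkj
      refine Set.mem_iUnion₂.2 ⟨j, ⟨by omega, fun h0 => hkj (by rw [h0, map_zero])⟩, k, hkj, rfl⟩
  have h1 : HasOpSum (flowTerm (act B v Y)) _ := hl.hasOpSum.prod_snd fun b => by
    have e := hasOpSum_act (v := v) hB hY h b.1 (-b.2)
    unfold flowTerm nord
    split_ifs
    · exact e.mul_left (der b)
    · exact e.mul_right (der b)
  rw [flow, h1.opSum_eq]
  exact hl.hasOpSum

/-- The sign of the contraction of a pair of modes. -/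
def contractionSign (k j : ℤ) : ℂ :=
  if 0 ≤ k ∧ j < 0 then -1 else if k < 0 ∧ 0 ≤ j then 1 else 0

/-- The four combinations of orderings; the sign is non-zero exactly when one derivation stands on
the left and the other on the right. -/
lemma nord_commutator (a b : Fin N × ℤ) {x y u v : Module.End ℂ (Fock N)} (hxy : Commute x y)
    (hu : der b * x = x * der b + u) (hv : der a * y = y * der a + v) (huy : Commute u y)
    (hxv : Commute x v) (huv : Commute u v) :
    contractionSign a.2 b.2 • (u * v) = nord a x * nord b y - nord b y * nord a x -
      nord b (x * v) + nord a (y * u) := by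
  have hP := (der_commute a b).eq
  unfold nord contractionSign
  by_cases ha : a.2 < 0 <;> by_cases hb : b.2 < 0
  · rw [if_neg (by omega), if_neg (by omega), if_pos ha, if_pos hb, if_pos ha, if_pos hb, zero_smul,
      commutator_left_left hP hxy hu hv huy hxv]
  · rw [if_neg (by omega), if_pos (by omega), if_pos ha, if_neg hb, if_pos ha, if_neg hb, one_smul,
      commutator_left_right hP hxy hu hv hxv huv]
  · rw [if_pos (by omega), if_neg ha, if_pos hb, if_neg ha, if_pos hb, end_neg_one_smul,
      commutator_right_left hP hxy hu hv huy]
  · rw [if_neg (by omega), if_neg (by omega), if_neg ha, if_neg hb, if_neg ha, if_neg hb, zero_smul,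
      commutator_right_right hP hxy hu hv]

/-- The commutator of two flows is the flow of the commutator up to the sum of the contractions of
all pairs of modes. -/
lemma flow_commutator {B C : Fin N → OpField (Fock N)} {v v' : ℤ → ℂ}
    {Y Y' : Fin N → Fin N → OpField (Fock N)} (hB : HasDer B v Y) (hC : HasDer C v' Y')
    (hBC : ∀ μ ν, OpField.FComm (B μ) (C ν)) (hYC : ∀ ν μ ν', OpField.FComm (Y ν μ) (C ν'))
    (hBY : ∀ μ μ' ν, OpField.FComm (B μ) (Y' μ' ν))
    (hYY : ∀ μ ν μ' ν', OpField.FComm (Y μ ν) (Y' μ' ν')) :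
    HasOpSum (fun x : (Fin N × ℤ) × (Fin N × ℤ) => contractionSign x.1.2 x.2.2 •
        ((v x.2.2 • Y x.2.1 x.1.1 (-x.1.2 + x.2.2)) *
          (v' x.1.2 • Y' x.1.1 x.2.1 (-x.2.2 + x.1.2))))
      (flow B * flow C - flow C * flow B - flow (act B v' Y') + flow (act C v Y)) := by
  -- All four operators become sums over the same pairs of modes, so `nord_commutator` applies term
  -- by term. The contractions are thereby locally finite, as a combination of locally finite
  -- families.
  have h1 := (hasOpSum_flow hB.ann).mul (hasOpSum_flow hC.ann)
  have h2 := ((hasOpSum_flow hC.ann).mul (hasOpSum_flow hB.ann)).swap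
  have h3 := hasOpSum_nord_act (v := v') hB.ann hC.ann_der hBY
  have h4 := (hasOpSum_nord_act (v := v) hC.ann hB.ann_der fun μ μ' ν => (hYC μ' ν μ).symm).swap
  refine (((h1.sub h2).sub h3).add h4).congr fun x => ?_
  exact (nord_commutator x.1 x.2 (hBC _ _ _ _) (hB.bracket _ _ _ _) (hC.bracket _ _ _ _)
    ((hYC _ _ _ _ _).smul_left _) ((hBY _ _ _ _ _).smul_right _)
    (((hYY _ _ _ _ _ _).smul_left _).smul_right _)).symm

/-- The commutator of a flow with a field. -/
lemma flow_field_commutator {B C : Fin N → OpField (Fock N)} {v' : ℤ → ℂ}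
    {Y' : Fin N → Fin N → OpField (Fock N)} (hB : ∀ μ, OpField.Ann (B μ)) (hC : HasDer C v' Y')
    (hBC : ∀ μ ν, OpField.FComm (B μ) (C ν)) (hBY : ∀ μ μ' ν, OpField.FComm (B μ) (Y' μ' ν))
    (ν : Fin N) (n : ℤ) :
    flow B * C ν n - C ν n * flow B = act B v' Y' ν n := by
  have h := hasOpSum_flow hB
  refine ((h.mul_right (C ν n)).sub (h.mul_left (C ν n))).unique
    ((hasOpSum_act hB hC.ann_der hBY ν n).congr fun a => ?_)
  have e := hC.bracket a.1 a.2 ν n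
  have c := (hBC a.1 ν (-a.2) n).eq
  have c' := ((hBY a.1 a.1 ν (-a.2) (n + a.2)).smul_right (v' a.2)).eq
  unfold flowTerm nord
  split_ifs
  · rw [mul_assoc, c, ← mul_assoc, e, add_mul, ← c', mul_assoc, add_sub_cancel_left]
  · rw [mul_assoc, e, mul_add, ← mul_assoc, ← mul_assoc, c, add_sub_cancel_left]

end Fock

end NormalOrdering

/-! ### Sums of contractions -/

section Contractions

/-- The sum of `F` from `0` to `l - 1`, extended to negative `l`. -/
def signedSum (F : ℤ → ℂ) (l : ℤ) : ℂ := ∑ j ∈ Finset.Ico 0 l, F j - ∑ j ∈ Finset.Ico l 0, F j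

lemma signedSum_succ (F : ℤ → ℂ) (l : ℤ) : signedSum F (l + 1) = signedSum F l + F l := by
  unfold signedSum
  rcases lt_or_ge l 0 with hl | hl
  · rw [Finset.Ico_eq_empty (by omega : ¬(0 : ℤ) < l), Finset.Ico_eq_empty (by omega : ¬(0 : ℤ) < l + 1),
      ← Finset.insert_Ico_succ_left_eq_Ico hl, Finset.sum_insert (by simp)]
    simp
  · rw [Finset.Ico_eq_empty (by omega : ¬l < (0 : ℤ)), Finset.Ico_eq_empty (by omega : ¬l + 1 < (0 : ℤ)),
      ← Finset.insert_Ico_right_eq_Ico_add_one hl, Finset.sum_insert (by simp)]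
    simp [add_comm]

/-- A function on the integers is determined by its increments and its value at 0, for negative
arguments as well. -/
lemma signedSum_eq {F g : ℤ → ℂ} (h0 : g 0 = 0) (h : ∀ l, g (l + 1) = g l + F l) (l : ℤ) :
    signedSum F l = g l := by
  induction l using Int.induction_on with
  | zero => simp [signedSum, h0]
  | succ i ih => rw [signedSum_succ, h, ih]
  | pred i ih =>
    have h1 := signedSum_succ F (-i - 1)
    have h2 := h (-i - 1)
    rw [sub_add_cancel] at h1 h2
    rw [ih, h2] at h1
    exact (add_right_cancel h1).symm

lemma signedSum_add (F G : ℤ → ℂ) (l : ℤ) :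
    signedSum (fun j => F j + G j) l = signedSum F l + signedSum G l := by
  simp only [signedSum, Finset.sum_add_distrib]
  ring

lemma signedSum_mul_left (c : ℂ) (F : ℤ → ℂ) (l : ℤ) :
    signedSum (fun j => c * F j) l = c * signedSum F l := by
  simp only [signedSum, ← Finset.mul_sum]
  ring

lemma signedSum_one (l : ℤ) : signedSum (fun _ => 1) l = l :=
  signedSum_eq (g := fun l => (l : ℂ)) (by simp) (fun l => by push_cast; ring) l

lemma signedSum_id (l : ℤ) : signedSum (fun j => (j : ℂ)) l = l * (l - 1) / 2 :=
  signedSum_eq (g := fun l => (l : ℂ) * (l - 1) / 2) (by simp) (fun l => by push_cast; ring) l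

lemma signedSum_sq (l : ℤ) : signedSum (fun j => (j : ℂ) ^ 2) l = l * (l - 1) * (2 * l - 1) / 6 :=
  signedSum_eq (g := fun l => (l : ℂ) * (l - 1) * (2 * l - 1) / 6) (by simp)
    (fun l => by push_cast; ring) l

namespace Fock

/-- With k = j - l the sign is 1 for 0 ≤ j < l and -1 for l ≤ j < 0, so at a given transfer l
exactly |l| pairs contract. -/
lemma sum_contractionSign (F : ℤ → ℂ) (l : ℤ) :
    ∑ j ∈ Finset.Ico 0 l ∪ Finset.Ico l 0, contractionSign (j - l) j * F j = signedSum F l := by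
  unfold signedSum
  rcases lt_or_ge l 0 with hl | hl
  · rw [Finset.Ico_eq_empty (by omega : ¬(0 : ℤ) < l), Finset.empty_union, Finset.sum_empty, zero_sub,
      ← Finset.sum_neg_distrib]
    refine Finset.sum_congr rfl fun j hj => ?_
    rw [Finset.mem_Ico] at hj
    rw [contractionSign, if_pos (by omega), neg_one_mul]
  · rw [Finset.Ico_eq_empty (by omega : ¬l < (0 : ℤ)), Finset.union_empty, Finset.sum_empty, sub_zero]
    refine Finset.sum_congr rfl fun j hj => ?_
    rw [Finset.mem_Ico] at hj
    rw [contractionSign, if_neg (by omega), if_pos (by omega), one_mul]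

lemma contractionSign_eq_zero {l j : ℤ} (h : j ∉ Finset.Ico 0 l ∪ Finset.Ico l 0) :
    contractionSign (j - l) j = 0 := by
  simp only [Finset.mem_union, Finset.mem_Ico, not_or, not_and_or] at h
  rw [contractionSign, if_neg (by omega), if_neg (by omega)]

/-- The pairs of frequencies `(k, j)` parametrized by `(j - k, j)`. -/
def contractionEquiv : ℤ × ℤ ≃ ℤ × ℤ where
  toFun x := (x.2 - x.1, x.2)
  invFun x := (x.2 - x.1, x.2)
  left_inv x := by simp
  right_inv x := by simp

variable {N : ℕ}

/-- Pairs (k, j) are grouped by l = j - k. The operator part then depends on l only, and the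
coefficients of the finitely many contracting pairs add up to c l, which becomes a weight on the
modes of Y. -/
lemma hasOpSum_contraction_aux {W : Type*} [AddCommGroup W] [Module ℂ W] {Y Y' : OpField W}
    {v v' c : ℤ → ℂ} (hc : ∀ l, signedSum (fun j => v j * v' (j - l)) l = c l)
    (hY : OpField.Ann Y) (hY' : OpField.Ann Y') (h : OpField.FComm Y Y') :
    HasOpSum (fun x : ℤ × ℤ => contractionSign x.1 x.2 •
        ((v x.2 • Y (-x.1 + x.2)) * (v' x.1 • Y' (-x.2 + x.1))))
      (OpField.mul (OpField.weight c Y) Y' 0) := by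
  have hG : LocFin fun l : ℤ => Y l * Y' (0 - l) := (OpField.hasOpSum_mul hY hY' h 0).1
  set F : ℤ × ℤ → Module.End ℂ W := fun x =>
    (contractionSign (x.2 - x.1) x.2 * (v x.2 * v' (x.2 - x.1))) • (Y x.1 * Y' (0 - x.1)) with hF
  have hl : LocFin F := fun w => by
    refine ((hG w).biUnion fun l _ => ((Finset.Ico 0 l ∪ Finset.Ico l 0).finite_toSet.image
      fun j => (l, j))).subset ?_
    rintro ⟨l, j⟩ hx
    refine Set.mem_iUnion₂.2 ⟨l, fun h0 => hx ?_, j, ?_, rfl⟩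
    · simp only [hF, LinearMap.smul_apply, h0, smul_zero]
    · by_contra hj
      refine hx ?_
      simp only [hF, contractionSign_eq_zero hj, zero_mul, zero_smul, LinearMap.zero_apply]
  have h1 : HasOpSum (fun l => OpField.weight c Y l * Y' (0 - l)) (opSum F) :=
    hl.hasOpSum.prod_fst fun l => by
      have e := HasOpSum.of_finset (A := fun j => F (l, j)) (Finset.Ico 0 l ∪ Finset.Ico l 0)
        (fun j hj => by simp only [hF, contractionSign_eq_zero hj, zero_mul, zero_smul])
      simp only [hF] at e
      rw [← Finset.sum_smul, sum_contractionSign, hc] at e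
      simpa only [OpField.weight, smul_mul_assoc] using e
  have h2 : OpField.mul (OpField.weight c Y) Y' 0 = opSum F := h1.opSum_eq
  rw [h2]
  refine (hl.hasOpSum.comp_equiv contractionEquiv).congr fun x => ?_
  simp only [hF, contractionEquiv, Equiv.coe_fn_mk, sub_sub_cancel, smul_mul_assoc, mul_smul_comm,
    smul_smul, zero_sub, neg_sub, neg_add_eq_sub, mul_comm (v' x.1) (v x.2)]

/-- The sum of the contractions of all pairs of modes. -/
lemma hasOpSum_contraction {Y Y' : Fin N → Fin N → OpField (Fock N)}
    {v v' c : ℤ → ℂ} (hc : ∀ l, signedSum (fun j => v j * v' (j - l)) l = c l)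
    (hY : ∀ μ ν, OpField.Ann (Y μ ν)) (hY' : ∀ μ ν, OpField.Ann (Y' μ ν))
    (h : ∀ μ ν μ' ν', OpField.FComm (Y μ ν) (Y' μ' ν')) :
    HasOpSum (fun x : (Fin N × ℤ) × (Fin N × ℤ) => contractionSign x.1.2 x.2.2 •
        ((v x.2.2 • Y x.2.1 x.1.1 (-x.1.2 + x.2.2)) *
          (v' x.1.2 • Y' x.1.1 x.2.1 (-x.2.2 + x.1.2))))
      (∑ μ, ∑ ν, OpField.mul (OpField.weight c (Y ν μ)) (Y' μ ν) 0) := by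
  rw [← Fintype.sum_prod_type' fun μ ν => OpField.mul (OpField.weight c (Y ν μ)) (Y' μ ν) 0]
  have e := HasOpSum.fintype_prod fun i : Fin N × Fin N =>
    hasOpSum_contraction_aux hc (hY i.2 i.1) (hY' i.1 i.2) (h _ _ _ _)
  exact e.comp_equiv (Equiv.prodProdProdComm (Fin N) ℤ (Fin N) ℤ)

end Fock

end Contractions

/-! ### Flows of vector fields and of reparametrizations -/

section Flows

variable {N : ℕ}

namespace OpField

variable {W : Type*} [AddCommGroup W] [Module ℂ W]

lemma weight_one (B : OpField W) : weight (fun _ => 1) B = B := by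
  funext n
  simp [weight]

lemma weight_dot (B : OpField W) : weight (fun m => Complex.I * ((-m : ℤ) : ℂ)) B = -B.dot := by
  funext n
  simp only [weight, dot, Pi.neg_apply]
  push_cast
  rw [_root_.mul_neg, neg_smul]

lemma weight_freq (B : OpField W) : weight (fun m => (m : ℂ)) B = (-Complex.I) • B.dot := by
  funext n
  simp only [weight, dot, Pi.smul_apply, smul_smul, ← _root_.mul_assoc]
  simp

lemma ann_smear {B : OpField W} (h : Ann B) (f : Trig) :
    Ann (smear f B) := by
  rw [smear_eq_mul]
  exact (ann_scalar f).mul h (fcomm_scalar_left f B)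

lemma fcomm_smear {B C : OpField W} (hC : Ann C) (h : FComm B C)
    (f : Trig) : FComm B (smear f C) := by
  rw [smear_eq_mul]
  exact FComm.mul_right (ann_scalar f) hC (fcomm_scalar_left f C)
    (fcomm_scalar_right f B) h

end OpField

namespace Fock

lemma two_pi_mul_inv : (2 * Real.pi : ℂ) * (1 / (2 * Real.pi)) = 1 :=
  mul_one_div_cancel (mul_ne_zero two_ne_zero (Complex.ofReal_ne_zero.2 Real.pi_ne_zero))

lemma der_mul_fn (a : Fin N × ℤ) (φ : Fn N) (n : ℤ) :
    der a * fn φ n = fn φ n * der a + fn (Fn.pd a.1 φ) (n + a.2) := by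
  have h := pField_fn a.1 a.2 φ n
  rw [sub_eq_iff_eq_add] at h
  rw [der, smul_mul_assoc, h, smul_add, smul_smul, two_pi_mul_inv, one_smul, mul_smul_comm,
    add_comm]

lemma hasDer_fn {κ : Type*} (ξ : κ → Fn N) (e : Fin N → κ) : HasDer (fun μ => fn (ξ (e μ)))
    (fun _ => 1) (fun ν μ => fn (Fn.pd ν (ξ (e μ)))) where
  ann _ := ann_fn _
  ann_der _ _ := ann_fn _
  bracket ν j μ n := by rw [der_mul_fn, one_smul]

/-- The fields `-f(t) dq^μ/dt` generating reparametrizations. -/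
def repField (f : Trig) : Fin N → OpField (Fock N) :=
  fun μ => -OpField.smear f (qField μ).dot

lemma ann_repField (f : Trig) (μ : Fin N) : OpField.Ann (repField f μ) :=
  (OpField.ann_smear (ann_qField μ).dot f).neg

lemma fcomm_repField {B : OpField (Fock N)} (h : ∀ μ, OpField.FComm B (qField μ)) (f : Trig)
    (μ : Fin N) : OpField.FComm B (repField f μ) :=
  (OpField.fcomm_smear (ann_qField μ).dot (h μ).dot_right f).neg_right

lemma fcomm_fn_repField (φ : Fn N) (f : Trig) (μ : Fin N) :
    OpField.FComm (fn φ) (repField f μ) :=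
  fcomm_repField (fun μ => (fcomm_qField_fn μ φ).symm) f μ

lemma fcomm_qField (μ ν : Fin N) : OpField.FComm (qField μ) (qField ν) :=
  fun _ _ => qField_commute _ _ _ _

lemma fcomm_repField_repField (f h : Trig) (μ ν : Fin N) :
    OpField.FComm (repField f μ) (repField h ν) :=
  fcomm_repField (fun ν => (fcomm_repField (fun μ => fcomm_qField ν μ) f μ).symm) h ν

/-- The derivatives of `repField`. -/
def repDer (f : Trig) (ν μ : Fin N) : OpField (Fock N) :=
  if ν = μ then OpField.scalar f else 0

lemma ann_repDer (f : Trig) (ν μ : Fin N) : OpField.Ann (repDer f ν μ) := by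
  unfold repDer
  split_ifs
  · exact OpField.ann_scalar f
  · exact OpField.ann_zero

lemma fcomm_repDer (B : OpField (Fock N)) (f : Trig) (ν μ : Fin N) :
    OpField.FComm B (repDer f ν μ) := by
  unfold repDer
  split_ifs
  · exact OpField.fcomm_scalar_right f B
  · exact fun _ _ => Commute.zero_right _

lemma der_mul_qField (a : Fin N × ℤ) (μ : Fin N) (n : ℤ) :
    der a * qField μ n = qField μ n * der a + if a.1 = μ ∧ a.2 + n = 0 then 1 else 0 := by
  rw [der, smul_mul_assoc, pField_mul_qField, smul_add, mul_smul_comm]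
  congr 1
  split_ifs
  · rw [smul_smul, two_pi_mul_inv, one_smul]
  · rw [smul_zero]

/-- The mode j of p contracts with the mode -j of q, which carries the factor -i j in q̇; the sign
in `repField` turns it into i j. In the smeared field this selects the coefficient of f at n + j. -/
lemma hasDer_repField (f : Trig) : HasDer (N := N) (repField f) (fun j => Complex.I * j)
    (repDer f) where
  ann := ann_repField f
  ann_der := ann_repDer f
  bracket ν j μ n := by
    have h := OpField.hasOpSum_smear f (qField μ).dot n
    have h1 := (h.mul_left (der (ν, j))).sub (h.mul_right (der (ν, j)))
    have e : ∀ k, der (ν, j) * ((OpField.scalar f : OpField (Fock N)) k * (qField μ).dot (n - k)) -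
        (OpField.scalar f : OpField (Fock N)) k * (qField μ).dot (n - k) * der (ν, j) =
        if ν = μ ∧ j + (n - k) = 0 then (f.coeff k * (Complex.I * ((n - k : ℤ) : ℂ))) • 1
          else 0 := by
      intro k
      simp only [OpField.scalar, OpField.dot, smul_mul_assoc, one_mul, mul_smul_comm, smul_smul]
      rw [← end_smul_sub, der_mul_qField, add_sub_cancel_left]
      split_ifs
      · rw [mul_comm]
      · rw [smul_zero]
    have h2 := HasOpSum.single (A := fun k : ℤ => if ν = μ ∧ j + (n - k) = 0 then
      (f.coeff k * (Complex.I * ((n - k : ℤ) : ℂ))) • (1 : Module.End ℂ (Fock N)) else 0) (n + j)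
      (fun k hk => if_neg fun hc => hk (by omega))
    have h3 := h1.unique (h2.congr fun k => (e k).symm)
    rw [sub_eq_iff_eq_add] at h3
    simp only [repField, Pi.neg_apply]
    rw [end_mul_neg, end_neg_mul, h3, neg_add, add_comm]
    congr 1
    unfold repDer
    by_cases hν : ν = μ
    · rw [if_pos ⟨hν, by ring⟩, if_pos hν, OpField.scalar, smul_smul, ← end_neg_one_smul, smul_smul]
      congr 1
      push_cast
      ring
    · rw [if_neg (by tauto), if_neg hν]
      simp

lemma act_fn {B : Fin N → OpField (Fock N)} (η : Fin N → Fn N) (ν : Fin N) :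
    act B (fun _ => 1) (fun ν μ => fn (Fn.pd ν (η μ))) ν =
      ∑ μ, OpField.mul (B μ) (fn (Fn.pd μ (η ν))) := by
  simp only [act, OpField.weight_one]

lemma fn_sum {κ : Type*} (s : Finset κ) (φ : κ → Fn N) : fn (∑ i ∈ s, φ i) = ∑ i ∈ s, fn (φ i) :=
  map_sum fnLinear φ s

lemma fn_sub (φ ψ : Fn N) : fn (φ - ψ) = fn φ - fn ψ := map_sub fnLinear φ ψ

lemma act_fn_fn (ξ η : Fin N → Fn N) (ν : Fin N) :
    act (fun μ => fn (ξ μ)) (fun _ => 1) (fun ν μ => fn (Fn.pd ν (η μ))) ν =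
      fn (∑ μ, ξ μ * Fn.pd μ (η ν)) := by
  rw [act_fn, fn_sum]
  simp only [fn_mul]

/-- By the chain rule, differentiation along -f q̇ is -f d/dt. -/
lemma act_repField_fn (f : Trig) (η : Fin N → Fn N) (ν : Fin N) :
    act (repField f) (fun _ => 1) (fun ν μ => fn (Fn.pd ν (η μ))) ν =
      -OpField.smear f (fn (η ν)).dot := by
  have hq : ∀ μ : Fin N, OpField.Ann (qField μ).dot := fun μ => (ann_qField μ).dot
  have hqf : ∀ (μ : Fin N) χ, OpField.FComm (qField μ).dot (fn χ) :=
    fun μ χ => (fcomm_qField_fn μ χ).dot_left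
  rw [act_fn, fn_dot, OpField.smear_eq_mul, OpField.mul_sum (OpField.ann_scalar f)
    (fun μ _ => (hq μ).mul (ann_fn _) (hqf μ _)) (fun μ _ => OpField.fcomm_scalar_left _ _),
    ← Finset.sum_neg_distrib]
  refine Finset.sum_congr rfl fun μ _ => ?_
  rw [repField, OpField.smear_eq_mul, OpField.neg_mul ((OpField.ann_scalar f).mul (hq μ)
    (OpField.fcomm_scalar_left _ _)) (ann_fn _) (OpField.FComm.mul_right (OpField.ann_scalar f)
    (hq μ) (OpField.fcomm_scalar_left _ _) (OpField.fcomm_scalar_right _ _) (hqf μ _).symm).symm,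
    OpField.mul_assoc (OpField.ann_scalar f) (hq μ) (ann_fn _) (OpField.fcomm_scalar_left _ _)
    (OpField.fcomm_scalar_left _ _) (hqf μ _)]

lemma act_rep {B : Fin N → OpField (Fock N)} (hB : ∀ μ, OpField.Ann (B μ)) (f : Trig)
    (ν : Fin N) : act B (fun j => Complex.I * j) (repDer f) ν = -OpField.smear f (B ν).dot := by
  rw [act, Finset.sum_eq_single ν]
  · rw [OpField.weight_dot, repDer, if_pos rfl, OpField.neg_mul (hB ν).dot (OpField.ann_scalar f)
      (OpField.fcomm_scalar_right _ _), OpField.smear_eq_mul,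
      OpField.mul_comm (OpField.ann_scalar f) (hB ν).dot (OpField.fcomm_scalar_left _ _)]
  · intro μ _ hμ
    rw [repDer, if_neg hμ]
    refine OpField.mul_eq_of_hasOpSum fun n => ?_
    simpa using HasOpSum.zero
  · simp

/-- The operator `∫ :ξ^μ(q(t)) p_μ(t): dt`. -/
def vfFlow (ξ : Fin N → Fn N) : Module.End ℂ (Fock N) := flow fun μ => fn (ξ μ)

lemma vfFlow_fn (ξ : Fin N → Fn N) (φ : Fn N) (n : ℤ) :
    vfFlow ξ * fn φ n - fn φ n * vfFlow ξ = fn (∑ μ, ξ μ * Fn.pd μ φ) n := by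
  -- `flow_field_commutator` concerns families indexed by directions; φ is repeated in every
  -- direction and read off at index 0. Without directions both sides vanish.
  rcases Nat.eq_zero_or_pos N with rfl | hN
  · have h0 : vfFlow ξ = 0 := by
      have := (hasOpSum_flow (B := fun μ => fn (ξ μ)) fun μ => ann_fn _)
      exact this.unique (HasOpSum.zero.congr fun a => a.1.elim0)
    have h1 : fn (0 : Fn 0) = 0 := map_zero fnLinear
    simp [h0, h1]
  · have h := flow_field_commutator (B := fun μ => fn (ξ μ)) (fun μ => ann_fn _)
      (hasDer_fn (fun _ : Fin N => φ) id) (fun μ ν => fcomm_fn _ _) (fun μ μ' ν => fcomm_fn _ _)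
      ⟨0, hN⟩ n
    rw [act_fn_fn ξ (fun _ => φ)] at h
    exact h

lemma repFlow_fn (f : Trig) (φ : Fn N) (n : ℤ) :
    flow (repField f) * fn φ n - fn φ n * flow (repField f) =
      (-OpField.smear f (fn φ).dot) n := by
  rcases Nat.eq_zero_or_pos N with rfl | hN
  · have h0 : flow (repField f) = (0 : Module.End ℂ (Fock 0)) := by
      have := (hasOpSum_flow (B := repField (N := 0) f) (ann_repField f))
      exact this.unique (HasOpSum.zero.congr fun a => a.1.elim0)
    have h1 : OpField.smear f (fn φ).dot = 0 := by
      rw [fn_dot, OpField.smear_eq_mul]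
      refine OpField.mul_eq_of_hasOpSum fun n => ?_
      simpa using HasOpSum.zero
    simp [h0, h1]
  · have h := flow_field_commutator (ann_repField f) (hasDer_fn (fun _ : Fin N => φ) id)
      (fun μ ν => (fcomm_fn_repField _ _ _).symm) (fun μ μ' ν => (fcomm_fn_repField _ _ _).symm)
      ⟨0, hN⟩ n
    rw [act_repField_fn f (fun _ => φ)] at h
    exact h

/-- `φ'(t) ψ(q(t))`, where `φ' = d/dt φ(q(t))`. -/
lemma dot_fn_mul (φ ψ : Fn N) : OpField.mul (fn φ).dot (fn ψ) =
    ∑ ρ, OpField.mul (qField ρ).dot (fn (Fn.pd ρ φ * ψ)) := by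
  have hq : ∀ μ : Fin N, OpField.Ann (qField μ).dot := fun μ => (ann_qField μ).dot
  have hqf : ∀ (μ : Fin N) χ, OpField.FComm (qField μ).dot (fn χ) :=
    fun μ χ => (fcomm_qField_fn μ χ).dot_left
  rw [fn_dot, OpField.sum_mul (ann_fn ψ) (fun μ _ => (hq μ).mul (ann_fn _) (hqf μ _))
    (fun μ _ => (OpField.FComm.mul_right (hq μ) (ann_fn _) (hqf μ _) (hqf μ _).symm
      (fcomm_fn _ _)).symm)]
  refine Finset.sum_congr rfl fun μ _ => ?_
  rw [OpField.mul_assoc (hq μ) (ann_fn _) (ann_fn _) (hqf μ _) (hqf μ _) (fcomm_fn _ _), fn_mul]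


end Fock
end Flows

/-! ### Central terms of the commutators of flows -/

section FlowCommutators

variable {N : ℕ}

namespace Fock

/-- Both derivative weights are 1, so the contractions at transfer l add up to l, that is, to -i
d/dt on ∂_ν ξ^μ. This is the summand 1 of c₁. -/
lemma vfFlow_vfFlow (ξ η : Fin N → Fn N) :
    vfFlow ξ * vfFlow η - vfFlow η * vfFlow ξ = vfFlow (vfBracket ξ η) + (-Complex.I) •
      ∑ μ, ∑ ν, OpField.mul (fn (Fn.pd ν (ξ μ))).dot (fn (Fn.pd μ (η ν))) 0 := by
  have h := flow_commutator (hasDer_fn ξ id) (hasDer_fn η id) (fun μ ν => fcomm_fn _ _)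
    (fun _ _ _ => fcomm_fn _ _) (fun _ _ _ => fcomm_fn _ _) (fun _ _ _ _ => fcomm_fn _ _)
  have h' := hasOpSum_contraction (N := N) (Y := fun ν μ => fn (Fn.pd ν (ξ μ)))
    (Y' := fun ν μ => fn (Fn.pd ν (η μ))) (v := fun _ => 1) (v' := fun _ => 1)
    (c := fun l => (l : ℂ)) (fun l => by simpa using signedSum_one l) (fun μ ν => ann_fn _)
    (fun μ ν => ann_fn _) (fun _ _ _ _ => fcomm_fn _ _)
  have h1 := h.unique h'
  have h2 : vfFlow (vfBracket ξ η) = flow (act (fun μ => fn (ξ μ)) (fun _ => 1)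
      (fun ν μ => fn (Fn.pd ν (η μ)))) - flow (act (fun μ => fn (η μ)) (fun _ => 1)
      (fun ν μ => fn (Fn.pd ν (ξ μ)))) := by
    rw [← flow_sub]
    · unfold vfFlow
      congr 1
      funext ν
      rw [Pi.sub_apply, act_fn_fn, act_fn_fn, ← fn_sub, vfBracket, Finset.sum_sub_distrib]
    · intro ν
      rw [act_fn_fn]
      exact ann_fn _
    · intro ν
      rw [act_fn_fn]
      exact ann_fn _
  have h3 : ∀ φ ψ : Fn N, OpField.mul (OpField.weight (fun l : ℤ => (l : ℂ)) (fn φ)) (fn ψ) 0 =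
      (-Complex.I) • OpField.mul (fn φ).dot (fn ψ) 0 := by
    intro φ ψ
    rw [OpField.weight_freq, OpField.smul_mul (ann_fn φ).dot (ann_fn ψ) (fcomm_fn φ ψ).dot_left]
    rfl
  simp only [h3, ← Finset.smul_sum, id] at h1
  rw [h2, vfFlow, vfFlow]
  exact end_eq_of_sub_add h1

/-- The two flow terms agree, both coming from -f times the derivative of ξ(q(t)), and cancel. The
weights i j and 1 sum to i l(l-1)/2, which acts on f as -i/2 times f̈ - i ḟ; this is the summand 1
of c₃. -/
lemma repFlow_vfFlow (f : Trig) (ξ : Fin N → Fn N) :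
    flow (repField f) * vfFlow ξ - vfFlow ξ * flow (repField f) = (-Complex.I / 2) •
      ∑ μ, OpField.smear (f.dot.dot - Complex.I • f.dot) (fn (Fn.pd μ (ξ μ))) 0 := by
  have h := flow_commutator (hasDer_repField f) (hasDer_fn ξ id)
    (fun μ ν => (fcomm_fn_repField _ _ _).symm)
    (fun _ _ _ => (fcomm_repDer _ _ _ _).symm) (fun _ _ _ => (fcomm_fn_repField _ _ _).symm)
    (fun _ _ _ _ => (fcomm_repDer _ _ _ _).symm)
  have h1 := h.unique (hasOpSum_contraction (N := N) (Y := repDer f)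
    (Y' := fun ν μ => fn (Fn.pd ν (ξ μ))) (v := fun j => Complex.I * j) (v' := fun _ => 1)
    (c := fun l => Complex.I * (l * (l - 1) / 2))
    (fun l => by simpa [signedSum_id] using signedSum_mul_left Complex.I (fun j => (j : ℂ)) l)
    (ann_repDer f) (fun μ ν => ann_fn _) (fun _ _ _ _ => (fcomm_repDer _ _ _ _).symm))
  have h2 : act (repField f) (fun _ => 1) (fun ν μ => fn (Fn.pd ν (ξ μ))) =
      act (fun μ => fn (ξ μ)) (fun j => Complex.I * j) (repDer f) := by
    funext ν
    rw [act_repField_fn, act_rep fun μ => ann_fn _]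
  simp only [id] at h1
  rw [h2, sub_add_cancel] at h1
  rw [vfFlow, h1, Finset.smul_sum]
  refine Finset.sum_congr rfl fun μ _ => ?_
  rw [Finset.sum_eq_single μ]
  · have e : OpField.weight (fun l : ℤ => Complex.I * (l * (l - 1) / 2)) (repDer f μ μ) =
        (-Complex.I / 2) • (OpField.scalar (f.dot.dot - Complex.I • f.dot) : OpField (Fock N)) := by
      funext n
      simp only [OpField.weight, repDer, if_true, OpField.scalar, Pi.smul_apply, smul_smul]
      congr 1
      simp only [AddMonoidAlgebra.coeff_sub, AddMonoidAlgebra.coeff_smul, Finsupp.sub_apply,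
        Finsupp.smul_apply, Trig.coeff_dot, smul_eq_mul]
      linear_combination (Complex.I * n * f.coeff n * (n - 1) / 2) * Complex.I_sq
    rw [e, OpField.smul_mul (OpField.ann_scalar _) (ann_fn _) (OpField.fcomm_scalar_left _ _),
      OpField.smear_eq_mul]
    rfl
  · intro ν _ hν
    have e : OpField.mul (OpField.weight (fun l : ℤ => Complex.I * (l * (l - 1) / 2))
        (repDer f ν μ)) (fn (Fn.pd μ (ξ ν))) = 0 := by
      refine OpField.mul_eq_of_hasOpSum fun n => ?_
      simpa [repDer, hν, OpField.weight] using HasOpSum.zero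
    exact congrFun e 0
  · simp

/-- The contractions with weights i j and i(j-l) sum to (l³-l)/6, once for each of the N directions
since the derivatives are diagonal; with the prefactor N/12 = 2N/24 this is the summand 2N of c₄. -/
lemma repFlow_repFlow (f h : Trig) :
    flow (repField f) * flow (repField h) - flow (repField h) * flow (repField f) =
      flow (repField (N := N) (f * h.dot - f.dot * h)) +
        (N / (12 * Real.pi * Complex.I) * Trig.integral (f.dot.dot * h.dot - f.dot * h)) • 1 := by
  have h0 := flow_commutator (N := N) (hasDer_repField f) (hasDer_repField h)
    (fcomm_repField_repField f h) (fun _ _ _ => (fcomm_repDer _ _ _ _).symm)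
    (fun _ _ _ => fcomm_repDer _ _ _ _) (fun _ _ _ _ => fcomm_repDer _ _ _ _)
  have hc : ∀ l, signedSum (fun j => Complex.I * j * (Complex.I * ((j - l : ℤ) : ℂ))) l =
      ((l : ℂ) ^ 3 - l) / 6 := by
    intro l
    have e : (fun j : ℤ => Complex.I * j * (Complex.I * ((j - l : ℤ) : ℂ))) =
        fun j : ℤ => (-1) * (j : ℂ) ^ 2 + l * (j : ℂ) := by
      funext j
      push_cast
      linear_combination (j * (j - l) : ℂ) * Complex.I_sq
    rw [e, signedSum_add (fun j : ℤ => (-1) * (j : ℂ) ^ 2) fun j : ℤ => l * (j : ℂ),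
      signedSum_mul_left, signedSum_mul_left, signedSum_sq, signedSum_id]
    ring
  have h1 := h0.unique (hasOpSum_contraction (N := N) (Y := repDer f) (Y' := repDer h)
    (v := fun j => Complex.I * j) (v' := fun j => Complex.I * j)
    (c := fun l => ((l : ℂ) ^ 3 - l) / 6) hc
    (ann_repDer f) (ann_repDer h) (fun _ _ _ _ => fcomm_repDer _ _ _ _))
  have hs : ∀ (a b : Trig) (μ : Fin N), OpField.smear a (repField b μ).dot =
      -OpField.mul (OpField.scalar (a * b.dot)) (qField μ).dot -
        OpField.mul (OpField.scalar (a * b)) (qField μ).dot.dot := by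
    intro a b μ
    have hq := (ann_qField μ).dot
    have s := fun (a : Trig) (B : OpField (Fock N)) => OpField.fcomm_scalar_left a B
    have sa := fun a : Trig => OpField.ann_scalar (W := Fock N) a
    have e1 : (repField b μ).dot = -(OpField.mul (OpField.scalar b.dot) (qField μ).dot +
        OpField.mul (OpField.scalar b) (qField μ).dot.dot) := by
      rw [← OpField.scalar_dot, ← OpField.dot_mul (sa b) hq (s _ _), ← OpField.smear_eq_mul]
      funext n
      simp [repField, OpField.dot]
    have m1 := (sa b.dot).mul hq (s _ _)
    have m2 := (sa b).mul hq.dot (s _ _)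
    rw [OpField.smear_eq_mul, e1, OpField.mul_neg (sa a) (m1.add m2) (s _ _),
      OpField.mul_add (sa a) m1 m2 (s _ _) (s _ _),
      ← OpField.mul_assoc (sa a) (sa _) hq (s _ _) (s _ _) (s _ _),
      ← OpField.mul_assoc (sa a) (sa _) hq.dot (s _ _) (s _ _) (s _ _), OpField.scalar_mul,
      OpField.scalar_mul]
    abel
  -- In both iterated actions q̈ has the coefficient f h, so it cancels in the difference and only a
  -- multiple of q̇ remains.
  have h2 : flow (repField (N := N) (f * h.dot - f.dot * h)) =
      flow (act (repField f) (fun j => Complex.I * j) (repDer h)) -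
      flow (act (repField h) (fun j => Complex.I * j) (repDer f)) := by
    rw [← flow_sub]
    · congr 1
      funext μ
      have hq := (ann_qField μ).dot
      rw [Pi.sub_apply, act_rep (ann_repField f), act_rep (ann_repField h), hs, hs, repField,
        OpField.smear_eq_mul, OpField.scalar_sub, mul_comm h f, mul_comm h f.dot]
      have e2 : OpField.mul (OpField.scalar (f * h.dot) - OpField.scalar (f.dot * h))
          (qField μ).dot = OpField.mul (OpField.scalar (f * h.dot)) (qField μ).dot -
            OpField.mul (OpField.scalar (f.dot * h)) (qField μ).dot := by
        refine OpField.mul_eq_of_hasOpSum fun n => ?_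
        refine ((OpField.hasOpSum_mul (OpField.ann_scalar _) hq (OpField.fcomm_scalar_left _ _)
          n).sub (OpField.hasOpSum_mul (OpField.ann_scalar _) hq (OpField.fcomm_scalar_left _ _)
          n)).congr fun k => ?_
        rw [Pi.sub_apply, sub_mul]
      rw [e2]
      abel
    · intro μ
      rw [act_rep (ann_repField f)]
      exact (OpField.ann_smear (ann_repField f μ).dot h).neg
    · intro μ
      rw [act_rep (ann_repField h)]
      exact (OpField.ann_smear (ann_repField h μ).dot f).neg
  have h3 : ∑ μ : Fin N, ∑ ν : Fin N, OpField.mul (OpField.weight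
      (fun l : ℤ => ((l : ℂ) ^ 3 - l) / 6) (repDer f ν μ)) (repDer h μ ν) 0 =
      (N / (12 * Real.pi * Complex.I) * Trig.integral (f.dot.dot * h.dot - f.dot * h)) •
        (1 : Module.End ℂ (Fock N)) := by
    have e : OpField.mul (OpField.weight (fun l : ℤ => ((l : ℂ) ^ 3 - l) / 6)
        (OpField.scalar f)) (OpField.scalar h : OpField (Fock N)) 0 =
        (1 / (12 * Real.pi * Complex.I) * Trig.integral (f.dot.dot * h.dot - f.dot * h)) • 1 := by
      have e1 : (1 / (12 * Real.pi * Complex.I) * Trig.integral (f.dot.dot * h.dot - f.dot * h)) •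
          (1 : Module.End ℂ (Fock N)) = (-Complex.I / 6) •
          (OpField.scalar (f.dot.dot * h.dot - f.dot * h) : OpField (Fock N)) 0 := by
        rw [OpField.scalar, smul_smul]
        congr 1
        have : (Real.pi : ℂ) ≠ 0 := Complex.ofReal_ne_zero.2 Real.pi_ne_zero
        have hI := Complex.I_ne_zero
        simp only [Trig.integral, LinearMap.coe_mk, AddHom.coe_mk]
        field_simp
        linear_combination (12 * (f.dot.dot * h.dot - f.dot * h).coeff 0) * Complex.I_sq
      have sa := fun a : Trig => OpField.ann_scalar (W := Fock N) a
      have s := fun (a : Trig) (B : OpField (Fock N)) => OpField.fcomm_scalar_left a B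
      rw [e1, OpField.scalar_sub, OpField.scalar_mul, OpField.scalar_mul]
      refine HasOpSum.unique (OpField.hasOpSum_mul ((sa f).weight _) (sa h)
        ((s _ _).weight_left _) 0) (((((OpField.hasOpSum_mul (sa f.dot.dot) (sa h.dot) (s _ _) 0)).sub
          (OpField.hasOpSum_mul (sa f.dot) (sa h) (s _ _) 0)).smul (-Complex.I / 6)).congr
          fun k => ?_)
      simp only [OpField.weight, OpField.scalar, Trig.coeff_dot, smul_mul_assoc, one_mul,
        smul_smul, ← sub_smul]
      congr 1
      push_cast
      linear_combination (f.coeff k * h.coeff (0 - k) * (k - k ^ 3 * (1 - Complex.I ^ 2)) / 6) *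
        Complex.I_sq
    have e' : ∀ μ : Fin N, ∑ ν : Fin N, OpField.mul (OpField.weight
        (fun l : ℤ => ((l : ℂ) ^ 3 - l) / 6) (repDer f ν μ)) (repDer h μ ν) 0 =
        (1 / (12 * Real.pi * Complex.I) * Trig.integral (f.dot.dot * h.dot - f.dot * h)) • 1 := by
      intro μ
      rw [Finset.sum_eq_single μ, ← e]
      · simp only [repDer, if_true]
      · intro ν _ hν
        have e3 : OpField.mul (OpField.weight (fun l : ℤ => ((l : ℂ) ^ 3 - l) / 6)
            (repDer f ν μ)) (repDer h μ ν) = 0 := by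
          refine OpField.mul_eq_of_hasOpSum fun n => ?_
          simpa [repDer, hν, OpField.weight] using HasOpSum.zero
        exact congrFun e3 0
      · simp
    rw [Finset.sum_congr rfl fun μ _ => e' μ, Finset.sum_const, Finset.card_univ, Fintype.card_fin,
      ← Nat.cast_smul_eq_nsmul ℂ, smul_smul]
    congr 1
    ring
  rw [h3] at h1
  rw [h2]
  exact end_eq_of_sub_add h1

end Fock

end FlowCommutators

/-! ### Products of a commuting field with a current -/

section CurrentFields

variable {W : Type*} [AddCommGroup W] [Module ℂ W]

lemma HasOpSum.graph {α β : Type*} [DecidableEq β] {A : α → Module.End ℂ W} {S : Module.End ℂ W}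
    (h : HasOpSum A S) (σ : α → β) :
    HasOpSum (fun x : α × β => if x.2 = σ x.1 then A x.1 else 0) S := by
  have hl : LocFin fun x : α × β => if x.2 = σ x.1 then A x.1 else 0 := fun w => by
    refine ((h.1 w).image fun a => (a, σ a)).subset ?_
    rintro ⟨a, b⟩ hab
    simp only [Set.mem_ofPred_eq] at hab
    split_ifs at hab with hb
    · exact ⟨a, hab, by rw [hb]⟩
    · exact absurd rfl hab
  have h1 := hl.hasOpSum.prod_fst (T := A) fun a => by
    simpa using HasOpSum.single (A := fun b => if b = σ a then A a else 0) (σ a)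
      fun b hb => if_neg hb
  rw [h.unique h1]
  exact hl.hasOpSum

lemma commutator_mul_mul {R : Type*} [Ring R] {b c i i' : R} (hbc : Commute b c)
    (hbi' : Commute b i') (hci : Commute c i) :
    b * i * (c * i') - c * i' * (b * i) = b * (c * (i * i' - i' * i)) := by
  rw [mul_sub, mul_sub, mul_assoc b i, ← mul_assoc i c, ← hci.eq, mul_assoc c i i',
    ← mul_assoc (c * i') b, mul_assoc c i' b, ← hbi'.eq, ← mul_assoc c b i', ← hbc.eq]
  simp only [mul_assoc]

namespace OpField

/-- The current part of the bracket assembles to a triple product. The central part forces opposite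
frequencies, k = -j, and its factor -j is a derivative of B; it is placed on that graph to share the
index set of pairs. -/
lemma commutator_mul_zero {B C I I' I'' : OpField W} (hB : Ann B) (hC : Ann C) (hI : Ann I)
    (hI' : Ann I') (hI'' : Ann I'') (hBC : FComm B C) (hBI : FComm B I) (hBI' : FComm B I')
    (hBI'' : FComm B I'') (hCI : FComm C I) (hCI' : FComm C I') (hCI'' : FComm C I'') {a κ : ℂ}
    (h : ∀ m n, I m * I' n - I' n * I m =
      a • I'' (m + n) + if m + n = 0 then (m * κ) • (1 : Module.End ℂ W) else 0) :
    mul B I 0 * mul C I' 0 - mul C I' 0 * mul B I 0 =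
      a • mul (mul B C) I'' 0 + (Complex.I * κ) • mul B.dot C 0 := by
  have e1 := (hasOpSum_mul hB hI hBI 0).mul (hasOpSum_mul hC hI' hCI' 0)
  have e2 := ((hasOpSum_mul hC hI' hCI' 0).mul (hasOpSum_mul hB hI hBI 0)).swap
  have e3 := (hasOpSum_triple hB hC hI'' hBC hBI'' hCI'' 0).smul a
  have e4 := ((hasOpSum_mul hB.dot hC hBC.dot_left 0).smul (Complex.I * κ)).graph
    fun j : ℤ => -j
  refine (e1.sub e2).unique ((e3.add e4).congr fun x => ?_)
  obtain ⟨j, k⟩ := x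
  simp only
  rw [commutator_mul_mul (hBC j k) (hBI' j _) (hCI k _), h, _root_.mul_add, _root_.mul_add,
    mul_smul_comm, mul_smul_comm]
  congr 1
  · rw [show (0 : ℤ) - j + (0 - k) = 0 - j - k by ring]
  · by_cases hk : k = -j
    · subst hk
      rw [if_pos rfl, if_pos (by ring), mul_smul_comm, mul_smul_comm, _root_.mul_one, dot,
        smul_mul_assoc, smul_smul, zero_sub]
      congr 1
      push_cast
      linear_combination (κ * j) * Complex.I_sq
    · rw [if_neg hk, if_neg (by omega), mul_zero, mul_zero]

/-- B transforms with weight zero and I as a density up to e, so the product B I changes by a total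
derivative plus e B; the integral of the former vanishes. -/
lemma commutator_mul_dilation {L : Module.End ℂ W} {B I : OpField W} (hB : Ann B) (hI : Ann I)
    (hBI : FComm B I) (f e : Trig) (hLB : ∀ n, L * B n - B n * L = (-smear f B.dot) n)
    (hLI : ∀ n, L * I n - I n * L = (-(smear f I).dot + scalar e : OpField W) n) :
    L * mul B I 0 - mul B I 0 * L = smear e B 0 := by
  have hs := fcomm_scalar_left (W := W)
  have hs' := fcomm_scalar_right (W := W)
  have hf := ann_scalar (W := W) f
  have hfI := ann_smear hI f
  have hBfI := fcomm_smear hI hBI f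
  have h := commutator_mul (k := 0) hB hI (ann_smear hB.dot f).neg (hfI.dot.neg.add (ann_scalar e))
    hBI (fcomm_smear hB.dot hBI.dot_left.symm f).symm.neg_left
    (hBfI.dot_right.neg_right.add_right (hs' e B)) (fun n => by rw [add_zero]; exact hLB n)
    (fun n => by rw [add_zero]; exact hLI n) 0
  have hd := congrFun (dot_mul hB hfI hBfI) 0
  rw [add_zero, mul_add hB hfI.dot.neg (ann_scalar e) hBfI.dot_right.neg_right (hs' e B),
    mul_neg hB hfI.dot hBfI.dot_right, neg_mul (ann_smear hB.dot f) hI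
      (fcomm_smear hB.dot hBI.dot_left.symm f).symm, mul_comm hB (ann_scalar e) (hs' e B),
    ← smear_eq_mul, smear_eq_mul f B.dot, mul_comm hf hB.dot (hs _ _),
    mul_assoc hB.dot hf hI (hs' _ _) hBI.dot_left (hs _ _), ← smear_eq_mul] at h
  rw [h]
  simp only [dot, Pi.add_apply, Int.cast_zero, mul_zero, zero_smul] at hd
  simp only [Pi.add_apply, Pi.neg_apply]
  rw [eq_neg_of_add_eq_zero_left hd.symm, neg_neg, add_neg_cancel_left]

end OpField

end CurrentFields

/-! ### The modes of currents and Virasoro generators on V -/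

section Currents

variable {g : Type*} [LieRing g] [LieAlgebra ℂ g] {N p : ℕ} {K : CentralData g N p}

namespace VirKM

lemma lie_current_current (f h : Trig) (M M' : EnvMat g N p) :
    ⁅current K f M, current K h M'⁆ = current K (f * h) (M * M' - M' * M) +
      (-(1 / (2 * Real.pi * Complex.I)) * (matForm g N p K.k M M' *
        Trig.integral (Trig.dot f * h))) • central K := by
  ext1
  · rw [lie_cur, add_cur, smul_cur]
    simp [current, central, TensorProduct.tmul_sub, mul_comm h f]
  · rw [lie_vir, add_vir, smul_vir]
    simp [current, central]
  · rw [lie_cen, add_cen, smul_cen]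
    simp [current, central, Loop.dot, CentralData.form_tmul]

lemma lie_virasoro_current (f h : Trig) (M : EnvMat g N p) :
    ⁅virasoro K f, current K h M⁆ = current K (f * Trig.dot h) M +
      (1 / (4 * Real.pi * Complex.I) * (matFunctional g N p K.d M *
        Trig.integral ((f.dot.dot - Complex.I • f.dot) * h))) • central K := by
  ext1
  · rw [lie_cur, add_cur, smul_cur]
    simp [current, central, virasoro, Loop.dot, TensorProduct.smul_tmul']
  · rw [lie_vir, add_vir, smul_vir]
    simp [current, central, virasoro]
  · rw [lie_cen, add_cen, smul_cen]
    simp only [current, central, virasoro, CentralData.functional_tmul, map_zero, mul_zero,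
      LinearMap.zero_apply, smul_zero, sub_zero, mul_smul_comm, map_smul, smul_eq_mul]
    ring

lemma lie_virasoro_virasoro (f h : Trig) :
    ⁅virasoro K f, virasoro K h⁆ = virasoro K (f * h.dot - f.dot * h) +
      (K.c / (24 * Real.pi * Complex.I) * Trig.integral (f.dot.dot * h.dot - f.dot * h)) •
        central K := by
  ext1
  · rw [lie_cur, add_cur, smul_cur]
    simp [central, virasoro]
  · rw [lie_vir, add_vir, smul_vir]
    simp [central, virasoro]
  · rw [lie_cen, add_cen, smul_cen]
    simp [central, virasoro]

end VirKM

variable {V : Type*} [AddCommGroup V] [Module ℂ V]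
  [LieRingModule (VirKM K) V] [LieModule ℂ (VirKM K) V]

lemma toEnd_commutator (x y : VirKM K) :
    LieModule.toEnd ℂ (VirKM K) V x * LieModule.toEnd ℂ (VirKM K) V y -
      LieModule.toEnd ℂ (VirKM K) V y * LieModule.toEnd ℂ (VirKM K) V x =
      LieModule.toEnd ℂ (VirKM K) V ⁅x, y⁆ := by
  rw [LieHom.map_lie, Ring.lie_def]

lemma IsSmoothModule.toEnd_central (hV : IsSmoothModule K V) :
    LieModule.toEnd ℂ (VirKM K) V (VirKM.central K) = 1 := by
  ext v
  exact hV.central v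

variable (K V) in
/-- The action of the current smeared with `f`, as a linear function of `f` and the matrix. -/
def currentAction : Trig →ₗ[ℂ] EnvMat g N p →ₗ[ℂ] Module.End ℂ V :=
  LinearMap.mk₂ ℂ (fun f M => LieModule.toEnd ℂ (VirKM K) V (VirKM.current K f M))
    (fun f h M => by
      rw [← map_add]
      congr 1
      ext1 <;> simp [VirKM.current, VirKM.add_cur, VirKM.add_vir, VirKM.add_cen,
        TensorProduct.add_tmul])
    (fun a f M => by
      rw [← map_smul]
      congr 1
      ext1 <;> simp [VirKM.current, VirKM.smul_cur, VirKM.smul_vir, VirKM.smul_cen,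
        TensorProduct.smul_tmul'])
    (fun f M M' => by
      rw [← map_add]
      congr 1
      ext1 <;> simp [VirKM.current, VirKM.add_cur, VirKM.add_vir, VirKM.add_cen,
        TensorProduct.tmul_add])
    (fun a f M => by
      rw [← map_smul]
      congr 1
      ext1 <;> simp [VirKM.current, VirKM.smul_cur, VirKM.smul_vir, VirKM.smul_cen])

variable (K V) in
/-- The action of the smeared Virasoro generator as a linear function of `f`. -/
def virasoroAction : Trig →ₗ[ℂ] Module.End ℂ V where
  toFun f := LieModule.toEnd ℂ (VirKM K) V (VirKM.virasoro K f)
  map_add' f h := by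
    rw [← map_add]
    congr 1
    ext1 <;> simp [VirKM.virasoro, VirKM.add_cur, VirKM.add_vir, VirKM.add_cen]
  map_smul' a f := by
    rw [RingHom.id_apply, ← map_smul]
    congr 1
    ext1 <;> simp [VirKM.virasoro, VirKM.smul_cur, VirKM.smul_vir, VirKM.smul_cen]

variable (K V) in
/-- The modes of the current `I^M(t)` on `V`. -/
def currentField (M : EnvMat g N p) : OpField V := fun n =>
  (1 / (2 * Real.pi) : ℂ) • currentAction K V (LaurentPolynomial.T (-n)) M

lemma ann_currentField (hV : IsSmoothModule K V) (M : EnvMat g N p) :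
    OpField.Ann (currentField K V M) := fun v => by
  obtain ⟨n₀, h⟩ := hV.smooth M v
  refine ⟨n₀, fun n hn => ?_⟩
  rw [currentField, LinearMap.smul_apply]
  change _ • ⁅VirKM.current K (LaurentPolynomial.T (-n)) M, v⁆ = 0
  rw [h n hn, smul_zero]

lemma dot_T (n : ℤ) : Trig.dot (LaurentPolynomial.T n) = (Complex.I * n) • LaurentPolynomial.T n := by
  rw [LaurentPolynomial.T]
  refine (Trig.dot_single n 1).trans ?_
  rw [AddMonoidAlgebra.smul_single, smul_eq_mul]

lemma coeff_mul_T (f : Trig) (m : ℤ) : (f * LaurentPolynomial.T (-m)).coeff 0 = f.coeff m := by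
  rw [LaurentPolynomial.T, AddMonoidAlgebra.coeff_mul_apply_right, AddMonoidAlgebra.coeff_single,
    Finsupp.sum_single_index (by simp)]
  simp

lemma integral_mul_T (f : Trig) (m : ℤ) :
    Trig.integral (f * LaurentPolynomial.T (-m)) = 2 * (Real.pi : ℂ) * f.coeff m := by
  change 2 * (Real.pi : ℂ) * (f * LaurentPolynomial.T (-m)).coeff 0 = _
  rw [coeff_mul_T]

lemma currentAction_mul_T (f : Trig) (M : EnvMat g N p) (n : ℤ) :
    (1 / (2 * Real.pi) : ℂ) • currentAction K V (f * LaurentPolynomial.T (-n)) M =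
      OpField.smear f (currentField K V M) n := by
  induction f using AddMonoidAlgebra.induction_linear with
  | zero => simp [OpField.smear]
  | add f₁ f₂ h₁ h₂ =>
    rw [add_mul, map_add, LinearMap.add_apply, smul_add, h₁, h₂]
    simp only [OpField.smear, AddMonoidAlgebra.coeff_add]
    rw [Finsupp.sum_add_index' (by simp) (by simp [add_smul])]
  | single m a =>
    simp only [OpField.smear, AddMonoidAlgebra.coeff_single, currentField]
    rw [Finsupp.sum_single_index (by simp), smul_comm a]
    congr 1
    rw [← LinearMap.smul_apply, ← map_smul, LaurentPolynomial.T, LaurentPolynomial.T,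
      AddMonoidAlgebra.single_mul_single, AddMonoidAlgebra.smul_single, smul_eq_mul, neg_sub,
      sub_eq_add_neg]

/-- For the test functions exp(-imt) and exp(-int) the central term equals m k^{MN} when m + n = 0;
the normalization 1/2π of the two modes accounts for 1/4π² there and leaves one factor 1/2π with the
current. -/
lemma current_commutator (hV : IsSmoothModule K V) (M M' : EnvMat g N p) (m n : ℤ) :
    currentField K V M m * currentField K V M' n - currentField K V M' n * currentField K V M m =
      (1 / (2 * Real.pi) : ℂ) • currentField K V (M * M' - M' * M) (m + n) +
        if m + n = 0 then (m * (matForm g N p K.k M M' / (4 * Real.pi ^ 2)) : ℂ) • 1 else 0 := by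
  have h := toEnd_commutator (V := V) (VirKM.current K (LaurentPolynomial.T (-m)) M)
    (VirKM.current K (LaurentPolynomial.T (-n)) M')
  rw [VirKM.lie_current_current, map_add, map_smul, hV.toEnd_central, ← LaurentPolynomial.T_add,
    dot_T, smul_mul_assoc, map_smul, integral_mul_T] at h
  simp only [currentField, smul_mul_smul_comm, ← smul_sub]
  change _ • (LieModule.toEnd ℂ (VirKM K) V _ * LieModule.toEnd ℂ (VirKM K) V _ -
    LieModule.toEnd ℂ (VirKM K) V _ * LieModule.toEnd ℂ (VirKM K) V _) = _
  rw [h, smul_add, smul_smul (1 / (2 * Real.pi) : ℂ), neg_add, smul_smul]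
  congr 1
  have : (Real.pi : ℂ) ≠ 0 := Complex.ofReal_ne_zero.2 Real.pi_ne_zero
  rw [LaurentPolynomial.T, AddMonoidAlgebra.coeff_single, Finsupp.single_apply]
  by_cases hmn : m + n = 0
  · rw [if_pos hmn, if_pos (by omega)]
    congr 1
    push_cast
    rw [smul_eq_mul]
    field_simp
    ring
  · rw [if_neg hmn, if_neg (by omega)]
    simp

/-- The derivative falls on the mode function exp(-int), which amounts to minus the derivative of
the whole field f I: currents are densities of weight one, unlike functions of q(t). -/
lemma virasoro_current (hV : IsSmoothModule K V) (f : Trig) (M : EnvMat g N p) (n : ℤ) :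
    virasoroAction K V f * currentField K V M n - currentField K V M n * virasoroAction K V f =
      (-(OpField.smear f (currentField K V M)).dot + OpField.scalar
        ((matFunctional g N p K.d M / (4 * Real.pi * Complex.I)) •
          (f.dot.dot - Complex.I • f.dot)) : OpField V) n := by
  have h := toEnd_commutator (V := V) (VirKM.virasoro K f)
    (VirKM.current K (LaurentPolynomial.T (-n)) M)
  rw [VirKM.lie_virasoro_current, map_add, map_smul, hV.toEnd_central, integral_mul_T] at h
  rw [currentField, mul_smul_comm, smul_mul_assoc, ← smul_sub]
  change _ • (LieModule.toEnd ℂ (VirKM K) V _ * LieModule.toEnd ℂ (VirKM K) V _ -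
    LieModule.toEnd ℂ (VirKM K) V _ * LieModule.toEnd ℂ (VirKM K) V _) = _
  rw [h, smul_add, smul_smul]
  refine congrArg₂ (· + ·) ?_ ?_
  · change _ • currentAction K V (f * Trig.dot (LaurentPolynomial.T (-n))) M = _
    rw [dot_T, mul_smul_comm, map_smul, LinearMap.smul_apply, smul_comm, currentAction_mul_T]
    simp [OpField.dot]
  · have : (Real.pi : ℂ) ≠ 0 := Complex.ofReal_ne_zero.2 Real.pi_ne_zero
    rw [OpField.scalar, AddMonoidAlgebra.coeff_smul, Finsupp.smul_apply, smul_eq_mul]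
    congr 1
    field_simp

lemma virasoro_virasoro (hV : IsSmoothModule K V) (f h : Trig) :
    virasoroAction K V f * virasoroAction K V h - virasoroAction K V h * virasoroAction K V f =
      virasoroAction K V (f * h.dot - f.dot * h) +
      (K.c / (24 * Real.pi * Complex.I) * Trig.integral (f.dot.dot * h.dot - f.dot * h)) • 1 := by
  change LieModule.toEnd ℂ (VirKM K) V _ * LieModule.toEnd ℂ (VirKM K) V _ - _ = _
  refine (toEnd_commutator _ _).trans ?_
  rw [VirKM.lie_virasoro_virasoro, map_add, map_smul, hV.toEnd_central]
  rfl

end Currents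

/-! ### Fields acting on one tensor factor -/

section TensorFields

variable {W U : Type*} [AddCommGroup W] [Module ℂ W] [AddCommGroup U] [Module ℂ U]

lemma OpField.Ann.of_tensor {B : OpField (W ⊗[ℂ] U)}
    (h : ∀ w u, ∃ n₀ : ℤ, ∀ n ≥ n₀, B n (w ⊗ₜ u) = 0) : OpField.Ann B := fun x => by
  induction x using TensorProduct.induction_on with
  | zero => exact ⟨0, fun _ _ => map_zero _⟩
  | tmul w u => exact h w u
  | add x y hx hy =>
    obtain ⟨a, ha⟩ := hx
    obtain ⟨b, hb⟩ := hy
    exact ⟨max a b, fun n hn => by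
      rw [map_add, ha n (le_of_max_le_left hn), hb n (le_of_max_le_right hn), add_zero]⟩

lemma OpField.Ann.rTensor {B : OpField W} (h : OpField.Ann B) :
    OpField.Ann fun n => ((B n).rTensor U : Module.End ℂ (W ⊗[ℂ] U)) :=
  OpField.Ann.of_tensor fun w u => by
    obtain ⟨n₀, hn₀⟩ := h w
    exact ⟨n₀, fun n hn => by rw [LinearMap.rTensor_tmul, hn₀ n hn, TensorProduct.zero_tmul]⟩

lemma OpField.Ann.lTensor {B : OpField U} (h : OpField.Ann B) :
    OpField.Ann fun n => ((B n).lTensor W : Module.End ℂ (W ⊗[ℂ] U)) :=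
  OpField.Ann.of_tensor fun w u => by
    obtain ⟨n₀, hn₀⟩ := h u
    exact ⟨n₀, fun n hn => by rw [LinearMap.lTensor_tmul, hn₀ n hn, TensorProduct.tmul_zero]⟩

lemma OpField.rTensor_mul {B C : OpField W} (hB : OpField.Ann B) (hC : OpField.Ann C)
    (h : OpField.FComm B C) : (fun n => ((OpField.mul B C n).rTensor U : Module.End ℂ (W ⊗[ℂ] U))) =
      OpField.mul (fun n => (B n).rTensor U) fun n => (C n).rTensor U :=
  (OpField.mul_eq_of_hasOpSum fun n => (OpField.hasOpSum_mul hB hC h n).rTensor.congr fun _ =>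
    LinearMap.rTensor_mul ..).symm

lemma lTensor_sub_mul {A B C : Module.End ℂ U} (h : A * B - B * A = C) :
    (A.lTensor W * B.lTensor W - B.lTensor W * A.lTensor W : Module.End ℂ (W ⊗[ℂ] U)) =
      C.lTensor W := by
  rw [← LinearMap.lTensor_mul, ← LinearMap.lTensor_mul, ← h, LinearMap.lTensor_sub]

lemma rTensor_sub_mul {A B C : Module.End ℂ W} (h : A * B - B * A = C) :
    (A.rTensor U * B.rTensor U - B.rTensor U * A.rTensor U : Module.End ℂ (W ⊗[ℂ] U)) =
      C.rTensor U := by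
  rw [← LinearMap.rTensor_mul, ← LinearMap.rTensor_mul, ← h, LinearMap.rTensor_sub]

end TensorFields

/-! ### Pairings of functions of q(t) with currents -/

section Pairing

variable {g : Type*} [LieRing g] [LieAlgebra ℂ g] {N p : ℕ} {K : CentralData g N p}
  {V : Type*} [AddCommGroup V] [Module ℂ V]

lemma ann_fnField (φ : Fn N) : OpField.Ann (fnField V φ) := (Fock.ann_fn φ).rTensor

lemma fcomm_fnField (φ ψ : Fn N) : OpField.FComm (fnField V φ) (fnField V ψ) :=
  fun m n => rTensor_commute (Fock.fcomm_fn φ ψ m n)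

lemma fnField_mul (φ ψ : Fn N) :
    fnField V (φ * ψ) = OpField.mul (fnField V φ) (fnField V ψ) := by
  have h := OpField.rTensor_mul (U := V) (Fock.ann_fn φ) (Fock.ann_fn ψ) (Fock.fcomm_fn φ ψ)
  rw [← Fock.fn_mul] at h
  exact h

variable (V) in
/-- `φ ↦ φ(q(t))` on `Fock N ⊗ V` as a linear map. -/
def fnFieldLinear : Fn N →ₗ[ℂ] OpField (Carrier N V) where
  toFun := fnField V
  map_add' φ ψ := by
    funext n
    simp only [fnField, onFock, Fock.fn_add, Pi.add_apply]
    exact LinearMap.rTensor_add ..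
  map_smul' a φ := by
    funext n
    simp only [fnField, onFock, Fock.fn_smul, Pi.smul_apply]
    exact LinearMap.rTensor_smul ..

lemma dot_fnField (φ : Fn N) :
    (fnField V φ).dot = fun n => ((Fock.fn φ).dot n).rTensor V := by
  funext n
  exact (LinearMap.rTensor_smul ..).symm

lemma onFock_dot_mul (φ ψ : Fn N) (n : ℤ) :
    onFock V (OpField.mul (Fock.fn φ).dot (Fock.fn ψ) n) =
      OpField.mul (fnField V φ).dot (fnField V ψ) n := by
  rw [dot_fnField]
  exact congrFun (OpField.rTensor_mul (Fock.ann_fn φ).dot (Fock.ann_fn ψ)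
    (Fock.fcomm_fn φ ψ).dot_left) n

lemma dot_fnField_mul (φ ψ : Fn N) : OpField.mul (fnField V φ).dot (fnField V ψ) =
    ∑ ρ, OpField.mul (fnField V (Fn.coord ρ)).dot (fnField V (Fn.pd ρ φ * ψ)) := by
  funext n
  rw [← onFock_dot_mul, Fock.dot_fn_mul, Finset.sum_apply, Finset.sum_apply]
  simp only [← onFock_dot_mul, Fock.fn_coord]
  exact map_sum (LinearMap.rTensorHom V) _ _

variable [LieRingModule (VirKM K) V] [LieModule ℂ (VirKM K) V]

lemma ann_curField (hV : IsSmoothModule K V) (M : EnvMat g N p) :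
    OpField.Ann (curField K V M) := (ann_currentField hV M).lTensor

lemma fcomm_fnField_curField (φ : Fn N) (M : EnvMat g N p) :
    OpField.FComm (fnField V φ) (curField K V M) :=
  fun _ _ => rTensor_lTensor_commute _ _

lemma curField_eq (M : EnvMat g N p) :
    curField K V M = fun n => (currentField K V M n).lTensor (Fock N) := rfl

lemma curField_add (M M' : EnvMat g N p) :
    curField K V (M + M') = curField K V M + curField K V M' := by
  funext n
  simp only [curField_eq, Pi.add_apply, currentField]
  rw [map_add, smul_add]
  exact LinearMap.lTensor_add ..

lemma curField_smul (a : ℂ) (M : EnvMat g N p) : curField K V (a • M) = a • curField K V M := by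
  funext n
  simp only [curField_eq, Pi.smul_apply, currentField]
  rw [map_smul, smul_comm]
  exact LinearMap.lTensor_smul ..

/-- `∫ φ(q(t)) I^M(t) dt` as a bilinear function of `φ` and `M`. -/
def pairingMap (hV : IsSmoothModule K V) :
    Fn N →ₗ[ℂ] EnvMat g N p →ₗ[ℂ] Module.End ℂ (Carrier N V) :=
  LinearMap.mk₂ ℂ (pairing K V)
    (fun φ ψ M => by
      have h : fnField V (φ + ψ) = fnField V φ + fnField V ψ := (fnFieldLinear V).map_add φ ψ
      simp only [pairing, OpField.integral, h]
      rw [OpField.mul_comm ((ann_fnField φ).add (ann_fnField ψ)) (ann_curField hV M)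
          ((fcomm_fnField_curField φ M).symm.add_right (fcomm_fnField_curField ψ M).symm).symm,
        OpField.mul_add (ann_curField hV M) (ann_fnField φ) (ann_fnField ψ)
          (fcomm_fnField_curField φ M).symm (fcomm_fnField_curField ψ M).symm, Pi.add_apply,
        smul_add, OpField.mul_comm (ann_curField hV M) (ann_fnField φ)
          (fcomm_fnField_curField φ M).symm, OpField.mul_comm (ann_curField hV M) (ann_fnField ψ)
          (fcomm_fnField_curField ψ M).symm])
    (fun a φ M => by
      have h : fnField V (a • φ) = a • fnField V φ := (fnFieldLinear V).map_smul a φ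
      simp only [pairing, OpField.integral, h]
      rw [OpField.smul_mul (ann_fnField φ) (ann_curField hV M) (fcomm_fnField_curField φ M),
        Pi.smul_apply, smul_comm])
    (fun φ M M' => by
      simp only [pairing, OpField.integral, curField_add]
      rw [OpField.mul_add (ann_fnField φ) (ann_curField hV M) (ann_curField hV M')
        (fcomm_fnField_curField φ M) (fcomm_fnField_curField φ M'), Pi.add_apply, smul_add])
    (fun a φ M => by
      simp only [pairing, OpField.integral, curField_smul]
      rw [OpField.mul_smul (ann_fnField φ) (ann_curField hV M) (fcomm_fnField_curField φ M),
        Pi.smul_apply, smul_comm])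

lemma pairingMap_apply (hV : IsSmoothModule K V) (φ : Fn N) (M : EnvMat g N p) :
    pairingMap hV φ M = pairing K V φ M := rfl

lemma smul_commutator {W : Type*} [AddCommGroup W] [Module ℂ W] (c d : ℂ) (A B : Module.End ℂ W) :
    (c • A) * (d • B) - (d • B) * (c • A) = (c * d) • (A * B - B * A) := by
  rw [smul_mul_smul_comm, smul_mul_smul_comm, mul_comm d c, smul_sub]

lemma commutator_smul {W : Type*} [AddCommGroup W] [Module ℂ W] (c : ℂ) (A B : Module.End ℂ W) :
    A * (c • B) - (c • B) * A = c • (A * B - B * A) := by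
  rw [mul_smul_comm, smul_mul_assoc, smul_sub]

lemma smul_add_smul_eq_sub {W : Type*} [AddCommGroup W] [Module ℂ W] {a b a' b' : ℂ} (h : a = a')
    (h' : b = -b') (x y : W) : a • x + b • y = a' • x - b' • y := by
  rw [h, h', neg_smul, sub_eq_add_neg]

lemma curField_commutator (hV : IsSmoothModule K V) (M M' : EnvMat g N p) (m n : ℤ) :
    curField K V M m * curField K V M' n - curField K V M' n * curField K V M m =
      (1 / (2 * Real.pi) : ℂ) • curField K V (M * M' - M' * M) (m + n) +
        if m + n = 0 then (m * (matForm g N p K.k M M' / (4 * Real.pi ^ 2)) : ℂ) • 1 else 0 := by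
  refine (lTensor_sub_mul (current_commutator hV M M' m n)).trans ?_
  refine (LinearMap.lTensor_add ..).trans (congrArg₂ (· + ·) (LinearMap.lTensor_smul ..) ?_)
  split_ifs
  · refine (LinearMap.lTensor_smul ..).trans ?_
    rw [Module.End.one_eq_id, LinearMap.lTensor_id]
    rfl
  · exact LinearMap.lTensor_zero ..

/-- `OpField.commutator_mul_zero`, with the derivative of φ(q(t)) expanded by the chain rule. The
factor (2π)² of the two integrals meets 1/2π in the current term and 1/4π² in the central one. -/
lemma pairing_commutator (hV : IsSmoothModule K V) (φ ψ : Fn N) (M M' : EnvMat g N p) :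
    pairing K V φ M * pairing K V ψ M' - pairing K V ψ M' * pairing K V φ M =
      pairing K V (φ * ψ) (M * M' - M' * M) - (1 / (2 * Real.pi * Complex.I)) •
        matForm g N p K.k M M' • ∑ ρ, trajectoryIntegral (fnField V) ρ (Fn.pd ρ φ * ψ) := by
  have h := OpField.commutator_mul_zero (ann_fnField φ) (ann_fnField ψ) (ann_curField hV M)
    (ann_curField hV M') (ann_curField hV (M * M' - M' * M)) (fcomm_fnField φ ψ)
    (fcomm_fnField_curField φ M) (fcomm_fnField_curField φ M') (fcomm_fnField_curField φ _)
    (fcomm_fnField_curField ψ M) (fcomm_fnField_curField ψ M') (fcomm_fnField_curField ψ _)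
    (curField_commutator hV M M')
  rw [← fnField_mul, dot_fnField_mul] at h
  simp only [pairing, OpField.integral, trajectoryIntegral]
  rw [smul_commutator, h, smul_add, smul_smul, smul_smul, ← Finset.smul_sum, smul_smul, smul_smul,
    Finset.sum_apply]
  have : (Real.pi : ℂ) ≠ 0 := Complex.ofReal_ne_zero.2 Real.pi_ne_zero
  have hI := Complex.I_ne_zero
  refine smul_add_smul_eq_sub ?_ ?_ _ _
  · field_simp
  · field_simp
    linear_combination (4 * matForm g N p K.k M M') * Complex.I_sq

lemma vfFlow_pairing (hV : IsSmoothModule K V) (ξ : Fin N → Fn N) (φ : Fn N) (M : EnvMat g N p) :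
    onFock V (Fock.vfFlow ξ) * pairing K V φ M - pairing K V φ M * onFock V (Fock.vfFlow ξ) =
      pairing K V (∑ μ, ξ μ * Fn.pd μ φ) M := by
  have h := OpField.commutator_mul (A := onFock V (Fock.vfFlow ξ)) (k := 0) (C' := 0)
    (B' := fnField V (∑ μ, ξ μ * Fn.pd μ φ))
    (ann_fnField φ) (ann_curField hV M) (ann_fnField _) OpField.ann_zero
    (fcomm_fnField_curField φ M) (fcomm_fnField_curField _ M) (fun _ _ => Commute.zero_right _)
    (fun n => by
      rw [add_zero]
      exact rTensor_sub_mul (Fock.vfFlow_fn ξ φ n))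
    (fun n => sub_eq_zero.2 (rTensor_lTensor_commute _ _).eq) 0
  have h0 : OpField.mul (fnField V φ) (0 : OpField (Carrier N V)) = 0 :=
    OpField.mul_eq_of_hasOpSum fun n => HasOpSum.zero.congr fun _ => (mul_zero _).symm
  rw [h0, add_zero, Pi.zero_apply, add_zero] at h
  simp only [pairing, OpField.integral]
  rw [commutator_smul, h]

/-- The generator `L_f` on `Fock N ⊗ V`. -/
def dilation (K : CentralData g N p) (V : Type*) [AddCommGroup V] [Module ℂ V]
    [LieRingModule (VirKM K) V] [LieModule ℂ (VirKM K) V] (f : Trig) : Module.End ℂ (Carrier N V) :=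
  onFock V (Fock.flow (Fock.repField f)) + (virasoroAction K V f).lTensor (Fock N)

lemma dilation_fnField (f : Trig) (φ : Fn N) (n : ℤ) :
    dilation K V f * fnField V φ n - fnField V φ n * dilation K V f =
      (-OpField.smear f (fnField V φ).dot) n := by
  have h1 : onFock V (Fock.flow (Fock.repField f)) * fnField V φ n -
      fnField V φ n * onFock V (Fock.flow (Fock.repField f)) = _ :=
    rTensor_sub_mul (U := V) (Fock.repFlow_fn f φ n)
  have h2 : (virasoroAction K V f).lTensor (Fock N) * fnField V φ n =
      fnField V φ n * (virasoroAction K V f).lTensor (Fock N) :=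
    (rTensor_lTensor_commute _ _).symm.eq
  rw [dilation, add_mul, mul_add, h2, add_sub_add_right_eq_sub, h1, dot_fnField]
  simp only [OpField.smear, Pi.neg_apply, Finsupp.sum]
  refine (LinearMap.rTensor_neg ..).trans (congrArg Neg.neg ?_)
  refine (map_sum (LinearMap.rTensorHom V) _ _).trans (Finset.sum_congr rfl fun k _ => ?_)
  exact LinearMap.rTensor_smul ..

lemma dilation_curField (hV : IsSmoothModule K V) (f : Trig) (M : EnvMat g N p) (n : ℤ) :
    dilation K V f * curField K V M n - curField K V M n * dilation K V f =
      (-(OpField.smear f (curField K V M)).dot + OpField.scalar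
        ((matFunctional g N p K.d M / (4 * Real.pi * Complex.I)) •
          (f.dot.dot - Complex.I • f.dot)) : OpField (Carrier N V)) n := by
  have h1 : (virasoroAction K V f).lTensor (Fock N) * curField K V M n -
      curField K V M n * (virasoroAction K V f).lTensor (Fock N) = _ :=
    lTensor_sub_mul (W := Fock N) (virasoro_current hV f M n)
  have h2 : onFock V (Fock.flow (Fock.repField f)) * curField K V M n =
      curField K V M n * onFock V (Fock.flow (Fock.repField f)) :=
    (rTensor_lTensor_commute _ _).eq
  rw [dilation, add_mul, mul_add, h2, add_sub_add_left_eq_sub, h1]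
  refine (LinearMap.lTensor_add ..).trans (congrArg₂ (· + ·) ?_ ?_)
  · refine (LinearMap.lTensor_neg ..).trans (congrArg Neg.neg ?_)
    refine (LinearMap.lTensor_smul ..).trans (congrArg _ ?_)
    refine (map_sum (LinearMap.lTensorHom (Fock N)) _ _).trans (Finset.sum_congr rfl fun k _ => ?_)
    exact LinearMap.lTensor_smul ..
  · refine (LinearMap.lTensor_smul ..).trans ?_
    rw [Module.End.one_eq_id, LinearMap.lTensor_id]
    rfl

lemma dilation_pairing (hV : IsSmoothModule K V) (f : Trig) (φ : Fn N) (M : EnvMat g N p) :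
    dilation K V f * pairing K V φ M - pairing K V φ M * dilation K V f =
    (matFunctional g N p K.d M / (4 * Real.pi * Complex.I)) •
      (OpField.smear (f.dot.dot - Complex.I • f.dot) (fnField V φ)).integral := by
  have h := OpField.commutator_mul_dilation (ann_fnField φ) (ann_curField hV M)
    (fcomm_fnField_curField φ M) f _ (dilation_fnField f φ) (dilation_curField hV f M)
  simp only [pairing, OpField.integral]
  rw [commutator_smul, h, smul_comm _ (2 * (Real.pi : ℂ))]
  congr 1
  simp only [OpField.smear_eq_mul]
  have e : ∀ (a : ℂ) (e : Trig), (OpField.scalar (a • e) : OpField (Carrier N V)) =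
      a • OpField.scalar e := fun a e => by
    funext n
    simp only [OpField.scalar, Pi.smul_apply, AddMonoidAlgebra.coeff_smul, Finsupp.smul_apply,
      smul_eq_mul, smul_smul]
  rw [e, OpField.smul_mul (OpField.ann_scalar _) (ann_fnField φ) (OpField.fcomm_scalar_left _ _)]
  rfl

end Pairing

/-! ### Multi-indices and sums of binomial coefficients -/

section MultiIndices

variable {N p : ℕ}

lemma mem_multiIndices {m : Fin N → ℕ} : m ∈ multiIndices N p ↔ ∑ μ, m μ ≤ p := by
  simp only [multiIndices, Finset.mem_filter, Fintype.mem_piFinset, Finset.mem_range, Order.lt_add_one_iff,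
    and_iff_right_iff_imp]
  exact fun h μ => (Finset.single_le_sum (fun _ _ => Nat.zero_le _) (Finset.mem_univ μ)).trans h

lemma mem_multiIndices_of_le {m n : Fin N → ℕ} (hm : m ∈ multiIndices N p) (h : n ≤ m) :
    n ∈ multiIndices N p :=
  mem_multiIndices.2 ((Finset.sum_le_sum fun μ _ => h μ).trans (mem_multiIndices.1 hm))

/-- Counts subsets of n + 1 points with a + b + 1 elements by the position k of the element that has
a elements below and b above it. The proof is an induction with Pascal's rule, in which b must vary.
-/
lemma sum_range_choose_mul_choose (n a b : ℕ) :
    ∑ k ∈ Finset.range (n + 1), k.choose a * (n - k).choose b = (n + 1).choose (a + b + 1) := by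
  induction n generalizing b with
  | zero => cases a <;> cases b <;> simp [Nat.choose_eq_zero_of_lt]
  | succ n ih =>
    cases b with
    | zero =>
      have h := ih 0
      simp only [Nat.choose_zero_right, mul_one, add_zero] at h ⊢
      rw [Finset.sum_range_succ, h, Nat.choose_succ_succ (n + 1) a, add_comm]
    | succ b =>
      rw [Finset.sum_range_succ, Nat.sub_self, Nat.choose_zero_succ, mul_zero, add_zero,
        Nat.choose_succ_succ, ← add_assoc a b 1, ← ih b, add_assoc a b 1, ← ih (b + 1),
        ← Finset.sum_add_distrib]
      refine Finset.sum_congr rfl fun k hk => ?_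
      rw [Finset.mem_range] at hk
      rw [Nat.succ_sub (by omega), Nat.choose_succ_succ, mul_add]

/-- Source of the binomial coefficients in the charges. Splitting off the first entry k leaves
multi-indices of length at most p - k in one direction less; the sum over k is
`sum_range_choose_mul_choose`. -/
lemma sum_multiIndices_choose (N p : ℕ) (α : Fin N → ℕ) :
    ∑ m ∈ multiIndices N p, ∏ μ, (m μ).choose (α μ) = (N + p).choose (N + ∑ μ, α μ) := by
  induction N generalizing p with
  | zero =>
    have h : multiIndices 0 p = {0} := by
      ext m
      simp [mem_multiIndices, Subsingleton.elim m 0]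
    simp [h]
  | succ N ih =>
    have h : ∑ m ∈ multiIndices (N + 1) p, ∏ μ, (m μ).choose (α μ) =
        ∑ k ∈ Finset.range (p + 1), ∑ m ∈ multiIndices N (p - k),
          k.choose (α 0) * ∏ μ, (m μ).choose (α μ.succ) := by
      rw [Finset.sum_sigma']
      refine Finset.sum_bij' (fun m _ => ⟨m 0, fun μ => m μ.succ⟩) (fun x _ => Fin.cons x.1 x.2)
        ?_ ?_ ?_ ?_ ?_
      · intro m hm
        rw [mem_multiIndices, Fin.sum_univ_succ] at hm
        simp only [Finset.mem_sigma, Finset.mem_range, mem_multiIndices]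
        omega
      · rintro ⟨k, m⟩ hm
        simp only [Finset.mem_sigma, Finset.mem_range, mem_multiIndices] at hm
        rw [mem_multiIndices, Fin.sum_univ_succ]
        simp only [Fin.cons_zero, Fin.cons_succ]
        omega
      · intro m _
        exact Fin.cons_self_tail m
      · rintro ⟨k, m⟩ _
        simp
      · intro m _
        rw [Fin.prod_univ_succ]
    simp only [← Finset.mul_sum, ih] at h
    rw [h, Fin.sum_univ_succ]
    have h2 := sum_range_choose_mul_choose (N + p) (α 0) (N + ∑ μ : Fin N, α μ.succ)
    rw [show N + 1 + p = N + p + 1 by ring, show N + 1 + (α 0 + ∑ μ : Fin N, α μ.succ) =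
      α 0 + (N + ∑ μ : Fin N, α μ.succ) + 1 by ring, ← h2]
    -- The range of k may be extended from p to N + p: for k > p the upper entry N + p - k is below
    -- N and the binomial coefficient vanishes.
    refine (Finset.sum_congr rfl fun k hk => ?_).trans (Finset.sum_subset
      (Finset.range_subset_range.2 (by omega : p + 1 ≤ N + p + 1)) fun k hk hk' => ?_)
    · rw [Finset.mem_range] at hk
      rw [show N + p - k = N + (p - k) by omega]
    · rw [Finset.mem_range] at hk hk'
      rw [Nat.choose_eq_zero_of_lt (n := N + p - k) (by omega), mul_zero]

lemma sum_multiChoose (α : Fin N → ℕ) :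
    ∑ m ∈ multiIndices N p, multiChoose m α = ((N + p).choose (N + ∑ μ, α μ) : ℂ) := by
  rw [← sum_multiIndices_choose]
  push_cast
  rfl

lemma multiChoose_eq_zero {m n : Fin N → ℕ} (h : ¬ n ≤ m) : multiChoose m n = 0 := by
  rw [Pi.le_def, not_forall] at h
  obtain ⟨μ, hμ⟩ := h
  exact Finset.prod_eq_zero (Finset.mem_univ μ) (by
    rw [Nat.choose_eq_zero_of_lt (not_le.1 hμ), Nat.cast_zero])

lemma multiChoose_self (m : Fin N → ℕ) : multiChoose m m = 1 := by simp [multiChoose]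

lemma multiChoose_sub {m n : Fin N → ℕ} (h : n ≤ m) : multiChoose m (m - n) = multiChoose m n :=
  Finset.prod_congr rfl fun μ _ => by rw [Pi.sub_apply, Nat.choose_symm (h μ)]

lemma multiChoose_add_single (m n : Fin N → ℕ) (μ : Fin N) :
    multiChoose (m + Pi.single μ 1) (n + Pi.single μ 1) =
      multiChoose m n + multiChoose m (n + Pi.single μ 1) := by
  have h : ∀ a b : Fin N → ℕ, multiChoose a b =
      ((a μ).choose (b μ) : ℂ) * ∏ ν ∈ Finset.univ.erase μ, ((a ν).choose (b ν) : ℂ) :=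
    fun a b => (Finset.mul_prod_erase _ _ (Finset.mem_univ μ)).symm
  have h' : ∀ ν ∈ Finset.univ.erase μ, ∀ a : Fin N → ℕ, (a + Pi.single μ 1 : Fin N → ℕ) ν = a ν :=
    fun ν hν a => by simp [(Finset.mem_erase.1 hν).1]
  have e1 : ∏ ν ∈ Finset.univ.erase μ, (((m + Pi.single μ 1 : Fin N → ℕ) ν).choose
      ((n + Pi.single μ 1 : Fin N → ℕ) ν) : ℂ) =
      ∏ ν ∈ Finset.univ.erase μ, ((m ν).choose (n ν) : ℂ) :=
    Finset.prod_congr rfl fun ν hν => by rw [h' ν hν, h' ν hν]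
  have e2 : ∏ ν ∈ Finset.univ.erase μ, ((m ν).choose ((n + Pi.single μ 1 : Fin N → ℕ) ν) : ℂ) =
      ∏ ν ∈ Finset.univ.erase μ, ((m ν).choose (n ν) : ℂ) :=
    Finset.prod_congr rfl fun ν hν => by rw [h' ν hν]
  rw [h, h m n, h m, e1, e2]
  simp only [Pi.add_apply, Pi.single_eq_same, Nat.choose_succ_succ]
  push_cast
  ring

lemma multiChoose_add_single_of_eq_zero (m : Fin N → ℕ) {n : Fin N → ℕ} {μ : Fin N} (h : n μ = 0) :
    multiChoose (m + Pi.single μ 1) n = multiChoose m n :=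
  Finset.prod_congr rfl fun ν _ => by
    by_cases hν : ν = μ
    · subst hν
      simp [h]
    · simp [hν]

lemma sub_single_add_single {m : Fin N → ℕ} {μ : Fin N} (h : m μ ≠ 0) :
    m - Pi.single μ 1 + Pi.single μ 1 = m := by
  funext ν
  by_cases hν : ν = μ
  · subst hν
    simp
    omega
  · simp [hν]

lemma multiIndex_induction {P : (Fin N → ℕ) → Prop} (zero : P 0)
    (add : ∀ m μ, P m → P (m + Pi.single μ 1)) (m : Fin N → ℕ) : P m := by
  obtain ⟨d, hd⟩ : ∃ d, ∑ μ, m μ = d := ⟨_, rfl⟩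
  induction d generalizing m with
  | zero =>
    have : m = 0 := by
      funext μ
      simpa using (Finset.sum_eq_zero_iff.1 hd) μ (Finset.mem_univ μ)
    rwa [this]
  | succ d ih =>
    obtain ⟨μ, _, hμ⟩ := Finset.exists_ne_zero_of_sum_ne_zero (hd.trans_ne d.succ_ne_zero)
    rw [← sub_single_add_single hμ] at hd ⊢
    refine add _ _ (ih _ ?_)
    simp only [Pi.add_apply, Finset.sum_add_distrib, Finset.sum_pi_single', Finset.mem_univ,
      if_true] at hd ⊢
    omega

end MultiIndices

/-! ### Multiplication and shift on jets -/

section Jets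

variable {N p : ℕ}

/-- The coefficients of Leibniz' rule, `∂_m (φ ψ) = Σ_n leib φ m n ∂_n ψ`. -/
def leib (φ : Fn N) (m n : Fin N → ℕ) : Fn N := multiChoose m n • Fn.pdMulti (m - n) φ

lemma leib_eq_zero (φ : Fn N) {m n : Fin N → ℕ} (h : ¬ n ≤ m) : leib φ m n = 0 := by
  rw [leib, multiChoose_eq_zero h, zero_smul]

lemma leib_self (φ : Fn N) (m : Fin N → ℕ) : leib φ m m = φ := by
  rw [leib, multiChoose_self, one_smul, tsub_self, Fn.pdMulti_zero, Module.End.one_apply]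

lemma leib_add_single_of_eq_zero (φ : Fn N) (m : Fin N → ℕ) {n : Fin N → ℕ} {μ : Fin N}
    (h : n μ = 0) : leib φ (m + Pi.single μ 1) n = leib (Fn.pd μ φ) m n := by
  have e : m + Pi.single μ 1 - n = m - n + Pi.single μ 1 := by
    funext ν
    by_cases hν : ν = μ
    · subst hν
      simp [h]
    · simp [hν]
  rw [leib, multiChoose_add_single_of_eq_zero m h, e, Fn.pdMulti_add_single, leib]

/-- In ∂_μ applied to ∂_m(φψ), the derivative of order n + μ of ψ arises by differentiating the
coefficient at n + μ, or by raising the derivative of order n. -/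
lemma leib_add_single (φ : Fn N) (m n : Fin N → ℕ) (μ : Fin N) :
    leib φ (m + Pi.single μ 1) (n + Pi.single μ 1) =
      leib (Fn.pd μ φ) m (n + Pi.single μ 1) + leib φ m n := by
  rw [leib, multiChoose_add_single, add_smul, add_tsub_add_eq_tsub_right, add_comm, leib, leib]
  congr 1
  -- With truncated subtraction, m - n = m - (n + μ) + μ is available only for n + μ ≤ m; otherwise
  -- the binomial coefficient is zero.
  by_cases h : n + Pi.single μ 1 ≤ m
  · rw [← Fn.pdMulti_add_single]
    congr 3
    funext ν
    have := h ν
    simp only [Pi.add_apply, Pi.sub_apply] at this ⊢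
    omega
  · rw [multiChoose_eq_zero h, zero_smul, zero_smul]

lemma leib_add (φ ψ : Fn N) (m n : Fin N → ℕ) : leib (φ + ψ) m n = leib φ m n + leib ψ m n := by
  rw [leib, map_add, smul_add, leib, leib]

lemma leib_smul (a : ℂ) (φ : Fn N) (m n : Fin N → ℕ) : leib (a • φ) m n = a • leib φ m n := by
  rw [leib, map_smul, smul_comm, leib]

lemma pd_leib (μ : Fin N) (φ : Fn N) (m n : Fin N → ℕ) :
    Fn.pd μ (leib φ m n) = leib (Fn.pd μ φ) m n := by
  rw [leib, map_smul, leib]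
  congr 1
  exact LinearMap.congr_fun (Fn.pd_pdMulti_comm (m - n) μ).eq φ

/-- Two expansions of ∂_m applied to a product of φ, ψ and a third function. Both sides obey the
same recursion when m is raised in direction μ. -/
lemma leib_mul_sum (φ ψ : Fn N) (m r : Fin N → ℕ) :
    ∑ n ∈ Finset.Iic m, leib φ m n * leib ψ n r = leib (φ * ψ) m r := by
  induction m using multiIndex_induction generalizing φ ψ r with
  | zero =>
    rw [show Finset.Iic (0 : Fin N → ℕ) = {0} from Finset.Iic_bot, Finset.sum_singleton, leib_self]
    by_cases h : r ≤ 0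
    · have : r = 0 := le_antisymm h (fun _ => Nat.zero_le _)
      rw [this, leib_self, leib_self]
    · rw [leib_eq_zero _ h, leib_eq_zero _ h, mul_zero]
  | add m μ ih =>
    have hs : ∑ n ∈ Finset.Iic (m + Pi.single μ 1), leib φ (m + Pi.single μ 1) n * leib ψ n r =
        ∑ n ∈ Finset.Iic m, leib (Fn.pd μ φ) m n * leib ψ n r +
          ∑ n ∈ Finset.Iic m, leib φ m n * leib ψ (n + Pi.single μ 1) r := by
      have h1 : ∑ n ∈ Finset.Iic m, leib (Fn.pd μ φ) m n * leib ψ n r =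
          ∑ n ∈ Finset.Iic (m + Pi.single μ 1), leib (Fn.pd μ φ) m n * leib ψ n r :=
        Finset.sum_subset (Finset.Iic_subset_Iic.2 le_self_add) fun n _ hn => by
          rw [leib_eq_zero _ (by simpa using hn), zero_mul]
      have h2 : ∑ n ∈ Finset.Iic m, leib φ m n * leib ψ (n + Pi.single μ 1) r =
          ∑ n ∈ Finset.Iic (m + Pi.single μ 1), if n μ = 0 then 0 else
            leib φ m (n - Pi.single μ 1) * leib ψ n r := by
        simp only [← ite_not (_ = 0), ← Finset.sum_filter]
        refine Finset.sum_bij' (fun n _ => n + Pi.single μ 1) (fun n _ => n - Pi.single μ 1)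
          ?_ ?_ ?_ ?_ ?_
        · intro n hn
          rw [Finset.mem_filter, Finset.mem_Iic]
          exact ⟨add_le_add_left (Finset.mem_Iic.1 hn) _, by simp⟩
        · intro n hn
          rw [Finset.mem_filter, Finset.mem_Iic] at hn
          exact Finset.mem_Iic.2 (tsub_le_iff_right.2 hn.1)
        · intro n _
          exact add_tsub_cancel_right _ _
        · intro n hn
          exact sub_single_add_single (Finset.mem_filter.1 hn).2
        · intro n _
          rw [add_tsub_cancel_right]
      rw [h1, h2, ← Finset.sum_add_distrib]
      refine Finset.sum_congr rfl fun n _ => ?_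
      split_ifs with hn
      · rw [leib_add_single_of_eq_zero _ _ hn, add_zero]
      · obtain ⟨n', rfl⟩ : ∃ n', n = n' + Pi.single μ 1 := 
          ⟨n - Pi.single μ 1, (sub_single_add_single hn).symm⟩
        rw [leib_add_single, add_tsub_cancel_right, add_mul]
    rw [hs, ih]
    by_cases hr : r μ = 0
    · simp only [leib_add_single_of_eq_zero _ _ hr, ih]
      rw [Fn.pd_mul, leib_add]
    · obtain ⟨r', rfl⟩ : ∃ r', r = r' + Pi.single μ 1 :=
        ⟨r - Pi.single μ 1, (sub_single_add_single hr).symm⟩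
      simp only [leib_add_single, mul_add, Finset.sum_add_distrib, ih]
      rw [Fn.pd_mul, leib_add, add_assoc]

/-- Matrices of functions, with rows and columns indexed by multi-indices of length `≤ p`. -/
abbrev FnMat (N p : ℕ) : Type := Matrix (multiIndices N p) (multiIndices N p) (Fn N)

/-- The matrix of the multiplication by `φ` on `p`-jets. -/
def jet (p : ℕ) : Fn N →ₗ[ℂ] FnMat N p where
  toFun φ := Matrix.of fun m n => leib φ m.1 n.1
  map_add' φ ψ := by
    ext1 m n
    exact leib_add ..
  map_smul' a φ := by
    ext1 m n
    exact leib_smul ..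

/-- The part of `jet φ` which contains derivatives of `φ`. -/
def jetRed (p : ℕ) : Fn N →ₗ[ℂ] FnMat N p where
  toFun φ := jet p φ - φ • 1
  map_add' φ ψ := by
    rw [map_add, add_smul]
    abel
  map_smul' a φ := by
    rw [map_smul, RingHom.id_apply, smul_sub, smul_assoc]

/-- The shift of multi-indices by `α`. -/
def shift (p : ℕ) (α : Fin N → ℕ) : FnMat N p := Matrix.of fun m n => if n.1 = m.1 + α then 1 else 0

lemma jetRed_eq (φ : Fn N) : jetRed p φ = jet p φ - φ • 1 := rfl

lemma jet_apply (φ : Fn N) (m n : multiIndices N p) : jet p φ m n = leib φ m.1 n.1 := rfl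

/-- The truncation is harmless: only n ≤ m contribute to row m, and these have length at most p when
m has. -/
lemma jet_mul (φ ψ : Fn N) : jet p (φ * ψ) = jet p φ * jet p ψ := by
  ext1 m r
  rw [Matrix.mul_apply, jet_apply, ← leib_mul_sum]
  simp only [jet_apply]
  rw [Finset.sum_coe_sort (multiIndices N p) fun n => leib φ m n * leib ψ n r]
  refine Finset.sum_subset (fun n hn => mem_multiIndices_of_le m.2 (Finset.mem_Iic.1 hn))
    fun n _ hn => ?_
  rw [leib_eq_zero _ (by simpa using hn), zero_mul]

lemma jet_commute (φ ψ : Fn N) : jet p φ * jet p ψ = jet p ψ * jet p φ := by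
  rw [← jet_mul, mul_comm, jet_mul]

lemma jetRed_mul_jet (φ ψ : Fn N) :
    jetRed p φ * jet p ψ = jetRed p (φ * ψ) - φ • jetRed p ψ := by
  rw [jetRed_eq, jetRed_eq, jetRed_eq, sub_mul, ← jet_mul, smul_mul_assoc, one_mul, smul_sub,
    smul_smul]
  abel

lemma jet_mul_jetRed (φ ψ : Fn N) :
    jet p φ * jetRed p ψ = jetRed p (φ * ψ) - ψ • jetRed p φ := by
  rw [mul_comm φ ψ, ← jetRed_mul_jet, jetRed_eq, mul_sub, sub_mul, jet_commute, mul_smul_comm,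
    mul_one, smul_mul_assoc, one_mul]

lemma jetRed_mul_jetRed (φ ψ : Fn N) :
    jetRed p φ * jetRed p ψ = jetRed p (φ * ψ) - φ • jetRed p ψ - ψ • jetRed p φ := by
  rw [jetRed_eq ψ, mul_sub, jetRed_mul_jet, mul_smul_comm, mul_one, jetRed_eq ψ]

lemma jetRed_commute (φ ψ : Fn N) : jetRed p φ * jetRed p ψ = jetRed p ψ * jetRed p φ := by
  rw [jetRed_mul_jetRed, jetRed_mul_jetRed, mul_comm, sub_right_comm]

/-- If m + α + β has length at most p, so has the intermediate index m + α. -/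
lemma shift_mul (α β : Fin N → ℕ) : shift p α * shift p β = shift p (α + β) := by
  ext1 m r
  simp only [Matrix.mul_apply, shift, Matrix.of_apply, mul_ite, mul_one, mul_zero]
  by_cases h : r.1 = m.1 + (α + β)
  · rw [if_pos h]
    have hm : m.1 + α ∈ multiIndices N p := mem_multiIndices_of_le r.2 (by
      rw [h, ← add_assoc]
      exact le_self_add)
    rw [Finset.sum_eq_single ⟨m.1 + α, hm⟩]
    · rw [if_pos (by rw [h, add_assoc]), if_pos rfl]
    · intro n _ hn
      rw [if_neg (c := n.1 = m.1 + α) fun h' => hn (Subtype.ext h'), ite_self]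
    · simp
  · rw [if_neg h]
    refine Finset.sum_eq_zero fun n _ => ?_
    split_ifs with h1 h2
    · exact absurd (by rw [h1, h2, add_assoc]) h
    · rfl
    · rfl

/-- `jet φ` is lower triangular with diagonal φ; removing the diagonal makes it strictly triangular,
which is what hides the truncation of the shift in `jetRed_mul_shift_mul`. -/
lemma jetRed_apply_eq_zero (φ : Fn N) {m n : multiIndices N p} (h : ¬ n.1 < m.1) :
    jetRed p φ m n = 0 := by
  rw [jetRed_eq, Matrix.sub_apply, jet_apply, Matrix.smul_apply, Matrix.one_apply]
  split_ifs with hmn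
  · rw [hmn, leib_self, smul_eq_mul, mul_one, sub_self]
  · rw [leib_eq_zero _ fun h' => h (lt_of_le_of_ne h' fun e => hmn (Subtype.ext e.symm)), smul_zero,
      sub_zero]

lemma shift_mul_apply (M : FnMat N p) (α : Fin N → ℕ) (m r : multiIndices N p)
    (h : m.1 + α ∈ multiIndices N p) : (shift p α * M) m r = M ⟨m.1 + α, h⟩ r := by
  rw [Matrix.mul_apply, Finset.sum_eq_single ⟨m.1 + α, h⟩]
  · simp [shift]
  · intro n _ hn
    rw [shift, Matrix.of_apply, if_neg fun h' => hn (Subtype.ext h'), zero_mul]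
  · simp

lemma mul_shift_apply (M : FnMat N p) (α : Fin N → ℕ) (m r : multiIndices N p)
    {n : Fin N → ℕ} (h : r.1 = n + α) (hn : n ∈ multiIndices N p) :
    (M * shift p α) m r = M m ⟨n, hn⟩ := by
  rw [Matrix.mul_apply, Finset.sum_eq_single ⟨n, hn⟩]
  · simp [shift, h]
  · intro n' _ hn'
    rw [shift, Matrix.of_apply, if_neg fun h' => hn' (Subtype.ext (add_right_cancel (h'.symm.trans h))),
      mul_zero]
  · simp

lemma mul_shift_apply_eq_zero (M : FnMat N p) (α : Fin N → ℕ) (m r : multiIndices N p)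
    (h : ¬ α ≤ r.1) : (M * shift p α) m r = 0 := by
  rw [Matrix.mul_apply]
  refine Finset.sum_eq_zero fun n' _ => ?_
  rw [shift, Matrix.of_apply, if_neg fun h' : r.1 = n'.1 + α => h (h' ▸ le_add_self), mul_zero]

/-- The commutator of `∂_μ` with multiplication on jets, away from the truncation. -/
lemma jetRed_mul_shift_mul (φ ψ : Fn N) (μ : Fin N) :
    jetRed p φ * (shift p (Pi.single μ 1) * jet p ψ) =
      jetRed p φ * (jet p ψ * shift p (Pi.single μ 1)) + jetRed p φ * jet p (Fn.pd μ ψ) := by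
  rw [← mul_add]
  ext1 m r
  rw [Matrix.mul_apply, Matrix.mul_apply]
  refine Finset.sum_congr rfl fun n _ => ?_
  by_cases h : n.1 < m.1
  · congr 1
    -- Since n < m and m has length at most p, there is room for one more derivative.
    have hn : n.1 + Pi.single μ 1 ∈ multiIndices N p := by
      rw [mem_multiIndices]
      have h1 := mem_multiIndices.1 m.2
      have h2 : ∑ ν, n.1 ν < ∑ ν, m.1 ν := by
        obtain ⟨hle, i, hi⟩ := Pi.lt_def.1 h
        exact Finset.sum_lt_sum (fun ν _ => hle ν) ⟨i, Finset.mem_univ i, hi⟩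
      simp only [Pi.add_apply, Finset.sum_add_distrib, Finset.sum_pi_single', Finset.mem_univ,
        if_true]
      omega
    rw [shift_mul_apply _ _ _ _ hn, Matrix.add_apply, jet_apply, jet_apply]
    by_cases hr : r.1 μ = 0
    · rw [leib_add_single_of_eq_zero _ _ hr, mul_shift_apply_eq_zero, zero_add]
      intro h'
      simpa [hr] using h' μ
    · have hr' : r.1 = r.1 - Pi.single μ 1 + Pi.single μ 1 := (sub_single_add_single hr).symm
      rw [mul_shift_apply _ _ _ _ hr' (mem_multiIndices_of_le r.2 tsub_le_self), jet_apply]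
      simp only
      conv_lhs => rw [hr', leib_add_single]
      rw [← hr', add_comm]
  · rw [jetRed_apply_eq_zero φ h, zero_mul, zero_mul]

lemma trace_jet (φ : Fn N) : (jet p φ).trace = ((N + p).choose N : ℂ) • φ := by
  have h := sum_multiChoose (p := p) (0 : Fin N → ℕ)
  simp only [Pi.zero_apply, Finset.sum_const_zero, add_zero] at h
  rw [Matrix.trace, ← h, Finset.sum_smul]
  refine Eq.trans ?_ (Finset.sum_coe_sort (multiIndices N p) fun m => multiChoose m 0 • φ)
  refine Finset.sum_congr rfl fun m _ => ?_
  rw [Matrix.diag_apply, jet_apply, leib_self]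
  simp [multiChoose]

/-- The diagonal entry at m ≥ α is the entry of `jetRed φ` at (m, m - α), a binomial coefficient
times ∂_α φ, and the coefficients are summed by `sum_multiChoose`. For α = 0 one would meet the
diagonal, where `jetRed` vanishes. -/
lemma trace_jetRed_shift (φ : Fn N) {α : Fin N → ℕ} (hα : α ≠ 0) :
    (jetRed p φ * shift p α).trace =
      ((N + p).choose (N + ∑ μ, α μ) : ℂ) • Fn.pdMulti α φ := by
  rw [Matrix.trace, ← sum_multiChoose, Finset.sum_smul]
  refine Eq.trans ?_ (Finset.sum_coe_sort (multiIndices N p) fun m =>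
    multiChoose m α • Fn.pdMulti α φ)
  refine Finset.sum_congr rfl fun m _ => ?_
  rw [Matrix.diag_apply]
  by_cases h : α ≤ m.1
  · rw [mul_shift_apply _ _ _ _ (tsub_add_cancel_of_le h).symm
      (mem_multiIndices_of_le m.2 tsub_le_self), jetRed_eq, Matrix.sub_apply, jet_apply,
      Matrix.smul_apply, Matrix.one_apply_ne, smul_zero, sub_zero, leib, multiChoose_sub h,
      tsub_tsub_cancel_of_le h]
    intro e
    have e' : m.1 = m.1 - α := congrArg Subtype.val e
    refine hα ?_
    funext μ
    have h1 : m.1 μ = m.1 μ - α μ := congrFun e' μ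
    have h2 : α μ ≤ m.1 μ := h μ
    change α μ = 0
    omega
  · rw [mul_shift_apply_eq_zero _ _ _ _ h, multiChoose_eq_zero h, zero_smul]

end Jets

/-! ### Vector fields on jets and their traces -/

section JetFlow

variable {N p : ℕ}

/-- The action of a vector field on jets along the trajectory. -/
def jetFlow (p : ℕ) (ξ : Fin N → Fn N) : FnMat N p :=
  ∑ μ, jetRed p (ξ μ) * shift p (Pi.single μ 1)

lemma jetRed_mul_shift_jetRed (φ ψ : Fn N) (μ : Fin N) :
    jetRed p φ * (shift p (Pi.single μ 1) * jetRed p ψ) =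
      jetRed p φ * (jetRed p ψ * shift p (Pi.single μ 1)) + jetRed p φ * jet p (Fn.pd μ ψ) := by
  rw [jetRed_eq ψ, mul_sub, mul_sub, jetRed_mul_shift_mul, sub_mul, mul_sub, mul_smul_comm, mul_one,
    smul_mul_assoc, one_mul, sub_add_eq_add_sub]

lemma jetRed_jet_commute (φ ψ : Fn N) : jetRed p φ * jet p ψ = jet p ψ * jetRed p φ := by
  rw [jetRed_mul_jet, jet_mul_jetRed, mul_comm]

/-- The jets of ξ^μ and φ commute, so only the commutator of the shift with `jet φ`, namely the jet
of ∂_μ φ, survives. The transport term with undifferentiated ξ^μ is later cancelled by the flow of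
ξ. -/
lemma jetFlow_jet (ξ : Fin N → Fn N) (φ : Fn N) :
    jetFlow p ξ * jet p φ - jet p φ * jetFlow p ξ =
      jet p (∑ μ, ξ μ * Fn.pd μ φ) - ∑ μ, ξ μ • jet p (Fn.pd μ φ) := by
  rw [jetFlow, Finset.sum_mul, Finset.mul_sum, ← Finset.sum_sub_distrib, map_sum,
    ← Finset.sum_sub_distrib]
  refine Finset.sum_congr rfl fun μ _ => ?_
  rw [mul_assoc, jetRed_mul_shift_mul, ← mul_assoc, ← mul_assoc, jetRed_jet_commute,
    add_sub_cancel_left, jet_mul, jetRed_eq, sub_mul, smul_mul_assoc, one_mul]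

lemma jetFlow_mul_jetFlow (ξ η : Fin N → Fn N) :
    jetFlow p ξ * jetFlow p η = ∑ μ, ∑ ν,
      (jetRed p (ξ μ) * jetRed p (η ν) * shift p (Pi.single μ 1 + Pi.single ν 1) +
        (jetRed p (ξ μ * Fn.pd μ (η ν)) - ξ μ • jetRed p (Fn.pd μ (η ν))) *
          shift p (Pi.single ν 1)) := by
  rw [jetFlow, jetFlow, Finset.sum_mul_sum]
  refine Finset.sum_congr rfl fun μ _ => Finset.sum_congr rfl fun ν _ => ?_
  rw [mul_assoc, ← mul_assoc (shift p _), ← mul_assoc, jetRed_mul_shift_jetRed, add_mul,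
    jetRed_mul_jet, ← shift_mul]
  simp only [mul_assoc]

lemma jetFlow_sub (ξ η : Fin N → Fn N) :
    jetFlow p (fun μ => ξ μ - η μ) = jetFlow p ξ - jetFlow p η := by
  simp only [jetFlow, map_sub, sub_mul, Finset.sum_sub_distrib]

lemma jetFlow_act (ξ η : Fin N → Fn N) :
    ∑ μ, ∑ ν, (jetRed p (ξ μ * Fn.pd μ (η ν)) - ξ μ • jetRed p (Fn.pd μ (η ν))) *
      shift p (Pi.single ν 1) =
    jetFlow p (fun ν => ∑ μ, ξ μ * Fn.pd μ (η ν)) -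
      ∑ μ, ξ μ • jetFlow p (fun ν => Fn.pd μ (η ν)) := by
  simp only [jetFlow, map_sum, Finset.sum_mul, Finset.smul_sum]
  rw [Finset.sum_comm (f := fun ν μ => jetRed p (ξ μ * Fn.pd μ (η ν)) * _),
    ← Finset.sum_sub_distrib]
  refine Finset.sum_congr rfl fun μ _ => ?_
  rw [← Finset.sum_sub_distrib]
  refine Finset.sum_congr rfl fun ν _ => ?_
  rw [sub_mul, smul_mul_assoc]

/-- The part with two shifts is symmetric under exchange of ξ and η and cancels. The part with one
shift gives the bracket of vector fields, up to transport terms as in `jetFlow_jet`. -/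
lemma jetFlow_jetFlow (ξ η : Fin N → Fn N) :
    jetFlow p ξ * jetFlow p η - jetFlow p η * jetFlow p ξ =
      jetFlow p (vfBracket ξ η) - ∑ μ, ξ μ • jetFlow p (fun ν => Fn.pd μ (η ν)) +
        ∑ μ, η μ • jetFlow p (fun ν => Fn.pd μ (ξ ν)) := by
  have hb : vfBracket ξ η =
      fun ν => (∑ μ, ξ μ * Fn.pd μ (η ν)) - ∑ μ, η μ * Fn.pd μ (ξ ν) := by
    funext ν
    rw [vfBracket, Finset.sum_sub_distrib]
  have hs : ∑ μ, ∑ ν, jetRed p (ξ μ) * jetRed p (η ν) * shift p (Pi.single μ 1 + Pi.single ν 1) =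
      ∑ μ, ∑ ν, jetRed p (η μ) * jetRed p (ξ ν) * shift p (Pi.single μ 1 + Pi.single ν 1) := by
    rw [Finset.sum_comm]
    refine Finset.sum_congr rfl fun ν _ => Finset.sum_congr rfl fun μ _ => ?_
    rw [jetRed_commute, add_comm (Pi.single μ 1)]
  rw [jetFlow_mul_jetFlow, jetFlow_mul_jetFlow]
  simp only [Finset.sum_add_distrib]
  rw [jetFlow_act, jetFlow_act, hs, hb, jetFlow_sub]
  abel

lemma map_pd_jet (ρ : Fin N) (φ : Fn N) : (jet p φ).map (Fn.pd ρ) = jet p (Fn.pd ρ φ) := by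
  ext1 m n
  rw [Matrix.map_apply, jet_apply, pd_leib, jet_apply]

lemma map_pd_jetRed (ρ : Fin N) (φ : Fn N) :
    (jetRed p φ).map (Fn.pd ρ) = jetRed p (Fn.pd ρ φ) := by
  rw [jetRed_eq, jetRed_eq, ← map_pd_jet]
  ext1 m n
  rw [Matrix.map_apply, Matrix.sub_apply, Matrix.sub_apply, map_sub, Matrix.map_apply,
    Matrix.smul_apply, Matrix.smul_apply, Matrix.one_apply]
  split_ifs <;> simp

lemma map_pd_mul_shift (ρ : Fin N) (M : FnMat N p) (α : Fin N → ℕ) :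
    (M * shift p α).map (Fn.pd ρ) = M.map (Fn.pd ρ) * shift p α := by
  ext1 m n
  rw [Matrix.map_apply, Matrix.mul_apply, Matrix.mul_apply, map_sum]
  refine Finset.sum_congr rfl fun r _ => ?_
  rw [shift, Matrix.of_apply, Matrix.map_apply]
  split_ifs <;> simp

lemma map_pd_jetFlow (ρ : Fin N) (ξ : Fin N → Fn N) :
    (jetFlow p ξ).map (Fn.pd ρ) = jetFlow p (fun μ => Fn.pd ρ (ξ μ)) := by
  simp only [jetFlow, ← map_pd_jetRed, ← map_pd_mul_shift]
  ext1 m n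
  simp only [Matrix.map_apply, Matrix.sum_apply, map_sum]

lemma trace_jetRed_shift_single (φ : Fn N) (μ : Fin N) :
    (jetRed p φ * shift p (Pi.single μ 1)).trace = ((N + p).choose (N + 1) : ℂ) • Fn.pd μ φ := by
  rw [trace_jetRed_shift φ (by simp)]
  have h := Fn.pdMulti_add_single 0 μ φ
  rw [zero_add, Fn.pdMulti_zero, Module.End.one_apply] at h
  rw [h]
  simp

lemma trace_jetRed_shift_pair (φ : Fn N) (μ ν : Fin N) :
    (jetRed p φ * shift p (Pi.single μ 1 + Pi.single ν 1)).trace =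
      ((N + p).choose (N + 2) : ℂ) • Fn.pd μ (Fn.pd ν φ) := by
  rw [trace_jetRed_shift φ fun h => by simpa using congrFun h μ, Fn.pdMulti_add_single]
  have h := Fn.pdMulti_add_single 0 μ (Fn.pd ν φ)
  rw [zero_add, Fn.pdMulti_zero, Module.End.one_apply] at h
  rw [h]
  simp [Finset.sum_add_distrib]

lemma trace_jetFlow (ξ : Fin N → Fn N) :
    (jetFlow p ξ).trace = ((N + p).choose (N + 1) : ℂ) • ∑ μ, Fn.pd μ (ξ μ) := by
  rw [jetFlow, Matrix.trace_sum, Finset.smul_sum]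
  exact Finset.sum_congr rfl fun μ _ => trace_jetRed_shift_single _ _

lemma trace_jetFlow_mul_jet (ξ : Fin N → Fn N) (φ : Fn N) :
    (jetFlow p ξ * jet p φ).trace =
      ((N + p).choose (N + 1) : ℂ) • ((∑ μ, Fn.pd μ (ξ μ)) * φ) := by
  rw [Matrix.trace_mul_comm, jetFlow, Finset.mul_sum, Matrix.trace_sum, Finset.sum_mul,
    Finset.smul_sum]
  refine Finset.sum_congr rfl fun μ _ => ?_
  rw [← mul_assoc, jet_mul_jetRed, sub_mul, Matrix.trace_sub, smul_mul_assoc, Matrix.trace_smul,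
    trace_jetRed_shift_single, trace_jetRed_shift_single, Fn.pd_mul, smul_eq_mul, mul_smul_comm,
    ← smul_sub]
  congr 1
  ring

/-- The part with two shifts contributes the binomial N+p over N+2 to both contractions of first
derivatives; the part with one shift adds N+p over N+1 to the crossed contraction, and Pascal's rule
combines the two there. -/
lemma trace_jetFlow_mul_jetFlow (ξ η : Fin N → Fn N) :
    (jetFlow p ξ * jetFlow p η).trace = ∑ μ, ∑ ν,
      (((N + p + 1).choose (N + 2) : ℂ) • (Fn.pd ν (ξ μ) * Fn.pd μ (η ν)) +
        ((N + p).choose (N + 2) : ℂ) • (Fn.pd μ (ξ μ) * Fn.pd ν (η ν))) := by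
  rw [jetFlow_mul_jetFlow, Matrix.trace_sum]
  refine Finset.sum_congr rfl fun μ _ => ?_
  rw [Matrix.trace_sum]
  refine Finset.sum_congr rfl fun ν _ => ?_
  rw [jetRed_mul_jetRed]
  simp only [sub_mul, Matrix.trace_add, Matrix.trace_sub, smul_mul_assoc, Matrix.trace_smul,
    trace_jetRed_shift_pair, trace_jetRed_shift_single, Fn.pd_mul, map_add, smul_eq_mul,
    Nat.choose_succ_succ (N + p) (N + 1), Nat.cast_add, add_smul, mul_smul_comm]
  simp only [Algebra.smul_def]
  ring

lemma trace_jet_mul_jet (φ ψ : Fn N) :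
    (jet p φ * jet p ψ).trace = ((N + p).choose N : ℂ) • (φ * ψ) := by
  rw [← jet_mul, trace_jet]

end JetFlow

/-! ### Currents with matrix coefficients -/

section JetCurrents

variable {g : Type*} [LieRing g] [LieAlgebra ℂ g] {N p : ℕ}

lemma matForm_single (k : LinearMap.BilinForm ℂ (Env g N)) (m n r s : multiIndices N p)
    (u u' : Env g N) : matForm g N p k (Matrix.single m n u) (Matrix.single r s u') =
      if n = r ∧ m = s then k u u' else 0 := by
  simp only [matForm, LinearMap.sum_apply, LinearMap.compl₁₂_apply, Matrix.entryLinearMap_apply]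
  rw [Finset.sum_eq_single m, Finset.sum_eq_single n]
  · rw [Matrix.single_apply_same]
    by_cases h : n = r ∧ m = s
    · rw [if_pos h, h.1, h.2, Matrix.single_apply_same]
    · rw [if_neg h, Matrix.single_apply_of_ne _ _ _ _ _ (fun h' => h ⟨h'.1.symm, h'.2.symm⟩), map_zero]
  · intro n' _ hn
    rw [Matrix.single_apply_of_ne _ _ _ _ _ (fun h' => hn h'.2.symm), map_zero,
      LinearMap.zero_apply]
  · simp
  · intro m' _ hm
    refine Finset.sum_eq_zero fun n' _ => ?_
    rw [Matrix.single_apply_of_ne _ _ _ _ _ (fun h' => hm h'.1.symm), map_zero,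
      LinearMap.zero_apply]
  · simp

lemma matFunctional_single (d : Env g N →ₗ[ℂ] ℂ) (m n : multiIndices N p) (u : Env g N) :
    matFunctional g N p d (Matrix.single m n u) = if m = n then d u else 0 := by
  rw [matFunctional, LinearMap.comp_apply, Matrix.traceLinearMap_apply]
  split_ifs with h
  · rw [h, Matrix.trace_single_eq_same]
  · rw [Matrix.trace_single_eq_of_ne _ _ _ h, map_zero]

variable {V : Type*} [AddCommGroup V] [Module ℂ V]

variable (V) in
/-- The operator `∫ q̇^ρ(t) φ(q(t)) dt` as a linear function of `φ`. -/
def trajectoryMap (ρ : Fin N) : Fn N →ₗ[ℂ] Module.End ℂ (Carrier N V) where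
  toFun := trajectoryIntegral (fnField V) ρ
  map_add' φ ψ := by
    have h : fnField V (φ + ψ) = fnField V φ + fnField V ψ := (fnFieldLinear V).map_add φ ψ
    simp only [trajectoryIntegral, OpField.integral, h]
    rw [OpField.mul_add (ann_fnField _).dot (ann_fnField φ) (ann_fnField ψ)
      (fcomm_fnField _ _).dot_left (fcomm_fnField _ _).dot_left, Pi.add_apply, smul_add]
  map_smul' a φ := by
    have h : fnField V (a • φ) = a • fnField V φ := (fnFieldLinear V).map_smul a φ
    simp only [trajectoryIntegral, OpField.integral, h, RingHom.id_apply]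
    rw [OpField.mul_smul (ann_fnField _).dot (ann_fnField φ) (fcomm_fnField _ _).dot_left,
      Pi.smul_apply, smul_comm]

variable (V) in
/-- The operator `∫ f(t) φ(q(t)) dt` as a linear function of `φ`. -/
def smearMap (f : Trig) : Fn N →ₗ[ℂ] Module.End ℂ (Carrier N V) where
  toFun φ := (OpField.smear f (fnField V φ)).integral
  map_add' φ ψ := by
    have h : fnField V (φ + ψ) = fnField V φ + fnField V ψ := (fnFieldLinear V).map_add φ ψ
    simp only [OpField.smear_eq_mul, OpField.integral, h]
    rw [OpField.mul_add (OpField.ann_scalar f) (ann_fnField φ) (ann_fnField ψ)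
      (OpField.fcomm_scalar_left _ _) (OpField.fcomm_scalar_left _ _), Pi.add_apply, smul_add]
  map_smul' a φ := by
    have h : fnField V (a • φ) = a • fnField V φ := (fnFieldLinear V).map_smul a φ
    simp only [OpField.smear_eq_mul, OpField.integral, h, RingHom.id_apply]
    rw [OpField.mul_smul (OpField.ann_scalar f) (ann_fnField φ) (OpField.fcomm_scalar_left _ _),
      Pi.smul_apply, smul_comm]

variable (V) in
/-- The operator `(1/2πi) ∫ q̇^ρ(t) F_ρ(q(t)) dt`. -/
def anomaly : (Fin N → Fn N) →ₗ[ℂ] Module.End ℂ (Carrier N V) :=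
  (1 / (2 * Real.pi * Complex.I) : ℂ) • ∑ ρ : Fin N,
    trajectoryMap V ρ ∘ₗ (LinearMap.proj ρ : (Fin N → Fn N) →ₗ[ℂ] Fn N)

lemma anomaly_apply (F : Fin N → Fn N) : anomaly V F =
    (1 / (2 * Real.pi * Complex.I) : ℂ) • ∑ ρ, trajectoryIntegral (fnField V) ρ (F ρ) := by
  rw [anomaly, LinearMap.smul_apply, LinearMap.sum_apply]
  rfl

lemma neg_I_smul_dot_fnField_mul (φ ψ : Fn N) :
    (-Complex.I) • OpField.mul (fnField V φ).dot (fnField V ψ) 0 =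
      anomaly V fun ρ => Fn.pd ρ φ * ψ := by
  rw [anomaly_apply, dot_fnField_mul, Finset.sum_apply]
  simp only [trajectoryIntegral, OpField.integral]
  rw [← Finset.smul_sum, smul_smul]
  congr 1
  have : (Real.pi : ℂ) ≠ 0 := Complex.ofReal_ne_zero.2 Real.pi_ne_zero
  have hI := Complex.I_ne_zero
  field_simp
  exact Complex.I_sq.symm ▸ by ring

variable {K : CentralData g N p} [LieRingModule (VirKM K) V] [LieModule ℂ (VirKM K) V]

/-- The current `∫ Σ_{m,n} M_{mn}(q(t)) I^{m A}_n(t) dt` with `u = I^A`, for a matrix `M` of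
functions. -/
def jetCurrent (hV : IsSmoothModule K V) :
    FnMat N p →ₗ[ℂ] Env g N →ₗ[ℂ] Module.End ℂ (Carrier N V) :=
  ∑ m, ∑ n, (pairingMap hV).compl₁₂ (Matrix.entryLinearMap ℂ (Fn N) m n)
    (Matrix.singleLinearMap ℂ m n)

lemma jetCurrent_apply (hV : IsSmoothModule K V) (M : FnMat N p) (u : Env g N) :
    jetCurrent hV M u = ∑ m, ∑ n, pairing K V (M m n) (Matrix.single m n u) := by
  simp only [jetCurrent, LinearMap.sum_apply]
  rfl

lemma jetCurrent_single (hV : IsSmoothModule K V) (m n : multiIndices N p) (φ : Fn N)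
    (u : Env g N) :
    jetCurrent hV (Matrix.single m n φ) u = pairing K V φ (Matrix.single m n u) := by
  rw [jetCurrent_apply, Finset.sum_eq_single m, Finset.sum_eq_single n]
  · rw [Matrix.single_apply_same]
  · intro n' _ hn
    rw [Matrix.single_apply_of_ne _ _ _ _ _ (fun h' => hn h'.2.symm), ← pairingMap_apply hV,
      map_zero, LinearMap.zero_apply]
  · simp
  · intro m' _ hm
    refine Finset.sum_eq_zero fun n' _ => ?_
    rw [Matrix.single_apply_of_ne _ _ _ _ _ (fun h' => hm h'.1.symm), ← pairingMap_apply hV,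
      map_zero, LinearMap.zero_apply]
  · simp

/-- The functions `tr (∂_ρ M M')` of the index `ρ`. -/
def cocycle (M M' : FnMat N p) (ρ : Fin N) : Fn N := (M.map (Fn.pd ρ) * M').trace

lemma cocycle_add_left (M₁ M₂ M' : FnMat N p) :
    cocycle (M₁ + M₂) M' = cocycle M₁ M' + cocycle M₂ M' := by
  funext ρ
  rw [cocycle, Matrix.map_add _ (map_add _), add_mul, Matrix.trace_add]
  rfl

lemma cocycle_add_right (M M₁ M₂ : FnMat N p) :
    cocycle M (M₁ + M₂) = cocycle M M₁ + cocycle M M₂ := by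
  funext ρ
  rw [cocycle, mul_add, Matrix.trace_add]
  rfl

lemma cocycle_single (m n r s : multiIndices N p) (φ ψ : Fn N) :
    cocycle (Matrix.single m n φ) (Matrix.single r s ψ) =
      if n = r ∧ m = s then fun ρ => Fn.pd ρ φ * ψ else 0 := by
  funext ρ
  rw [cocycle, Matrix.map_single]
  by_cases h : n = r
  · subst h
    rw [Matrix.single_mul_single_same]
    by_cases h' : m = s
    · rw [if_pos ⟨rfl, h'⟩, h', Matrix.trace_single_eq_same]
    · rw [if_neg fun h => h' h.2, Matrix.trace_single_eq_of_ne _ _ _ h']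
      rfl
  · rw [if_neg fun h' => h h'.1, Matrix.single_mul_single_of_ne _ _ _ _ h, Matrix.trace_zero]
    rfl

lemma commutator_add_left {R : Type*} [Ring R] {A A' B X X' Y Y' Z Z' : R}
    (h : A * B - B * A = X - Y - Z) (h' : A' * B - B * A' = X' - Y' - Z') :
    (A + A') * B - B * (A + A') = (X + X') - (Y + Y') - (Z + Z') := by
  rw [add_mul, mul_add, add_sub_add_comm, h, h']
  abel

lemma commutator_add_right {R : Type*} [Ring R] {A B B' X X' Y Y' Z Z' : R}
    (h : A * B - B * A = X - Y - Z) (h' : A * B' - B' * A = X' - Y' - Z') :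
    A * (B + B') - (B + B') * A = (X + X') - (Y + Y') - (Z + Z') := by
  rw [add_mul, mul_add, add_sub_add_comm, h, h']
  abel

/-- Both sides are biadditive in M and M', so matrix units suffice, where this is
`pairing_commutator`. The functions commute, hence the order of factors only matters for the units
and in the enveloping algebra. -/
lemma jetCurrent_commutator (hV : IsSmoothModule K V) (M M' : FnMat N p) (u u' : Env g N) :
    jetCurrent hV M u * jetCurrent hV M' u' - jetCurrent hV M' u' * jetCurrent hV M u =
      jetCurrent hV (M * M') (u * u') - jetCurrent hV (M' * M) (u' * u) -
        K.k u u' • anomaly V (cocycle M M') := by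
  induction M using Matrix.induction_on' with
  | h_zero =>
    have : cocycle (0 : FnMat N p) M' = 0 := by
      funext ρ
      rw [cocycle, Matrix.map_zero _ (map_zero _), zero_mul, Matrix.trace_zero]
      rfl
    rw [this, zero_mul, mul_zero]
    simp only [map_zero, LinearMap.zero_apply, zero_mul, mul_zero, smul_zero, sub_zero]
  | h_add M₁ M₂ h₁ h₂ =>
    rw [cocycle_add_left, add_mul, mul_add]
    simp only [map_add, LinearMap.add_apply, smul_add]
    exact commutator_add_left h₁ h₂
  | h_std_basis m n φ =>
    induction M' using Matrix.induction_on' with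
    | h_zero =>
      have : cocycle (Matrix.single m n φ) (0 : FnMat N p) = 0 := by
        funext ρ
        rw [cocycle, mul_zero, Matrix.trace_zero]
        rfl
      rw [this, zero_mul, mul_zero]
      simp only [map_zero, LinearMap.zero_apply, zero_mul, mul_zero, smul_zero, sub_zero]
    | h_add M₁ M₂ h₁ h₂ =>
      rw [cocycle_add_right, add_mul, mul_add]
      simp only [map_add, LinearMap.add_apply, smul_add]
      exact commutator_add_right h₁ h₂
    | h_std_basis r s ψ =>
      have hp : ∀ (a b c d : multiIndices N p) (α β : Fn N) (v w : Env g N),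
          pairing K V (α * β) (Matrix.single a b v * Matrix.single c d w) =
            jetCurrent hV (Matrix.single a b α * Matrix.single c d β) (v * w) := by
        intro a b c d α β v w
        by_cases h : b = c
        · subst h
          rw [Matrix.single_mul_single_same, Matrix.single_mul_single_same, jetCurrent_single]
        · rw [Matrix.single_mul_single_of_ne _ _ _ _ h, Matrix.single_mul_single_of_ne _ _ _ _ h,
            ← pairingMap_apply hV, map_zero, map_zero, LinearMap.zero_apply]
      rw [jetCurrent_single, jetCurrent_single, pairing_commutator hV, ← hp, ← hp, mul_comm ψ φ,
        ← pairingMap_apply hV, map_sub, smul_comm, ← anomaly_apply fun ρ => Fn.pd ρ φ * ψ,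
        matForm_single, cocycle_single]
      congr 1
      split_ifs
      · rfl
      · rw [zero_smul, map_zero, smul_zero]

lemma vfFlow_jetCurrent (hV : IsSmoothModule K V) (ξ : Fin N → Fn N) (M : FnMat N p)
    (u : Env g N) :
    onFock V (Fock.vfFlow ξ) * jetCurrent hV M u - jetCurrent hV M u * onFock V (Fock.vfFlow ξ) =
      jetCurrent hV (∑ μ, ξ μ • M.map (Fn.pd μ)) u := by
  simp only [jetCurrent_apply, Finset.mul_sum, Finset.sum_mul, ← Finset.sum_sub_distrib,
    vfFlow_pairing hV, Matrix.sum_apply, Matrix.smul_apply, Matrix.map_apply, smul_eq_mul]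

lemma dilation_jetCurrent (hV : IsSmoothModule K V) (f : Trig) (M : FnMat N p) (u : Env g N) :
    dilation K V f * jetCurrent hV M u - jetCurrent hV M u * dilation K V f =
      (K.d u / (4 * Real.pi * Complex.I)) •
        (OpField.smear (f.dot.dot - Complex.I • f.dot) (fnField V M.trace)).integral := by
  have h : (OpField.smear (f.dot.dot - Complex.I • f.dot) (fnField V M.trace)).integral =
      ∑ m, smearMap V (f.dot.dot - Complex.I • f.dot) (M m m) :=
    map_sum (smearMap V (f.dot.dot - Complex.I • f.dot)) _ _
  rw [h, Finset.smul_sum, jetCurrent_apply, Finset.mul_sum, Finset.sum_mul, ← Finset.sum_sub_distrib]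
  refine Finset.sum_congr rfl fun m _ => ?_
  rw [Finset.mul_sum, Finset.sum_mul, ← Finset.sum_sub_distrib]
  simp only [dilation_pairing hV, matFunctional_single]
  rw [Finset.sum_eq_single m]
  · rw [if_pos rfl]
    rfl
  · intro n _ hn
    rw [if_neg (Ne.symm hn), zero_div, zero_smul]
  · simp

end JetCurrents

/-! ### The generators in terms of jets -/

section Generators

variable {g : Type*} [LieRing g] [LieAlgebra ℂ g] {N p : ℕ} {K : CentralData g N p}
  {V : Type*} [AddCommGroup V] [Module ℂ V] [LieRingModule (VirKM K) V] [LieModule ℂ (VirKM K) V]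

lemma gen_eq_single (m n : multiIndices N p) (u : Env g N) :
    gen p m.1 n.1 u = Matrix.single m n u := by
  ext1 a b
  simp only [gen, Matrix.of_apply, Matrix.single_apply, ← Subtype.ext_iff, eq_comm]

lemma gen_eq_sum (m : multiIndices N p) (n : Fin N → ℕ) (u : Env g N) :
    gen p m.1 n u = ∑ r : multiIndices N p, if r.1 = n then Matrix.single m r u else 0 := by
  by_cases h : n ∈ multiIndices N p
  · rw [Finset.sum_eq_single ⟨n, h⟩]
    · rw [if_pos rfl, ← gen_eq_single]
    · intro r _ hr
      rw [if_neg fun h' => hr (Subtype.ext h')]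
    · simp
  · have hr : ∀ r : multiIndices N p, r.1 ≠ n := fun r hr => h (hr ▸ r.2)
    simp only [hr, if_false, Finset.sum_const_zero]
    ext1 a b
    rw [gen, Matrix.of_apply, if_neg fun h' => hr b h'.2]
    rfl

/-- The shift on the right raises the lower index of the current by α; when n + α is too long, both
sides drop the term. -/
lemma jetCurrent_mul_shift (hV : IsSmoothModule K V) (M : FnMat N p) (α : Fin N → ℕ)
    (u : Env g N) : jetCurrent hV (M * shift p α) u =
      ∑ m, ∑ n, pairing K V (M m n) (gen p m.1 (n.1 + α) u) := by
  rw [jetCurrent_apply]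
  refine Finset.sum_congr rfl fun m _ => ?_
  simp only [gen_eq_sum, Matrix.mul_apply, ← pairingMap_apply hV, map_sum, LinearMap.sum_apply]
  rw [Finset.sum_comm]
  refine Finset.sum_congr rfl fun n _ => Finset.sum_congr rfl fun r _ => ?_
  rw [shift, Matrix.of_apply]
  split_ifs
  · rw [mul_one]
  · rw [mul_zero, map_zero, map_zero, LinearMap.zero_apply]

lemma pairing_leib (hV : IsSmoothModule K V) (φ : Fn N) (m n : Fin N → ℕ) (M : EnvMat g N p) :
    pairing K V (leib φ m n) M = multiChoose m n • pairing K V (Fn.pdMulti (m - n) φ) M := by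
  rw [leib, ← pairingMap_apply hV, map_smul, LinearMap.smul_apply, pairingMap_apply]

lemma jetCurrent_jet (hV : IsSmoothModule K V) (φ : Fn N) (u : Env g N) :
    jetCurrent hV (jet p φ) u = ∑ m ∈ multiIndices N p, ∑ n ∈ multiIndices N p,
      multiChoose m n • pairing K V (Fn.pdMulti (m - n) φ) (gen p m n u) := by
  rw [jetCurrent_apply, ← Finset.sum_coe_sort (multiIndices N p)]
  refine Finset.sum_congr rfl fun m _ => ?_
  rw [← Finset.sum_coe_sort (multiIndices N p)]
  refine Finset.sum_congr rfl fun n _ => ?_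
  rw [jet_apply, pairing_leib hV, gen_eq_single]

lemma jetCurrent_jet_shift (hV : IsSmoothModule K V) (φ : Fn N) (α : Fin N → ℕ) (u : Env g N) :
    jetCurrent hV (jet p φ * shift p α) u = ∑ m ∈ multiIndices N p, ∑ n ∈ multiIndices N p,
      multiChoose m n • pairing K V (Fn.pdMulti (m - n) φ) (gen p m (n + α) u) := by
  rw [jetCurrent_mul_shift, ← Finset.sum_coe_sort (multiIndices N p)]
  refine Finset.sum_congr rfl fun m _ => ?_
  rw [← Finset.sum_coe_sort (multiIndices N p)]
  refine Finset.sum_congr rfl fun n _ => ?_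
  rw [jet_apply, pairing_leib hV]

lemma jetCurrent_smul_shift (hV : IsSmoothModule K V) (φ : Fn N) (α : Fin N → ℕ) (u : Env g N) :
    jetCurrent hV (φ • shift p α) u =
      pairing K V φ (∑ m ∈ multiIndices N p, gen p m (m + α) u) := by
  rw [← one_mul (shift p α), ← smul_mul_assoc, jetCurrent_mul_shift,
    ← Finset.sum_coe_sort (multiIndices N p), ← pairingMap_apply hV, map_sum]
  refine Finset.sum_congr rfl fun m _ => ?_
  rw [Finset.sum_eq_single m]
  · rw [Matrix.smul_apply, Matrix.one_apply_eq, smul_eq_mul, mul_one, pairingMap_apply]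
  · intro n _ hn
    rw [Matrix.smul_apply, Matrix.one_apply_ne hn.symm, smul_zero, ← pairingMap_apply hV, map_zero,
      LinearMap.zero_apply]
  · simp

lemma gaugeOp_eq (hV : IsSmoothModule K V) {ι : Type*} [Fintype ι] (J : Module.Basis ι ℂ g)
    (X : ι → Fn N) : gaugeOp K V J X = ∑ a, jetCurrent hV (jet p (X a)) (envJ N J a) := by
  simp only [jetCurrent_jet, gaugeOp]
  exact Finset.sum_comm_cycle

lemma tangentOp_eq (hV : IsSmoothModule K V) (ξ : Fin N → Fn N) :
    tangentOp K V ξ = ∑ μ, ∑ ν, jetCurrent hV (jet p (Fn.pd ν (ξ μ))) (envT g ν μ) := by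
  simp only [jetCurrent_jet, tangentOp, Fn.pdMulti_add_single]
  exact Finset.sum_comm_cycle.trans (Finset.sum_congr rfl fun μ _ => Finset.sum_comm_cycle)

/-- The term ξ^μ P_μ subtracted in 𝓛_ξ is the scalar part ξ^μ • 1 that `jetRed` removes from `jet`.
-/
lemma jetCurrent_jetFlow (hV : IsSmoothModule K V) (ξ : Fin N → Fn N) :
    jetCurrent hV (jetFlow p ξ) 1 =
    - ∑ μ, pairing K V (ξ μ) (∑ m ∈ multiIndices N p, gen p m (m + Pi.single μ 1) 1) +
    ∑ m ∈ multiIndices N p, ∑ n ∈ multiIndices N p, ∑ μ,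
      multiChoose m n • pairing K V (Fn.pdMulti (m - n) (ξ μ)) (gen p m (n + Pi.single μ 1) 1) := by
  rw [Finset.sum_comm_cycle, jetFlow, map_sum, LinearMap.sum_apply, neg_add_eq_sub,
    ← Finset.sum_sub_distrib]
  refine Finset.sum_congr rfl fun μ _ => ?_
  rw [jetRed_eq, sub_mul, smul_mul_assoc, one_mul, map_sub, LinearMap.sub_apply,
    jetCurrent_jet_shift, jetCurrent_smul_shift]

variable (V) in
lemma onFock_sum {κ : Type*} (s : Finset κ) (A : κ → Module.End ℂ (Fock N)) :
    onFock V (∑ i ∈ s, A i) = ∑ i ∈ s, onFock V (A i) := map_sum (LinearMap.rTensorHom V) _ _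

/-- The part of `𝓛_ξ` without `T_{dξ}`. -/
def jetLie (hV : IsSmoothModule K V) (ξ : Fin N → Fn N) : Module.End ℂ (Carrier N V) :=
  onFock V (Fock.vfFlow ξ) + jetCurrent hV (jetFlow p ξ) 1

lemma lieOp_eq (hV : IsSmoothModule K V) (ξ : Fin N → Fn N) :
    lieOp K V ξ = jetLie hV ξ +
      ∑ μ, ∑ ν, jetCurrent hV (jet p (Fn.pd ν (ξ μ))) (envT g ν μ) := by
  rw [lieOp, tangentOp_eq hV, jetLie, jetCurrent_jetFlow, Fock.vfFlow, Fock.flow_eq, onFock_sum,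
    ← add_assoc, sub_eq_add_neg]
  exact fun μ => Fock.ann_fn _

lemma repOp_eq (f : Trig) : repOp K V f = dilation K V f := by
  have h : Fock.repField f = (-1 : ℂ) • fun μ : Fin N => OpField.smear f (Fock.qField μ).dot := by
    funext μ n
    exact (end_neg_one_smul _).symm
  have ha : ∀ μ : Fin N, OpField.Ann (OpField.smear f (Fock.qField μ).dot) :=
    fun μ => OpField.ann_smear (Fock.ann_qField μ).dot f
  rw [repOp, dilation, h, Fock.flow_smul ha, Fock.flow_eq ha, ← onFock_sum]
  refine congrArg₂ (· + ·) ?_ rfl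
  refine Eq.trans ?_ (LinearMap.rTensor_smul ..).symm
  exact (end_neg_one_smul _).symm

end Generators

/-! ### Brackets of the jet parts -/

section Brackets

variable {g : Type*} [LieRing g] [LieAlgebra ℂ g] {N p : ℕ} {K : CentralData g N p}
  {V : Type*} [AddCommGroup V] [Module ℂ V] [LieRingModule (VirKM K) V] [LieModule ℂ (VirKM K) V]

/-- The matrix `∂_ν ξ^μ`. -/
def jacobian (ξ : Fin N → Fn N) : Matrix (Fin N) (Fin N) (Fn N) :=
  Matrix.of fun ν μ => Fn.pd ν (ξ μ)

/-- The vector field `∂_ρ ξ`. -/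
def vfPd (ρ : Fin N) (ξ : Fin N → Fn N) : Fin N → Fn N := fun μ => Fn.pd ρ (ξ μ)

lemma map_pd_jacobian (ρ : Fin N) (ξ : Fin N → Fn N) :
    (jacobian ξ).map (Fn.pd ρ) = jacobian (vfPd ρ ξ) := by
  ext1 ν μ
  exact LinearMap.congr_fun (Fn.pd_comm ρ ν).eq (ξ μ)

lemma cocycle_jetFlow (ξ η : Fin N → Fn N) : cocycle (jetFlow p ξ) (jetFlow p η) = fun ρ =>
    ((N + p + 1).choose (N + 2) : ℂ) • (jacobian (vfPd ρ ξ) * jacobian η).trace +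
      ((N + p).choose (N + 2) : ℂ) • ((jacobian (vfPd ρ ξ)).trace * (jacobian η).trace) := by
  funext ρ
  rw [cocycle, map_pd_jetFlow, trace_jetFlow_mul_jetFlow]
  simp only [Finset.sum_add_distrib, ← Finset.smul_sum]
  congr 2
  · rw [Finset.sum_comm]
    rfl
  · rw [← Finset.sum_mul_sum]
    rfl

lemma cocycle_jetFlow_jet (ξ : Fin N → Fn N) (φ : Fn N) : cocycle (jetFlow p ξ) (jet p φ) = fun ρ =>
    ((N + p).choose (N + 1) : ℂ) • ((jacobian (vfPd ρ ξ)).trace * φ) := by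
  funext ρ
  rw [cocycle, map_pd_jetFlow, trace_jetFlow_mul_jet]
  rfl

lemma cocycle_jet (φ ψ : Fn N) : cocycle (jet p φ) (jet p ψ) = fun ρ =>
    ((N + p).choose N : ℂ) • (Fn.pd ρ φ * ψ) := by
  funext ρ
  rw [cocycle, map_pd_jet, trace_jet_mul_jet]

/-- Second derivatives give the transport of one Jacobian along the other field, products of first
derivatives a matrix commutator; the latter matches the bracket of the T^μ_ν. -/
lemma jacobian_vfBracket (ξ η : Fin N → Fn N) : jacobian (vfBracket ξ η) =
    ((∑ κ, ξ κ • (jacobian η).map (Fn.pd κ)) - ∑ κ, η κ • (jacobian ξ).map (Fn.pd κ)) +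
      (jacobian ξ * jacobian η - jacobian η * jacobian ξ) := by
  ext1 ν μ
  simp only [jacobian, vfBracket, Matrix.of_apply, map_sum, map_sub, Fn.pd_mul, Matrix.add_apply,
    Matrix.sub_apply, Matrix.sum_apply, Matrix.smul_apply, Matrix.map_apply, Matrix.mul_apply,
    smul_eq_mul, Finset.sum_sub_distrib, Finset.sum_add_distrib]
  have h : ∀ (κ : Fin N) (φ : Fn N), Fn.pd ν (Fn.pd κ φ) = Fn.pd κ (Fn.pd ν φ) :=
    fun κ φ => LinearMap.congr_fun (Fn.pd_comm ν κ).eq φ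
  simp only [h]
  ring

lemma jetCurrent_sub (hV : IsSmoothModule K V) (M M' : FnMat N p) (u : Env g N) :
    jetCurrent hV (M - M') u = jetCurrent hV M u - jetCurrent hV M' u :=
  ((jetCurrent hV).flip u).map_sub M M'

lemma jetCurrent_add (hV : IsSmoothModule K V) (M M' : FnMat N p) (u : Env g N) :
    jetCurrent hV (M + M') u = jetCurrent hV M u + jetCurrent hV M' u :=
  ((jetCurrent hV).flip u).map_add M M'

lemma smul_eq_neg_smul {M : Type*} [AddCommGroup M] [Module ℂ M] (c : ℂ) {x y : M}
    (h : x + y = 0) : c • x = -(c • y) := by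
  rw [eq_neg_of_add_eq_zero_left h, smul_neg]

/-- By the chain rule the two sides differ by the integral of the derivative of (φψ)(q(t)). -/
lemma anomaly_symm (φ ψ : Fn N) : anomaly V (fun ρ => Fn.pd ρ φ * ψ) =
    -anomaly V (fun ρ => Fn.pd ρ ψ * φ) := by
  rw [← neg_I_smul_dot_fnField_mul, ← neg_I_smul_dot_fnField_mul]
  refine smul_eq_neg_smul (M := Module.End ℂ (Carrier N V)) _ ?_
  have h := congrFun (OpField.dot_mul (ann_fnField (V := V) φ) (ann_fnField ψ)
    (fcomm_fnField φ ψ)) 0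
  rw [OpField.mul_comm (ann_fnField φ) (ann_fnField ψ).dot (fcomm_fnField φ ψ).dot_right] at h
  rw [← Pi.add_apply, ← h, OpField.dot, Int.cast_zero, mul_zero, zero_smul]

lemma commutator_add_add {R : Type*} [Ring R] (a b c d : R) :
    (a + b) * (c + d) - (c + d) * (a + b) =
      (a * c - c * a) + ((a * d - d * a) - (c * b - b * c)) + (b * d - d * b) := by
  noncomm_ring

lemma vfFlow_commutator (ξ η : Fin N → Fn N) :
    onFock V (Fock.vfFlow ξ) * onFock V (Fock.vfFlow η) -
      onFock V (Fock.vfFlow η) * onFock V (Fock.vfFlow ξ) = onFock V (Fock.vfFlow (vfBracket ξ η)) +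
      anomaly V (fun ρ => (jacobian (vfPd ρ ξ) * jacobian η).trace) := by
  refine (rTensor_sub_mul (Fock.vfFlow_vfFlow ξ η)).trans ?_
  refine (LinearMap.rTensor_add ..).trans (congrArg₂ (· + ·) rfl ?_)
  refine (LinearMap.rTensor_smul ..).trans ?_
  have h : (∑ μ, ∑ ν, OpField.mul (Fock.fn (Fn.pd ν (ξ μ))).dot
      (Fock.fn (Fn.pd μ (η ν))) 0).rTensor V = ∑ μ, ∑ ν,
        OpField.mul (fnField V (Fn.pd ν (ξ μ))).dot (fnField V (Fn.pd μ (η ν))) 0 := by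
    refine (onFock_sum V _ _).trans (Finset.sum_congr rfl fun μ _ => ?_)
    exact (onFock_sum V _ _).trans (Finset.sum_congr rfl fun ν _ => onFock_dot_mul ..)
  rw [h]
  simp only [Finset.smul_sum, neg_I_smul_dot_fnField_mul, ← map_sum]
  congr 1
  funext ρ
  simp only [Finset.sum_apply, Matrix.trace, Matrix.diag_apply, Matrix.mul_apply]
  rw [Finset.sum_comm]
  refine Finset.sum_congr rfl fun ν _ => Finset.sum_congr rfl fun μ _ => ?_
  rw [← map_pd_jacobian]
  rfl

lemma add_sub_cancel_aux {M : Type*} [AddCommGroup M] (a b c d e f : M) :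
    a + b + (c - d) + (e - c + d - f) = a + e + (b - f) := by
  abel

/-- The flow of ξ moves the coefficients of `jetFlow η` along ξ, and conversely; this cancels the
transport terms of `jetFlow_jetFlow` and leaves the bracket and two cocycles. -/
lemma jetLie_jetLie (hV : IsSmoothModule K V) (ξ η : Fin N → Fn N) :
    jetLie hV ξ * jetLie hV η - jetLie hV η * jetLie hV ξ = jetLie hV (vfBracket ξ η) +
      (anomaly V (fun ρ => (jacobian (vfPd ρ ξ) * jacobian η).trace) -
        K.k 1 1 • anomaly V (cocycle (jetFlow p ξ) (jetFlow p η))) := by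
  have h2 : ∀ ξ η : Fin N → Fn N, onFock V (Fock.vfFlow ξ) * jetCurrent hV (jetFlow p η) 1 -
      jetCurrent hV (jetFlow p η) 1 * onFock V (Fock.vfFlow ξ) =
      jetCurrent hV (∑ μ, ξ μ • jetFlow p (vfPd μ η)) 1 := fun ξ η => by
    rw [vfFlow_jetCurrent]
    simp only [map_pd_jetFlow]
    rfl
  have h3 := jetCurrent_commutator hV (jetFlow p ξ) (jetFlow p η) 1 1
  rw [mul_one, ← jetCurrent_sub, jetFlow_jetFlow, jetCurrent_add, jetCurrent_sub] at h3
  simp only [jetLie]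
  rw [commutator_add_add, vfFlow_commutator, h2, h2, h3]
  exact add_sub_cancel_aux ..

lemma jetLie_jet (hV : IsSmoothModule K V) (ξ : Fin N → Fn N) (φ : Fn N) (u : Env g N) :
    jetLie hV ξ * jetCurrent hV (jet p φ) u - jetCurrent hV (jet p φ) u * jetLie hV ξ =
      jetCurrent hV (jet p (∑ μ, ξ μ * Fn.pd μ φ)) u -
        (K.k 1 u * (N + p).choose (N + 1)) • anomaly V (fun ρ => (jacobian (vfPd ρ ξ)).trace * φ) := by
  have h1 := vfFlow_jetCurrent hV ξ (jet p φ) u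
  have h2 := jetCurrent_commutator hV (jetFlow p ξ) (jet p φ) 1 u
  simp only [map_pd_jet] at h1
  rw [one_mul, mul_one, ← jetCurrent_sub, jetFlow_jet, jetCurrent_sub, cocycle_jetFlow_jet, ← Pi.smul_def, map_smul, smul_smul] at h2
  rw [jetLie, add_mul, mul_add, add_sub_add_comm, h1, h2, add_comm, sub_add_eq_add_sub,
    sub_add_cancel]

lemma jetCurrent_jet_commutator (hV : IsSmoothModule K V) (φ ψ : Fn N) (u u' : Env g N) :
    jetCurrent hV (jet p φ) u * jetCurrent hV (jet p ψ) u' -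
      jetCurrent hV (jet p ψ) u' * jetCurrent hV (jet p φ) u =
      jetCurrent hV (jet p (φ * ψ)) (u * u' - u' * u) -
        (K.k u u' * (N + p).choose N) • anomaly V (fun ρ => Fn.pd ρ φ * ψ) := by
  rw [jetCurrent_commutator, ← jet_mul, ← jet_mul, mul_comm ψ φ, cocycle_jet, ← Pi.smul_def,
    map_smul, smul_smul, map_sub]

end Brackets

/-! ### The gl(N) part and the bracket of two vector fields -/

section Tangent

variable {g : Type*} [LieRing g] [LieAlgebra ℂ g] {N p : ℕ}

lemma env_commutator (x y : g × Matrix (Fin N) (Fin N) ℂ) :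
    UniversalEnvelopingAlgebra.ι ℂ x * UniversalEnvelopingAlgebra.ι ℂ y -
      UniversalEnvelopingAlgebra.ι ℂ y * UniversalEnvelopingAlgebra.ι ℂ x =
      UniversalEnvelopingAlgebra.ι ℂ ⁅x, y⁆ := by
  rw [LieHom.map_lie, Ring.lie_def]

lemma envT_commutator (ν μ σ τ : Fin N) :
    envT g ν μ * envT g σ τ - envT g σ τ * envT g ν μ =
      (if μ = σ then envT g ν τ else 0) - if τ = ν then envT g σ μ else 0 := by
  have h : ∀ a b c d : Fin N, (if b = c then envT g a d else 0) =
      UniversalEnvelopingAlgebra.ι ℂ ((0 : g), Matrix.single a b (1 : ℂ) * Matrix.single c d 1) := by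
    intro a b c d
    split_ifs with h
    · rw [h, Matrix.single_mul_single_same, one_mul, envT]
    · rw [Matrix.single_mul_single_of_ne _ _ _ _ h]
      exact (map_zero (UniversalEnvelopingAlgebra.ι ℂ)).symm
  rw [h, h, ← map_sub, envT, envT, env_commutator]
  congr 1
  ext1
  · exact (lie_self (0 : g)).trans (sub_self _).symm
  · exact Ring.lie_def _ _

lemma envT_envJ_commutator {ι : Type*} (J : Module.Basis ι ℂ g) (ν μ : Fin N) (a : ι) :
    envT g ν μ * envJ N J a - envJ N J a * envT g ν μ = 0 := by
  rw [envT, envJ, env_commutator]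
  refine (congrArg _ ?_).trans (map_zero (UniversalEnvelopingAlgebra.ι ℂ))
  ext1
  · exact zero_lie _
  · exact lie_zero _

lemma envJ_commutator {ι : Type*} [Fintype ι] (J : Module.Basis ι ℂ g) (a b : ι) :
    envJ N J a * envJ N J b - envJ N J b * envJ N J a =
      ∑ c, J.repr ⁅J a, J b⁆ c • envJ N J c := by
  have h : ∀ x : g, (UniversalEnvelopingAlgebra.ι ℂ ((x, 0) : g × Matrix (Fin N) (Fin N) ℂ) :
      Env g N) = ∑ c, J.repr x c • envJ N J c := fun x => by
    conv_lhs => rw [← J.sum_repr x]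
    exact map_sum ((UniversalEnvelopingAlgebra.ι ℂ :
      g × Matrix (Fin N) (Fin N) ℂ →ₗ⁅ℂ⁆ Env g N).toLinearMap ∘ₗ LinearMap.inl ℂ g _) _ _ |>.trans
      (Finset.sum_congr rfl fun c _ => map_smul ((UniversalEnvelopingAlgebra.ι ℂ :
        g × Matrix (Fin N) (Fin N) ℂ →ₗ⁅ℂ⁆ Env g N).toLinearMap ∘ₗ LinearMap.inl ℂ g _) _ _)
  rw [← h, envJ, envJ, env_commutator]
  congr 1
  ext1
  · rfl
  · exact lie_self _

variable {K : CentralData g N p}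
  {V : Type*} [AddCommGroup V] [Module ℂ V] [LieRingModule (VirKM K) V] [LieModule ℂ (VirKM K) V]

/-- The current `Σ_{m,n} (m choose n) ∂_{m-n} D_ν^μ T^{mν}_{nμ}` for a matrix `D` of functions. -/
def tangentMap (hV : IsSmoothModule K V) :
    Matrix (Fin N) (Fin N) (Fn N) →ₗ[ℂ] Module.End ℂ (Carrier N V) :=
  ∑ μ, ∑ ν, (jetCurrent hV).flip (envT g ν μ) ∘ₗ jet p ∘ₗ Matrix.entryLinearMap ℂ (Fn N) ν μ

lemma tangentMap_apply (hV : IsSmoothModule K V) (D : Matrix (Fin N) (Fin N) (Fn N)) :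
    tangentMap hV D = ∑ μ, ∑ ν, jetCurrent hV (jet p (D ν μ)) (envT g ν μ) := by
  simp only [tangentMap, LinearMap.sum_apply]
  rfl

lemma tangentMap_single (hV : IsSmoothModule K V) (ν μ : Fin N) (φ : Fn N) :
    tangentMap hV (Matrix.single ν μ φ) = jetCurrent hV (jet p φ) (envT g ν μ) := by
  rw [tangentMap_apply, Finset.sum_eq_single μ, Finset.sum_eq_single ν]
  · rw [Matrix.single_apply_same]
  · intro ν' _ hν
    rw [Matrix.single_apply_of_ne _ _ _ _ _ (fun h' => hν h'.1.symm), map_zero, map_zero,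
      LinearMap.zero_apply]
  · exact fun h => absurd (Finset.mem_univ _) h
  · intro μ' _ hμ
    refine Finset.sum_eq_zero fun ν' _ => ?_
    rw [Matrix.single_apply_of_ne _ _ _ _ _ (fun h' => hμ h'.2.symm), map_zero, map_zero,
      LinearMap.zero_apply]
  · exact fun h => absurd (Finset.mem_univ _) h

/-- The functions `a tr (∂_ρ D D') + b tr (∂_ρ D) tr D'` of the index `ρ`. -/
def glCocycle (a b : ℂ) (D D' : Matrix (Fin N) (Fin N) (Fn N)) (ρ : Fin N) : Fn N :=
  a • (D.map (Fn.pd ρ) * D').trace + b • ((D.map (Fn.pd ρ)).trace * D'.trace)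

lemma glCocycle_add_left (a b : ℂ) (D₁ D₂ D' : Matrix (Fin N) (Fin N) (Fn N)) :
    glCocycle a b (D₁ + D₂) D' = glCocycle a b D₁ D' + glCocycle a b D₂ D' := by
  funext ρ
  simp only [glCocycle, Matrix.map_add _ (map_add (Fn.pd ρ)), add_mul, Matrix.trace_add, smul_add,
    Pi.add_apply]
  exact add_add_add_comm ..

lemma glCocycle_add_right (a b : ℂ) (D D₁ D₂ : Matrix (Fin N) (Fin N) (Fn N)) :
    glCocycle a b D (D₁ + D₂) = glCocycle a b D D₁ + glCocycle a b D D₂ := by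
  funext ρ
  simp only [glCocycle, mul_add, Matrix.trace_add, smul_add, Pi.add_apply]
  exact add_add_add_comm ..

lemma glCocycle_single (a b : ℂ) (ν μ σ τ : Fin N) (φ ψ : Fn N) :
    glCocycle a b (Matrix.single ν μ φ) (Matrix.single σ τ ψ) =
      ((if ν = τ ∧ σ = μ then a else 0) + if ν = μ ∧ σ = τ then b else 0) •
        fun ρ => Fn.pd ρ φ * ψ := by
  have ht : ∀ (i j : Fin N) (χ : Fn N), (Matrix.single i j χ).trace = if i = j then χ else 0 := by
    intro i j χ
    split_ifs with h
    · rw [h, Matrix.trace_single_eq_same]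
    · rw [Matrix.trace_single_eq_of_ne _ _ _ h]
  funext ρ
  rw [glCocycle, Matrix.map_single, Pi.smul_apply, add_smul, ht, ht]
  congr 1
  · by_cases h : μ = σ
    · subst h
      rw [Matrix.single_mul_single_same, ht]
      simp only [and_true]
      split_ifs <;> simp
    · rw [Matrix.single_mul_single_of_ne _ _ _ _ h, if_neg fun h' => h h'.2.symm]
      simp
  · by_cases h1 : ν = μ <;> by_cases h2 : σ = τ <;> simp [h1, h2]

lemma tangentMap_commutator (hV : IsSmoothModule K V) {k₁ k₂ : ℂ}
    (hk : ∀ μ ν ρ σ : Fin N, K.k (envT g μ ν) (envT g ρ σ) =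
      (if μ = σ ∧ ρ = ν then k₁ else 0) + (if μ = ν ∧ ρ = σ then k₂ else 0))
    (D D' : Matrix (Fin N) (Fin N) (Fn N)) :
    tangentMap hV D * tangentMap hV D' - tangentMap hV D' * tangentMap hV D =
      tangentMap hV (D * D') - tangentMap hV (D' * D) -
        ((N + p).choose N : ℂ) • anomaly V (glCocycle k₁ k₂ D D') := by
  induction D using Matrix.induction_on' with
  | h_zero =>
    have : glCocycle k₁ k₂ 0 D' = 0 := by
      funext ρ
      simp [glCocycle, Matrix.map_zero _ (map_zero (Fn.pd ρ))]
    rw [this]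
    simp only [map_zero, zero_mul, mul_zero, smul_zero, sub_zero]
  | h_add M₁ M₂ h₁ h₂ =>
    rw [glCocycle_add_left, add_mul, mul_add]
    simp only [map_add, smul_add]
    exact commutator_add_left h₁ h₂
  | h_std_basis ν μ φ =>
    induction D' using Matrix.induction_on' with
    | h_zero =>
      have : glCocycle k₁ k₂ (Matrix.single ν μ φ) 0 = 0 := by
        funext ρ
        simp [glCocycle]
      rw [this]
      simp only [map_zero, zero_mul, mul_zero, smul_zero, sub_zero]
    | h_add M₁ M₂ h₁ h₂ =>
      rw [glCocycle_add_right, add_mul, mul_add]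
      simp only [map_add, smul_add]
      exact commutator_add_right h₁ h₂
    | h_std_basis σ τ ψ =>
      have hp : ∀ (a b c d : Fin N) (α β : Fn N),
          jetCurrent hV (jet p (α * β)) (if b = c then envT g a d else 0) =
            tangentMap hV (Matrix.single a b α * Matrix.single c d β) := by
        intro a b c d α β
        by_cases h : b = c
        · subst h
          rw [if_pos rfl, Matrix.single_mul_single_same, tangentMap_single]
        · rw [Matrix.single_mul_single_of_ne _ _ _ _ h, if_neg h, map_zero, map_zero]
      rw [tangentMap_single, tangentMap_single, jetCurrent_jet_commutator, envT_commutator, hk,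
        glCocycle_single, map_sub, hp, mul_comm φ ψ, hp, map_smul, smul_smul,
        mul_comm ((N + p).choose N : ℂ)]

lemma jetLie_tangentMap (hV : IsSmoothModule K V) {k₃ : ℂ}
    (hk : ∀ μ ν : Fin N, K.k (envT g μ ν) 1 = if μ = ν then k₃ else 0)
    (ξ : Fin N → Fn N) (D : Matrix (Fin N) (Fin N) (Fn N)) :
    jetLie hV ξ * tangentMap hV D - tangentMap hV D * jetLie hV ξ =
      tangentMap hV (∑ κ, ξ κ • D.map (Fn.pd κ)) - (k₃ * (N + p).choose (N + 1)) •
        anomaly V (fun ρ => (jacobian (vfPd ρ ξ)).trace * D.trace) := by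
  have h : anomaly V (fun ρ => (jacobian (vfPd ρ ξ)).trace * D.trace) =
      ∑ μ, anomaly V (fun ρ => (jacobian (vfPd ρ ξ)).trace * D μ μ) := by
    rw [← map_sum]
    congr 1
    funext ρ
    rw [Finset.sum_apply, ← Finset.mul_sum]
    rfl
  rw [h, Finset.smul_sum, tangentMap_apply, tangentMap_apply, Finset.mul_sum, Finset.sum_mul,
    ← Finset.sum_sub_distrib, ← Finset.sum_sub_distrib]
  refine Finset.sum_congr rfl fun μ _ => ?_
  simp only [Finset.mul_sum, Finset.sum_mul, ← Finset.sum_sub_distrib, jetLie_jet]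
  rw [Finset.sum_sub_distrib]
  congr 1
  · simp only [Matrix.sum_apply, Matrix.smul_apply, Matrix.map_apply, smul_eq_mul]
  · rw [Finset.sum_eq_single μ]
    · rw [K.k_symm, hk, if_pos rfl]
    · intro ν _ hν
      rw [K.k_symm, hk, if_neg hν, zero_mul, zero_smul]
    · exact fun h => absurd (Finset.mem_univ _) h

lemma trace_jacobian_vfPd (ρ : Fin N) (ξ : Fin N → Fn N) :
    (jacobian (vfPd ρ ξ)).trace = Fn.pd ρ (jacobian ξ).trace := by
  rw [← map_pd_jacobian, Matrix.trace, Matrix.trace, map_sum]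
  rfl

lemma anomaly_smul_add_smul (a b : ℂ) (F G : Fin N → Fn N) :
    anomaly V (fun ρ => a • F ρ + b • G ρ) = a • anomaly V F + b • anomaly V G := by
  rw [← map_smul, ← map_smul, ← map_add]
  rfl

lemma lieOp_eq_tangentMap (hV : IsSmoothModule K V) (ξ : Fin N → Fn N) :
    lieOp K V ξ = jetLie hV ξ + tangentMap hV (jacobian ξ) := by
  rw [lieOp_eq hV, tangentMap_apply]
  rfl

/-- A and B stand for the cocycles with the trace of the product and the product of the traces of
Jacobians. B is odd under exchange of the two fields, so the cross terms add up to -2c B instead of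
cancelling. -/
lemma lie_bracket_aux {M : Type*} [AddCommGroup M] [Module ℂ M] (L A B t₁ t₂ t₃ t₄ : M)
    (k a b c e k₁ k₂ : ℂ) :
    L + (A - k • (a • A + b • B)) + ((t₁ - c • B) - (t₂ - c • -B)) +
        (t₃ - t₄ - e • (k₁ • A + k₂ • B)) =
      L + ((t₁ - t₂) + (t₃ - t₄)) + ((1 - k₁ * e - k * a) • A + (-k₂ * e - 2 * c - k * b) • B) := by
  module

lemma lieOp_lieOp (hV : IsSmoothModule K V) {k₁ k₂ k₃ : ℂ}
    (hk_TT : ∀ μ ν ρ σ : Fin N, K.k (envT g μ ν) (envT g ρ σ) =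
      (if μ = σ ∧ ρ = ν then k₁ else 0) + (if μ = ν ∧ ρ = σ then k₂ else 0))
    (hk_T : ∀ μ ν : Fin N, K.k (envT g μ ν) 1 = if μ = ν then k₃ else 0)
    (ξ η : Fin N → Fn N) :
    lieOp K V ξ * lieOp K V η - lieOp K V η * lieOp K V ξ = lieOp K V (vfBracket ξ η) +
      ((1 - k₁ * (N + p).choose N - K.k 1 1 * (N + p + 1).choose (N + 2) : ℂ) •
        anomaly V (fun ρ => (jacobian (vfPd ρ ξ) * jacobian η).trace) +
      (-k₂ * (N + p).choose N - 2 * (k₃ * (N + p).choose (N + 1)) -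
          K.k 1 1 * (N + p).choose (N + 2) : ℂ) •
        anomaly V (fun ρ => (jacobian (vfPd ρ ξ)).trace * (jacobian η).trace)) := by
  have hs : anomaly V (fun ρ => (jacobian (vfPd ρ η)).trace * (jacobian ξ).trace) =
      -anomaly V (fun ρ => (jacobian (vfPd ρ ξ)).trace * (jacobian η).trace) := by
    simp only [trace_jacobian_vfPd]
    exact anomaly_symm _ _
  have hg : glCocycle k₁ k₂ (jacobian ξ) (jacobian η) = fun ρ =>
      k₁ • (jacobian (vfPd ρ ξ) * jacobian η).trace +
        k₂ • ((jacobian (vfPd ρ ξ)).trace * (jacobian η).trace) := by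
    funext ρ
    rw [glCocycle, map_pd_jacobian]
  simp only [lieOp_eq_tangentMap hV]
  rw [commutator_add_add, jetLie_jetLie, jetLie_tangentMap hV hk_T, jetLie_tangentMap hV hk_T,
    tangentMap_commutator hV hk_TT, hs, hg, cocycle_jetFlow, anomaly_smul_add_smul,
    anomaly_smul_add_smul, jacobian_vfBracket, map_add, map_sub, map_sub]
  exact lie_bracket_aux ..

end Tangent

/-! ### Brackets with gauge transformations and reparametrizations -/

section Relations

variable {g : Type*} [LieRing g] [LieAlgebra ℂ g] {N p : ℕ} {K : CentralData g N p}
  {V : Type*} [AddCommGroup V] [Module ℂ V] [LieRingModule (VirKM K) V] [LieModule ℂ (VirKM K) V]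
  {ι : Type*} (J : Module.Basis ι ℂ g)

lemma tangentMap_jet_envJ (hV : IsSmoothModule K V) {k₇ : ℂ} {δ : ι → ℂ}
    (hk : ∀ (μ ν : Fin N) a, K.k (envT g μ ν) (envJ N J a) = if μ = ν then k₇ * δ a else 0)
    (D : Matrix (Fin N) (Fin N) (Fn N)) (φ : Fn N) (a : ι) :
    tangentMap hV D * jetCurrent hV (jet p φ) (envJ N J a) -
      jetCurrent hV (jet p φ) (envJ N J a) * tangentMap hV D =
      -((k₇ * δ a * (N + p).choose N) • anomaly V (fun ρ => (D.map (Fn.pd ρ)).trace * φ)) := by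
  have h : anomaly V (fun ρ => (D.map (Fn.pd ρ)).trace * φ) =
      ∑ μ, anomaly V (fun ρ => Fn.pd ρ (D μ μ) * φ) := by
    rw [← map_sum]
    congr 1
    funext ρ
    rw [Finset.sum_apply, ← Finset.sum_mul]
    rfl
  rw [h, Finset.smul_sum, ← Finset.sum_neg_distrib, tangentMap_apply, Finset.mul_sum,
    Finset.sum_mul, ← Finset.sum_sub_distrib]
  refine Finset.sum_congr rfl fun μ _ => ?_
  rw [Finset.mul_sum, Finset.sum_mul, ← Finset.sum_sub_distrib]
  simp only [jetCurrent_jet_commutator, envT_envJ_commutator, map_zero, zero_sub, hk]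
  rw [Finset.sum_eq_single μ]
  · rw [if_pos rfl]
  · intro ν _ hν
    rw [if_neg hν, zero_mul, zero_smul, neg_zero]
  · exact fun h => absurd (Finset.mem_univ _) h

variable [Fintype ι]

lemma lieOp_gaugeOp (hV : IsSmoothModule K V) {k₆ k₇ : ℂ} {δ : ι → ℂ}
    (hk_J : ∀ a, K.k (envJ N J a) 1 = k₆ * δ a)
    (hk_TJ : ∀ (μ ν : Fin N) a, K.k (envT g μ ν) (envJ N J a) = if μ = ν then k₇ * δ a else 0)
    (ξ : Fin N → Fn N) (X : ι → Fn N) :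
    lieOp K V ξ * gaugeOp K V J X - gaugeOp K V J X * lieOp K V ξ =
      gaugeOp K V J (vfAct ξ X) - ∑ a,
        ((k₇ * (N + p).choose N + k₆ * (N + p).choose (N + 1)) * δ a) •
          anomaly V (fun ρ => (jacobian (vfPd ρ ξ)).trace * X a) := by
  rw [gaugeOp_eq hV, gaugeOp_eq hV, Finset.mul_sum, Finset.sum_mul, ← Finset.sum_sub_distrib,
    ← Finset.sum_sub_distrib]
  refine Finset.sum_congr rfl fun a _ => ?_
  rw [lieOp_eq_tangentMap hV, add_mul, mul_add, add_sub_add_comm, jetLie_jet,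
    tangentMap_jet_envJ J hV hk_TJ, K.k_symm, hk_J]
  simp only [map_pd_jacobian]
  rw [← sub_eq_add_neg, sub_sub, ← add_smul]
  congr 2
  ring

lemma gaugeOp_gaugeOp (hV : IsSmoothModule K V) (X Y : ι → Fn N) :
    gaugeOp K V J X * gaugeOp K V J Y - gaugeOp K V J Y * gaugeOp K V J X =
      gaugeOp K V J (gaugeBracket J X Y) - ∑ a, ∑ b,
        (K.k (envJ N J a) (envJ N J b) * (N + p).choose N) •
          anomaly V (fun ρ => Fn.pd ρ (X a) * Y b) := by
  have h : gaugeOp K V J (gaugeBracket J X Y) = ∑ a, ∑ b,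
      jetCurrent hV (jet p (X a * Y b)) (∑ c, J.repr ⁅J a, J b⁆ c • envJ N J c) := by
    rw [gaugeOp_eq hV]
    simp only [gaugeBracket, map_sum, map_smul, LinearMap.sum_apply, LinearMap.smul_apply]
    exact Finset.sum_comm_cycle.symm.trans
      (Finset.sum_congr rfl fun a _ => Finset.sum_congr rfl fun b _ => rfl)
  rw [h, gaugeOp_eq hV, gaugeOp_eq hV, Finset.sum_mul_sum, Finset.sum_mul_sum,
    Finset.sum_comm (f := fun b a => jetCurrent hV (jet p (Y b)) _ * _), ← Finset.sum_sub_distrib,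
    ← Finset.sum_sub_distrib]
  refine Finset.sum_congr rfl fun a _ => ?_
  rw [← Finset.sum_sub_distrib, ← Finset.sum_sub_distrib]
  refine Finset.sum_congr rfl fun b _ => ?_
  rw [jetCurrent_jet_commutator, envJ_commutator]

lemma smear_smul_fnField (f : Trig) (c : ℂ) (φ : Fn N) :
    (OpField.smear f (fnField V (c • φ))).integral =
      c • (OpField.smear f (fnField V φ)).integral := (smearMap V f).map_smul c φ

lemma repOp_gaugeOp (hV : IsSmoothModule K V) (f : Trig) (X : ι → Fn N) :
    repOp K V f * gaugeOp K V J X - gaugeOp K V J X * repOp K V f = ∑ a,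
      (K.d (envJ N J a) * (N + p).choose N / (4 * Real.pi * Complex.I)) •
        (OpField.smear (f.dot.dot - Complex.I • f.dot) (fnField V (X a))).integral := by
  rw [repOp_eq, gaugeOp_eq hV, Finset.mul_sum, Finset.sum_mul, ← Finset.sum_sub_distrib]
  refine Finset.sum_congr rfl fun a _ => ?_
  rw [dilation_jetCurrent, trace_jet, smear_smul_fnField, smul_smul, div_mul_eq_mul_div]

lemma dilation_vfFlow (f : Trig) (ξ : Fin N → Fn N) :
    dilation K V f * onFock V (Fock.vfFlow ξ) - onFock V (Fock.vfFlow ξ) * dilation K V f =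
      (1 / (4 * Real.pi * Complex.I) : ℂ) • (OpField.smear (f.dot.dot - Complex.I • f.dot)
        (fnField V (jacobian ξ).trace)).integral := by
  have h1 : onFock V (Fock.flow (Fock.repField f)) * onFock V (Fock.vfFlow ξ) -
      onFock V (Fock.vfFlow ξ) * onFock V (Fock.flow (Fock.repField f)) = _ :=
    rTensor_sub_mul (U := V) (Fock.repFlow_vfFlow f ξ)
  have h2 : (virasoroAction K V f).lTensor (Fock N) * onFock V (Fock.vfFlow ξ) =
      onFock V (Fock.vfFlow ξ) * (virasoroAction K V f).lTensor (Fock N) :=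
    (rTensor_lTensor_commute _ _).symm.eq
  have h3 : (OpField.smear (f.dot.dot - Complex.I • f.dot)
      (fnField V (jacobian ξ).trace)).integral = ∑ μ,
        (OpField.smear (f.dot.dot - Complex.I • f.dot) (fnField V (Fn.pd μ (ξ μ)))).integral :=
    map_sum (smearMap V (f.dot.dot - Complex.I • f.dot)) _ _
  rw [dilation, add_mul, mul_add, h2, add_sub_add_right_eq_sub, h1, h3]
  refine (LinearMap.rTensor_smul ..).trans ?_
  simp only [OpField.integral]
  rw [← Finset.smul_sum, smul_smul]
  refine congrArg₂ (· • ·) ?_ ?_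
  · have : (Real.pi : ℂ) ≠ 0 := Complex.ofReal_ne_zero.2 Real.pi_ne_zero
    have hI := Complex.I_ne_zero
    field_simp
    linear_combination (-4 : ℂ) * Complex.I_sq
  · refine (onFock_sum V _ _).trans (Finset.sum_congr rfl fun μ _ => ?_)
    refine (onFock_sum V _ _).trans (Finset.sum_congr rfl fun k _ => ?_)
    exact LinearMap.rTensor_smul ..

lemma dilation_tangentMap (hV : IsSmoothModule K V) {d₁ : ℂ}
    (hd : ∀ μ ν : Fin N, K.d (envT g μ ν) = if μ = ν then d₁ else 0)
    (f : Trig) (D : Matrix (Fin N) (Fin N) (Fn N)) :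
    dilation K V f * tangentMap hV D - tangentMap hV D * dilation K V f =
      (d₁ * (N + p).choose N / (4 * Real.pi * Complex.I)) •
        (OpField.smear (f.dot.dot - Complex.I • f.dot) (fnField V D.trace)).integral := by
  have h : (OpField.smear (f.dot.dot - Complex.I • f.dot) (fnField V D.trace)).integral =
      ∑ μ, (OpField.smear (f.dot.dot - Complex.I • f.dot) (fnField V (D μ μ))).integral :=
    map_sum (smearMap V (f.dot.dot - Complex.I • f.dot)) _ _
  rw [h, Finset.smul_sum, tangentMap_apply, Finset.mul_sum, Finset.sum_mul,
    ← Finset.sum_sub_distrib]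
  refine Finset.sum_congr rfl fun μ _ => ?_
  rw [Finset.mul_sum, Finset.sum_mul, ← Finset.sum_sub_distrib]
  simp only [dilation_jetCurrent, trace_jet, smear_smul_fnField, smul_smul, hd]
  rw [Finset.sum_eq_single μ]
  · rw [if_pos rfl, div_mul_eq_mul_div]
  · intro ν _ hν
    rw [if_neg hν, zero_div, zero_mul, zero_smul]
  · exact fun h => absurd (Finset.mem_univ _) h

lemma repOp_lieOp (hV : IsSmoothModule K V) {d₁ : ℂ}
    (hd_T : ∀ μ ν : Fin N, K.d (envT g μ ν) = if μ = ν then d₁ else 0)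
    (f : Trig) (ξ : Fin N → Fn N) :
    repOp K V f * lieOp K V ξ - lieOp K V ξ * repOp K V f =
      ((1 + d₁ * (N + p).choose N + K.d 1 * (N + p).choose (N + 1)) / (4 * Real.pi * Complex.I)) •
        (OpField.smear (f.dot.dot - Complex.I • f.dot)
          (fnField V (jacobian ξ).trace)).integral := by
  have h := dilation_jetCurrent hV f (jetFlow p ξ) 1
  rw [trace_jetFlow, smear_smul_fnField, smul_smul] at h
  rw [repOp_eq, lieOp_eq_tangentMap hV, jetLie, mul_add, mul_add, add_mul, add_mul,
    add_sub_add_comm, add_sub_add_comm, dilation_vfFlow, dilation_tangentMap hV hd_T, h]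
  refine (congrArg₂ (· + ·) (add_smul ..).symm rfl).trans ((add_smul ..).symm.trans ?_)
  congr 1
  ring

/-- The trajectory and the module V are different tensor factors, so the cross terms vanish and the
central terms 2N/24 and c/24 add. -/
lemma repOp_repOp (hV : IsSmoothModule K V) (f h : Trig) :
    repOp K V f * repOp K V h - repOp K V h * repOp K V f = repOp K V (f * h.dot - f.dot * h) +
      ((2 * N + K.c) / (24 * Real.pi * Complex.I) *
        Trig.integral (f.dot.dot * h.dot - f.dot * h)) • (1 : Module.End ℂ (Carrier N V)) := by
  have h1 : onFock V (Fock.flow (Fock.repField f)) * onFock V (Fock.flow (Fock.repField h)) -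
      onFock V (Fock.flow (Fock.repField h)) * onFock V (Fock.flow (Fock.repField f)) =
      onFock V (Fock.flow (Fock.repField (f * h.dot - f.dot * h))) +
        (N / (12 * Real.pi * Complex.I) * Trig.integral (f.dot.dot * h.dot - f.dot * h)) •
          (1 : Module.End ℂ (Carrier N V)) := by
    refine (rTensor_sub_mul (Fock.repFlow_repFlow f h)).trans ?_
    refine (LinearMap.rTensor_add ..).trans (congrArg₂ (· + ·) rfl ?_)
    refine (LinearMap.rTensor_smul ..).trans (congrArg _ ?_)
    exact LinearMap.rTensor_id ..
  have h2 : (virasoroAction K V f).lTensor (Fock N) * (virasoroAction K V h).lTensor (Fock N) -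
      (virasoroAction K V h).lTensor (Fock N) * (virasoroAction K V f).lTensor (Fock N) =
      (virasoroAction K V (f * h.dot - f.dot * h)).lTensor (Fock N) +
        (K.c / (24 * Real.pi * Complex.I) * Trig.integral (f.dot.dot * h.dot - f.dot * h)) •
          (1 : Module.End ℂ (Carrier N V)) := by
    refine (lTensor_sub_mul (virasoro_virasoro hV f h)).trans ?_
    refine (LinearMap.lTensor_add ..).trans (congrArg₂ (· + ·) rfl ?_)
    refine (LinearMap.lTensor_smul ..).trans (congrArg _ ?_)
    exact LinearMap.lTensor_id ..
  have h3 : ∀ f h : Trig, onFock V (Fock.flow (Fock.repField f)) *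
      (virasoroAction K V h).lTensor (Fock N) - (virasoroAction K V h).lTensor (Fock N) *
        onFock V (Fock.flow (Fock.repField f)) = 0 :=
    fun f h => sub_eq_zero.2 (rTensor_lTensor_commute _ _).eq
  simp only [repOp_eq, dilation]
  rw [commutator_add_add, h1, h2, h3, h3, sub_zero, add_zero, add_add_add_comm]
  refine congrArg₂ (· + ·) rfl ((add_smul ..).symm.trans ?_)
  congr 1
  ring

end Relations

/-! ### Linearity, local finiteness and the action on functions of q(t) -/

namespace OpField

variable {W : Type*} [AddCommGroup W] [Module ℂ W]

lemma smear_add_left (f h : Trig) (B : OpField W) : smear (f + h) B = smear f B + smear h B := by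
  funext n
  exact Finsupp.sum_add_index' (fun _ => zero_smul _ _) fun _ _ _ => add_smul _ _ _

lemma smear_smul_left (a : ℂ) (f : Trig) (B : OpField W) : smear (a • f) B = a • smear f B := by
  funext n
  simp only [Pi.smul_apply, smear, Finsupp.smul_sum]
  rw [AddMonoidAlgebra.coeff_smul, Finsupp.sum_smul_index' fun k => zero_smul ℂ (B (n - k))]
  simp only [smul_assoc]

lemma neg_add_field (B C : OpField W) : -(B + C) = -B + -C := neg_add B C

lemma neg_smul_field (a : ℂ) (B : OpField W) : -(a • B) = a • -B := (smul_neg a B).symm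

end OpField

section Linearity

variable {g : Type*} [LieRing g] [LieAlgebra ℂ g] {N p : ℕ} {K : CentralData g N p}
  {V : Type*} [AddCommGroup V] [Module ℂ V] [LieRingModule (VirKM K) V] [LieModule ℂ (VirKM K) V]

lemma vfFlow_add (ξ η : Fin N → Fn N) :
    Fock.vfFlow (ξ + η) = Fock.vfFlow ξ + Fock.vfFlow η := by
  have h : (fun μ => Fock.fn ((ξ + η) μ)) =
      (fun μ => Fock.fn (ξ μ)) + fun μ => Fock.fn (η μ) := funext fun μ => Fock.fn_add _ _
  rw [Fock.vfFlow, h]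
  exact Fock.flow_add (fun _ => Fock.ann_fn _) fun _ => Fock.ann_fn _

lemma vfFlow_smul (a : ℂ) (ξ : Fin N → Fn N) : Fock.vfFlow (a • ξ) = a • Fock.vfFlow ξ := by
  have h : (fun μ => Fock.fn ((a • ξ) μ)) = a • fun μ => Fock.fn (ξ μ) :=
    funext fun μ => Fock.fn_smul _ _
  rw [Fock.vfFlow, h]
  exact Fock.flow_smul (fun _ => Fock.ann_fn _) a

lemma jetFlow_add (ξ η : Fin N → Fn N) : jetFlow p (ξ + η) = jetFlow p ξ + jetFlow p η := by
  simp only [jetFlow, Pi.add_apply, map_add, add_mul, Finset.sum_add_distrib]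

lemma jetFlow_smul (a : ℂ) (ξ : Fin N → Fn N) : jetFlow p (a • ξ) = a • jetFlow p ξ := by
  simp only [jetFlow, Pi.smul_apply, map_smul, smul_mul_assoc, Finset.smul_sum]

lemma jacobian_add (ξ η : Fin N → Fn N) : jacobian (ξ + η) = jacobian ξ + jacobian η := by
  ext1 ν μ
  exact map_add (Fn.pd ν) _ _

lemma jacobian_smul (a : ℂ) (ξ : Fin N → Fn N) : jacobian (a • ξ) = a • jacobian ξ := by
  ext1 ν μ
  exact map_smul (Fn.pd ν) _ _

lemma isLinearMap_lieOp (hV : IsSmoothModule K V) : IsLinearMap ℂ (lieOp K V) where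
  map_add ξ η := by
    simp only [lieOp_eq_tangentMap hV, jetLie, jacobian_add, jetFlow_add, map_add,
      LinearMap.add_apply]
    rw [vfFlow_add, add_add_add_comm (_ + _), add_add_add_comm (onFock V (Fock.vfFlow ξ))]
    exact congrArg₂ (· + ·) (congrArg₂ (· + ·) (LinearMap.rTensor_add ..) rfl) rfl
  map_smul a ξ := by
    simp only [lieOp_eq_tangentMap hV, jetLie, jacobian_smul, jetFlow_smul, map_smul,
      LinearMap.smul_apply]
    rw [vfFlow_smul, smul_add, smul_add]
    exact congrArg₂ (· + ·) (congrArg₂ (· + ·) (LinearMap.rTensor_smul ..) rfl) rfl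

lemma isLinearMap_gaugeOp (hV : IsSmoothModule K V) {ι : Type*} [Fintype ι]
    (J : Module.Basis ι ℂ g) : IsLinearMap ℂ (gaugeOp K V J) where
  map_add X Y := by
    simp only [gaugeOp_eq hV, Pi.add_apply, map_add, LinearMap.add_apply, Finset.sum_add_distrib]
  map_smul a X := by
    simp only [gaugeOp_eq hV, Pi.smul_apply, map_smul, LinearMap.smul_apply, Finset.smul_sum]

lemma isLinearMap_repOp : IsLinearMap ℂ (repOp K V) where
  map_add f h := by
    have e : (Fock.repField (f + h) : Fin N → OpField (Fock N)) = Fock.repField f + Fock.repField h :=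
      funext fun μ => (congrArg Neg.neg (OpField.smear_add_left f h _)).trans
        (OpField.neg_add_field _ _)
    rw [repOp_eq, repOp_eq, repOp_eq, dilation, dilation, dilation, e, map_add,
      Fock.flow_add (Fock.ann_repField f) (Fock.ann_repField h), add_add_add_comm]
    exact congrArg₂ (· + ·) (LinearMap.rTensor_add ..) (LinearMap.lTensor_add ..)
  map_smul a f := by
    have e : (Fock.repField (a • f) : Fin N → OpField (Fock N)) = a • Fock.repField (N := N) f :=
      funext fun μ => (congrArg Neg.neg (OpField.smear_smul_left a f _)).trans
        (OpField.neg_smul_field _ _)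
    rw [repOp_eq, repOp_eq, dilation, dilation, e, map_smul,
      Fock.flow_smul (Fock.ann_repField f), smul_add]
    exact congrArg₂ (· + ·) (LinearMap.rTensor_smul ..) (LinearMap.lTensor_smul ..)

lemma wellDefined (hV : IsSmoothModule K V) : WellDefined K V where
  coord := Fock.fn_coord
  taylor := Fock.locFin_taylorTerm
  normal_fn φ := Fock.locFin_normalTerm (Fock.ann_fn φ)
  normal_q f μ := Fock.locFin_normalTerm (OpField.ann_smear (Fock.ann_qField μ).dot f) μ
  pairing φ M := OpField.locFin_mulTerm (ann_fnField φ) (ann_curField hV M)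
    (fcomm_fnField_curField φ M)

lemma fnField_one (n : ℤ) : fnField V (1 : Fn N) n = if n = 0 then 1 else 0 := by
  rw [fnField, Fock.fn_one]
  split_ifs
  · exact LinearMap.rTensor_id ..
  · exact LinearMap.rTensor_zero ..

lemma fnField_dot (φ : Fn N) : (fnField V φ).dot =
    ∑ μ, OpField.mul (fnField V (Fn.coord μ)).dot (fnField V (Fn.pd μ φ)) := by
  funext n
  rw [dot_fnField, Fock.fn_dot, Finset.sum_apply]
  simp only [Finset.sum_apply, ← onFock_dot_mul, Fock.fn_coord]
  exact map_sum (LinearMap.rTensorHom V) _ _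

lemma commute_pairing_fnField (hV : IsSmoothModule K V) (φ ψ : Fn N) (M : EnvMat g N p) (n : ℤ) :
    Commute (pairing K V φ M) (fnField V ψ n) :=
  (OpField.FComm.mul_right (ann_fnField φ) (ann_curField hV M) (fcomm_fnField_curField φ M)
    (fcomm_fnField ψ φ) (fcomm_fnField_curField ψ M) n 0).symm.smul_left _

lemma commute_jetCurrent_fnField (hV : IsSmoothModule K V) (M : FnMat N p) (u : Env g N)
    (ψ : Fn N) (n : ℤ) : Commute (jetCurrent hV M u) (fnField V ψ n) := by
  rw [jetCurrent_apply]
  exact Commute.sum_left _ _ _ fun m _ => Commute.sum_left _ _ _ fun r _ =>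
    commute_pairing_fnField hV ..

/-- Only the flow contains momenta; all current terms commute with functions of q(t). -/
lemma lieOp_fnField (hV : IsSmoothModule K V) (ξ : Fin N → Fn N) (φ : Fn N) (n : ℤ) :
    lieOp K V ξ * fnField V φ n - fnField V φ n * lieOp K V ξ =
      fnField V (∑ μ, ξ μ * Fn.pd μ φ) n := by
  have h : Commute (tangentMap hV (jacobian ξ)) (fnField V φ n) := by
    rw [tangentMap_apply]
    exact Commute.sum_left _ _ _ fun μ _ => Commute.sum_left _ _ _ fun ν _ =>
      commute_jetCurrent_fnField hV ..
  rw [lieOp_eq_tangentMap hV, jetLie, add_mul, add_mul, mul_add, mul_add, h.eq,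
    (commute_jetCurrent_fnField hV _ _ φ n).eq, add_sub_add_right_eq_sub, add_sub_add_right_eq_sub]
  exact rTensor_sub_mul (Fock.vfFlow_fn ξ φ n)

lemma gaugeOp_fnField (hV : IsSmoothModule K V) {ι : Type*} [Fintype ι] (J : Module.Basis ι ℂ g)
    (X : ι → Fn N) (φ : Fn N) (n : ℤ) :
    gaugeOp K V J X * fnField V φ n - fnField V φ n * gaugeOp K V J X = 0 := by
  rw [gaugeOp_eq hV]
  exact sub_eq_zero.2 (Commute.sum_left _ _ _ fun a _ => commute_jetCurrent_fnField hV ..).eq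

lemma sum_mul_pd_coord (ξ : Fin N → Fn N) (μ : Fin N) :
    ∑ ν, ξ ν * Fn.pd ν (Fn.coord μ) = ξ μ := by
  simp only [Fn.pd_coord, mul_ite, mul_one, mul_zero]
  exact (Finset.sum_ite_eq' _ _ _).trans (if_pos (Finset.mem_univ _))

lemma trajectoryIntegral_sum {κ : Type*} (s : Finset κ) (ρ : Fin N) (F : κ → Fn N) :
    trajectoryIntegral (fnField V) ρ (∑ i ∈ s, F i) =
      ∑ i ∈ s, trajectoryIntegral (fnField V) ρ (F i) := map_sum (trajectoryMap V ρ) _ _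

end Linearity

/-! ### The relations in index form -/

section Realized

variable {g : Type*} [LieRing g] [LieAlgebra ℂ g] {N p : ℕ} {K : CentralData g N p}
  {V : Type*} [AddCommGroup V] [Module ℂ V] [LieRingModule (VirKM K) V] [LieModule ℂ (VirKM K) V]
  {ι : Type*} [Fintype ι] (J : Module.Basis ι ℂ g)

lemma smul_sum_smul_add_smul {W : Type*} [AddCommGroup W] [Module ℂ W] {κ : Type*} (s : Finset κ)
    (z a b : ℂ) (F G : κ → κ → κ → W) :
    z • ∑ ρ ∈ s, ∑ μ ∈ s, ∑ ν ∈ s, (a • F ρ μ ν + b • G ρ μ ν) =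
      a • z • ∑ ρ ∈ s, ∑ μ ∈ s, ∑ ν ∈ s, F ρ μ ν + b • z • ∑ ρ ∈ s, ∑ μ ∈ s, ∑ ν ∈ s, G ρ μ ν := by
  simp only [Finset.sum_add_distrib, ← Finset.smul_sum]
  rw [smul_add, smul_comm z a, smul_comm z b]

lemma trace_jacobian_mul_jacobian (ρ : Fin N) (ξ η : Fin N → Fn N) :
    (jacobian (vfPd ρ ξ) * jacobian η).trace =
      ∑ μ, ∑ ν, Fn.pd ρ (Fn.pd ν (ξ μ)) * Fn.pd μ (η ν) := by
  rw [← map_pd_jacobian, Finset.sum_comm]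
  rfl

lemma trace_jacobian_mul_trace_jacobian (ρ : Fin N) (ξ η : Fin N → Fn N) :
    (jacobian (vfPd ρ ξ)).trace * (jacobian η).trace =
      ∑ μ, ∑ ν, Fn.pd ρ (Fn.pd μ (ξ μ)) * Fn.pd ν (η ν) := by
  rw [← map_pd_jacobian, Matrix.trace, Matrix.trace, Finset.sum_mul_sum]
  rfl

lemma anomaly_jacobian (a b : ℂ) (ξ η : Fin N → Fn N) :
    (1 / (2 * Real.pi * Complex.I) : ℂ) • ∑ ρ, ∑ μ, ∑ ν,
      (a • trajectoryIntegral (fnField V) ρ (Fn.pd ρ (Fn.pd ν (ξ μ)) * Fn.pd μ (η ν)) +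
        b • trajectoryIntegral (fnField V) ρ (Fn.pd ρ (Fn.pd μ (ξ μ)) * Fn.pd ν (η ν))) =
    a • anomaly V (fun ρ => (jacobian (vfPd ρ ξ) * jacobian η).trace) +
      b • anomaly V (fun ρ => (jacobian (vfPd ρ ξ)).trace * (jacobian η).trace) := by
  refine (smul_sum_smul_add_smul ..).trans ?_
  simp only [anomaly_apply, trace_jacobian_mul_jacobian, trace_jacobian_mul_trace_jacobian,
    trajectoryIntegral_sum]

lemma anomaly_gauge {δ : ι → ℂ} (c : ℂ) (ξ : Fin N → Fn N) (X : ι → Fn N) :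
    (c / (2 * Real.pi * Complex.I)) • ∑ a, ∑ ρ, ∑ μ,
      δ a • trajectoryIntegral (fnField V) ρ (X a * Fn.pd ρ (Fn.pd μ (ξ μ))) =
    ∑ a, (c * δ a) • anomaly V (fun ρ => (jacobian (vfPd ρ ξ)).trace * X a) := by
  have h : ∀ ρ a, (jacobian (vfPd ρ ξ)).trace * X a =
      ∑ μ, X a * Fn.pd ρ (Fn.pd μ (ξ μ)) := fun ρ a => by
    rw [← map_pd_jacobian, mul_comm, Matrix.trace, Finset.mul_sum]
    rfl
  rw [Finset.smul_sum]
  refine Finset.sum_congr rfl fun a _ => ?_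
  simp only [anomaly_apply, h, trajectoryIntegral_sum, ← Finset.smul_sum]
  rw [smul_smul, smul_smul]
  congr 1
  ring

lemma isDGRO (δ₂ : LinearMap.BilinForm ℂ g) (δ₁ : g →ₗ[ℂ] ℂ)
    {k₁ k₂ k₃ k₄ k₅ k₆ k₇ k₈ d₀ d₁ d₂ : ℂ}
    (hk_TT : ∀ μ ν ρ σ : Fin N, K.k (envT g μ ν) (envT g ρ σ) =
      (if μ = σ ∧ ρ = ν then k₁ else 0) + (if μ = ν ∧ ρ = σ then k₂ else 0))
    (hk_T : ∀ μ ν : Fin N, K.k (envT g μ ν) 1 = if μ = ν then k₃ else 0)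
    (hk_one : K.k 1 1 = k₄)
    (hk_JJ : ∀ a b, K.k (envJ N J a) (envJ N J b) =
      k₅ * δ₂ (J a) (J b) + k₈ * δ₁ (J a) * δ₁ (J b))
    (hk_J : ∀ a, K.k (envJ N J a) 1 = k₆ * δ₁ (J a))
    (hk_TJ : ∀ (μ ν : Fin N) a, K.k (envT g μ ν) (envJ N J a) =
      if μ = ν then k₇ * δ₁ (J a) else 0)
    (hd_one : K.d 1 = d₀)
    (hd_T : ∀ μ ν : Fin N, K.d (envT g μ ν) = if μ = ν then d₁ else 0)
    (hd_J : ∀ a, K.d (envJ N J a) = d₂ * δ₁ (J a)) (hV : IsSmoothModule K V) :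
    IsDGRO J δ₂ δ₁
      { c₁ := 1 - k₁ * (N + p).choose N - k₄ * (N + p + 1).choose (N + 2)
        c₂ := -k₂ * (N + p).choose N - 2 * k₃ * (N + p).choose (N + 1)
          - k₄ * (N + p).choose (N + 2)
        c₃ := 1 + d₁ * (N + p).choose N + d₀ * (N + p).choose (N + 1)
        c₄ := 2 * N + K.c
        c₅ := k₅ * (N + p).choose N
        c₆ := d₂ * (N + p).choose N
        c₇ := k₇ * (N + p).choose N + k₆ * (N + p).choose (N + 1)
        c₈ := k₈ * (N + p).choose N }
      (fnField V) (lieOp K V) (gaugeOp K V J) (repOp K V) where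
  obs_linear := (fnFieldLinear V).isLinear
  lie_linear := isLinearMap_lieOp hV
  gauge_linear := isLinearMap_gaugeOp hV J
  rep_linear := isLinearMap_repOp
  obs_one := fnField_one
  obs_mul_locFin φ ψ := OpField.locFin_mulTerm (ann_fnField φ) (ann_fnField ψ) (fcomm_fnField φ ψ)
  obs_mul := fnField_mul
  obs_dot_locFin ρ φ := OpField.locFin_mulTerm (ann_fnField _).dot (ann_fnField φ)
    (fcomm_fnField _ φ).dot_left
  obs_dot := fnField_dot
  lie_lie ξ η := by
    refine (Ring.lie_def _ _).trans ((lieOp_lieOp hV hk_TT hk_T ξ η).trans ?_)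
    rw [anomaly_jacobian, hk_one, mul_assoc 2 k₃]
  lie_gauge ξ X := by
    refine (Ring.lie_def _ _).trans ((lieOp_gaugeOp J hV hk_J hk_TJ ξ X).trans ?_)
    rw [← anomaly_gauge]
  gauge_gauge X Y := by
    refine (Ring.lie_def _ _).trans ((gaugeOp_gaugeOp J hV X Y).trans (congrArg _ ?_))
    rw [Finset.smul_sum]
    refine Finset.sum_congr rfl fun a _ => ?_
    rw [Finset.smul_sum]
    refine Finset.sum_congr rfl fun b _ => ?_
    rw [← Finset.smul_sum, hk_JJ, anomaly_apply, smul_comm]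
    congr 2
    ring
  rep_lie f ξ := by
    refine (Ring.lie_def _ _).trans ((repOp_lieOp hV hd_T f ξ).trans ?_)
    rw [hd_one]
    exact congrArg _ (map_sum (smearMap V (f.dot.dot - Complex.I • f.dot)) _ _)
  rep_gauge f X := by
    refine (Ring.lie_def _ _).trans ((repOp_gaugeOp J hV f X).trans ?_)
    rw [Finset.smul_sum]
    refine Finset.sum_congr rfl fun a _ => ?_
    rw [hd_J, smul_smul]
    congr 1
    ring
  rep_rep f h := (Ring.lie_def _ _).trans (repOp_repOp hV f h)
  lie_q ξ μ n := by
    refine (Ring.lie_def _ _).trans ((lieOp_fnField hV ξ _ n).trans ?_)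
    rw [sum_mul_pd_coord]
  rep_q f μ n := (Ring.lie_def _ _).trans (repOp_eq (K := K) (V := V) f ▸ dilation_fnField f _ n)
  gauge_q X μ n := (Ring.lie_def _ _).trans (gaugeOp_fnField hV J X _ n)
  q_q μ ν m n := (Ring.lie_def _ _).trans (sub_eq_zero.2 (fcomm_fnField _ _ m n).eq)
  lie_obs ξ φ n := (Ring.lie_def _ _).trans (lieOp_fnField hV ξ φ n)
  rep_obs f φ n := (Ring.lie_def _ _).trans (repOp_eq (K := K) (V := V) f ▸ dilation_fnField f φ n)
  gauge_obs X φ n := (Ring.lie_def _ _).trans (gaugeOp_fnField hV J X φ n)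
  obs_obs φ ψ m n := (Ring.lie_def _ _).trans (sub_eq_zero.2 (fcomm_fnField φ ψ m n).eq)

end Realized

end DGRO

end

theorem theorem3p1 {g : Type*} [LieRing g] [LieAlgebra ℂ g] {ι : Type*} [Fintype ι]
    (J : Module.Basis ι ℂ g) (δ₂ : LinearMap.BilinForm ℂ g) (δ₁ : g →ₗ[ℂ] ℂ)
    (hδ₂_symm : ∀ x y : g, δ₂ x y = δ₂ y x) (hδ₂_inv : ∀ x y z : g, δ₂ ⁅x, y⁆ z = δ₂ x ⁅y, z⁆)
    (hδ₁ : ∀ x y : g, δ₁ ⁅x, y⁆ = 0)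
    (N p : ℕ) (K : CentralData g N p) (k₁ k₂ k₃ k₄ k₅ k₆ k₇ k₈ d₀ d₁ d₂ : ℂ)
    (hk_TT : ∀ μ ν ρ σ : Fin N, K.k (envT g μ ν) (envT g ρ σ) =
      (if μ = σ ∧ ρ = ν then k₁ else 0) + (if μ = ν ∧ ρ = σ then k₂ else 0))
    (hk_T : ∀ μ ν : Fin N, K.k (envT g μ ν) 1 = if μ = ν then k₃ else 0)
    (hk_one : K.k 1 1 = k₄)
    (hk_JJ : ∀ a b, K.k (envJ N J a) (envJ N J b) =
      k₅ * δ₂ (J a) (J b) + k₈ * δ₁ (J a) * δ₁ (J b))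
    (hk_J : ∀ a, K.k (envJ N J a) 1 = k₆ * δ₁ (J a))
    (hk_TJ : ∀ (μ ν : Fin N) a, K.k (envT g μ ν) (envJ N J a) =
      if μ = ν then k₇ * δ₁ (J a) else 0)
    (hd_one : K.d 1 = d₀)
    (hd_T : ∀ μ ν : Fin N, K.d (envT g μ ν) = if μ = ν then d₁ else 0)
    (hd_J : ∀ a, K.d (envJ N J a) = d₂ * δ₁ (J a))
    (V : Type*) [AddCommGroup V] [Module ℂ V] [LieRingModule (VirKM K) V]
    [LieModule ℂ (VirKM K) V] (hV : IsSmoothModule K V) :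
    WellDefined K V ∧
    IsDGRO J δ₂ δ₁
      { c₁ := 1 - k₁ * (N + p).choose N - k₄ * (N + p + 1).choose (N + 2)
        c₂ := -k₂ * (N + p).choose N - 2 * k₃ * (N + p).choose (N + 1)
          - k₄ * (N + p).choose (N + 2)
        c₃ := 1 + d₁ * (N + p).choose N + d₀ * (N + p).choose (N + 1)
        c₄ := 2 * N + K.c
        c₅ := k₅ * (N + p).choose N
        c₆ := d₂ * (N + p).choose N
        c₇ := k₇ * (N + p).choose N + k₆ * (N + p).choose (N + 1)
        c₈ := k₈ * (N + p).choose N }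
      (fnField V) (lieOp K V) (gaugeOp K V J) (repOp K V) := by
  exact ⟨wellDefined hV, isDGRO J δ₂ δ₁ hk_TT hk_T hk_one hk_JJ hk_J hk_TJ hd_one hd_T hd_J hV⟩
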